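/- For $k\ge 0$ let $D^k$ be the closed unit ball of $\mathbb R^k$, let $\overline{\mathbb D}$ be the closed unit disc of $\mathbb C$, and let $\mathbf T^n=(\mathbb R/\mathbb Z)\times D^{n-1}$ be the closed solid torus. For $\lambda\in(0,1)$ put $B_\lambda=\{z\in\mathbb C: |z|\le 2(1-\lambda)^{-1}\}$, $B_\lambda^*=B_\lambda\setminus\{0\}$ and $\widetilde B_\lambda=\{z\in\mathbb C:(1-\lambda)/2\le|z|\le 2(1-\lambda)^{-1}-1-\lambda/2\}$. For $n\ge 5$, $\eta>\sigma>0$, $\mu\in(0,\sigma]$, $\beta,\beta_0,\beta_1>0$ and $(z,w,v)\in\mathbb C\times\mathbb C\times\mathbb R^{n-5}$ with $z\ne0$ put $$\widehat F_{\lambda,\mu}(z,w,v)=\Big((1-\lambda+\lambda|z|^{\mu/\sigma})\big(\tfrac{z}{|z|}\big)^2+1,\ \tfrac{z}{2|z|}+\beta|z|^{\eta/\sigma}\tfrac{|z|}{z}w,\ \beta|z|^{\eta/\sigma}v\Big),$$ $$\widehat T_{\lambda,\mu}(z,w,v)=\Big((1-\lambda+\lambda|z|^{\mu/\sigma})\tfrac{z}{|z|},\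 \beta_0|z|^{\eta/\sigma}w,\ \beta_0|z|^{\eta/\sigma}v\Big),\qquad \widehat G_\dagger(z,w,v)=\Big(\tfrac{z^2}{|z|}+1,\ \tfrac{z}{2|z|}+\beta_1\tfrac{|z|}{z}w,\ \beta_1v\Big).$$ **Theorem.** Let $n\ge5$ be an integer and let $\eta>\sigma>0$. For every $\lambda\in(0,1)$ sufficiently close to $1$ and every $\beta>0$ sufficiently small (depending on $\lambda$) there are $\beta_0\in(0,1)$ and $\beta_1\in(0,1/2)$ with $\beta_0\beta_1=\beta$, a number $\mu_0\in(0,\sigma)$, an open set $\mathbf U\subset\mathbf T^n$ whose closure lies in the interior of $\mathbf T^n$ and whose boundary is a smooth manifold of dimension $n-1$, an open neighbourhood $\mathbf V\subset\mathbf T^n$ of $\overline{\mathbf U}$, and a smooth one-parameter family of smooth vector fields $X_{\lambda,\mu}$, $\mu\in[\mu_0,\sigma]$, on $\mathbf V$ such that for every $\mu\in[\mu_0,\sigma]$ the following hold. 1. $X_{\lambda,\mu}$ points inward on $\partial\mathbf U$. It has a unique singularity $o$ in $\mathbf V$; moreover $o\in\mathbf U$, and $o$ is hyperbolic, with eigenvalues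 $-\mu$, $\sigma$, $-\eta$ of (algebraic) multiplicities $1$, $2$, $n-3$, respectively. 2. There are smooth submanifolds $\Sigma^u\cong B_\lambda\times\overline{\mathbb D}\times D^{n-5}$ and $\Sigma^s\cong\widetilde B_\lambda\times\overline{\mathbb D}\times D^{n-5}$ (with boundary and corners) of $\mathbf U$, of codimension $1$ and transversal to $X_{\lambda,\mu}$, and a local stable manifold $W^s_{loc}(o)$ of $o$ (of codimension $2$), such that every point of $\mathbf U$ has a complete forward orbit in $\mathbf U$, which intersects $\Sigma^u$ or is contained in $W^s_{loc}(o)$. Moreover $W^s_{loc}(o)\cap\Sigma^u=\{0\}\times\overline{\mathbb D}\times D^{n-5}$. 3. In these parametrizations, the Poincaré map from $\Sigma^u$ to $\Sigma^s$ is $\widehat T_{\lambda,\mu}:B_\lambda^*\times\overline{\mathbb D}\times D^{n-5}\to\widetilde B_\lambda\times\overline{\mathbb D}\times D^{n-5}$, the Poincaré map from $\Sigma^s$ to $\Sigma^u$ is $\widehat G_\dagger:\widetilde B_\lambda\times\overline{\mathbb D}\times D^{n-5}\to B_\lambda\times\overline{\mathbb D}\times D^{n-5}$, and the first return map to $\Sigma^u$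 is $\widehat F_{\lambda,\mu}=\widehat G_\dagger\circ\widehat T_{\lambda,\mu}:B_\lambda^*\times\overline{\mathbb D}\times D^{n-5}\to B_\lambda\times\overline{\mathbb D}\times D^{n-5}$; orbits of points of $\{0\}\times\overline{\mathbb D}\times D^{n-5}\subset\Sigma^u$ never reach $\Sigma^s$ and never return to $\Sigma^u$. -/

import Mathlib

open Set Filter Topology
open scoped ContDiff

namespace WildLorenz

noncomputable section

/-! ### The solid torus and vector fields on it -/

/-- The universal cover `ℝ × ℝ^(n-1)` of `ℝ/ℤ × ℝ^(n-1)`; it is also the tangent space at every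
point of `ℝ/ℤ × ℝ^(n-1)`, whose tangent bundle is trivial. -/
abbrev Cover (n : ℕ) : Type := ℝ × EuclideanSpace ℝ (Fin (n - 1))

/-- The manifold `ℝ/ℤ × ℝ^(n-1)`. -/
abbrev Ambient (n : ℕ) : Type := AddCircle (1 : ℝ) × EuclideanSpace ℝ (Fin (n - 1))

/-- The covering map `ℝ × ℝ^(n-1) → ℝ/ℤ × ℝ^(n-1)`. -/
def proj {n : ℕ} (x : Cover n) : Ambient n := ((x.1 : AddCircle (1 : ℝ)), x.2)

/-- The closed solid torus `ℝ/ℤ × D^(n-1)`. -/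
def solidTorus (n : ℕ) : Set (Ambient n) := univ ×ˢ Metric.closedBall 0 1

/-- The periodic lift to the cover of a vector field on `ℝ/ℤ × ℝ^(n-1)`. -/
def liftField {n : ℕ} (X : Ambient n → Cover n) (x : Cover n) : Cover n := X (proj x)

/-- The family `X μ`, `μ ∈ I`, of vector fields on the open set `V` is smooth, jointly in the
parameter and in the point. -/
def IsSmoothFamily {n : ℕ} (X : ℝ → Ambient n → Cover n) (I : Set ℝ) (V : Set (Ambient n)) : Prop :=
  ContDiffOn ℝ ∞ (fun p : ℝ × Cover n => liftField (X p.1) p.2) (I ×ˢ (proj ⁻¹' V))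

/-- Near the point `proj x`, the set `U` is the sublevel set `{g < 0}` of a smooth function `g`
without critical point at `x`, with `g x = 0`. (Thus near `proj x` the boundary of `U` is the
smooth hypersurface `{g = 0}`, and `U` lies on one side of it.) -/
def IsBoundaryFunctionAt {n : ℕ} (U : Set (Ambient n)) (x : Cover n) (g : Cover n → ℝ) : Prop :=
  g x = 0 ∧ fderiv ℝ g x ≠ 0 ∧
    ∃ O : Set (Cover n), IsOpen O ∧ x ∈ O ∧ ContDiffOn ℝ ∞ g O ∧
      ∀ y ∈ O, proj y ∈ U ↔ g y < 0

/-- The boundary of the open set `U` is a smooth manifold of dimension `n - 1`. -/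
def HasSmoothBoundary {n : ℕ} (U : Set (Ambient n)) : Prop :=
  ∀ x : Cover n, proj x ∈ frontier U → ∃ g, IsBoundaryFunctionAt U x g

/-- The vector field `X` points (strictly) inward on the boundary of `U`. -/
def PointsInward {n : ℕ} (X : Ambient n → Cover n) (U : Set (Ambient n)) : Prop :=
  ∀ x : Cover n, proj x ∈ frontier U →
    ∃ g, IsBoundaryFunctionAt U x g ∧ fderiv ℝ g x (liftField X x) < 0

/-- `S` is a smooth embedded submanifold of codimension `k`. -/
def IsSubmanifoldOfCodim {n : ℕ} (k : ℕ) (S : Set (Ambient n)) : Prop :=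
  ∀ x : Cover n, proj x ∈ S →
    ∃ (O : Set (Cover n)) (f : Cover n → EuclideanSpace ℝ (Fin k)),
      IsOpen O ∧ x ∈ O ∧ ContDiffOn ℝ ∞ f O ∧ Function.Surjective (fderiv ℝ f x) ∧
        ∀ y ∈ O, proj y ∈ S ↔ f y = 0

/-! ### Orbits, singularities, local stable manifolds, Poincaré maps -/

/-- `γ` restricted to `[0, ∞)` is (the lift of) a complete forward orbit of `X` that stays
in `U`. -/
def IsForwardOrbit {n : ℕ} (X : Ambient n → Cover n) (U : Set (Ambient n)) (γ : ℝ → Cover n) :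
    Prop :=
  IsIntegralCurveOn γ (fun _ => liftField X) (Ici 0) ∧ ∀ t : ℝ, 0 ≤ t → proj (γ t) ∈ U

/-- The linear part of `X` at the point `proj x`. -/
def linearPart {n : ℕ} (X : Ambient n → Cover n) (x : Cover n) : Cover n →ₗ[ℝ] Cover n :=
  (fderiv ℝ (liftField X) x).toLinearMap

/-- `proj x` is a hyperbolic singularity of `X`: the field vanishes there and its linear part has
no eigenvalue on the imaginary axis. -/
def IsHyperbolicSingularity {n : ℕ} (X : Ambient n → Cover n) (x : Cover n) : Prop :=
  liftField X x = 0 ∧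
    ∀ c : ℂ, ((linearPart X x).charpoly.map (algebraMap ℝ ℂ)).IsRoot c → c.re ≠ 0

/-- `W` is a local stable manifold, of codimension `k`, of the singularity `o` of the field `X`
on `U`: it is the set of all points of some open neighbourhood `N ⊆ U` of `o` whose forward orbit
stays in `N` and converges to `o`, and this set is a submanifold of codimension `k`. -/
def IsLocalStableManifold {n : ℕ} (X : Ambient n → Cover n) (U : Set (Ambient n)) (o : Ambient n)
    (k : ℕ) (W : Set (Ambient n)) : Prop :=
  IsSubmanifoldOfCodim k W ∧
    ∃ N : Set (Ambient n), IsOpen N ∧ o ∈ N ∧ N ⊆ U ∧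
      ∀ p : Ambient n, p ∈ W ↔
        ∃ γ : ℝ → Cover n, proj (γ 0) = p ∧ IsForwardOrbit X N γ ∧
          Tendsto (fun t => proj (γ t)) atTop (𝓝 o)

/-- The model space `ℂ × ℂ × ℝ^(n-5)` of the cross-sections. -/
abbrev Sec (n : ℕ) : Type := ℂ × ℂ × EuclideanSpace ℝ (Fin (n - 5))

/-- The image in `ℝ/ℤ × ℝ^(n-1)` of `A ⊆ ℂ × ℂ × ℝ^(n-5)` under the map with lift `Φ`. -/
def sectionSet {n : ℕ} (Φ : Sec n → Cover n) (A : Set (Sec n)) : Set (Ambient n) :=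
  (fun p => proj (Φ p)) '' A

/-- `proj ∘ Φ` is a smooth embedding of the compact set `A ⊆ ℂ × ℂ × ℝ^(n-5)` into `U` as a
submanifold of codimension one (with boundary and corners, as `A`) that is transversal to `X`. -/
def IsCrossSection {n : ℕ} (X : Ambient n → Cover n) (U : Set (Ambient n)) (Φ : Sec n → Cover n)
    (A : Set (Sec n)) : Prop :=
  ContDiff ℝ ∞ Φ ∧ InjOn (fun p => proj (Φ p)) A ∧ sectionSet Φ A ⊆ U ∧
    ∀ p ∈ A, Function.Injective (fderiv ℝ Φ p) ∧
      liftField X (Φ p) ∉ range (fderiv ℝ Φ p)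

/-- In the parametrizations `Φ` and `Ψ`, the Poincaré map from `Φ(A)` to `Ψ(B)` of the flow of `X`
in `U` has domain `A' ⊆ A` and is given by `f : A' → B`: the forward orbit of `Φ(p)`, for
`p ∈ A'`, meets `Ψ(B)` at a positive time, for the first time at `Ψ(f p)`, and for `p ∈ A \ A'`
it does not meet `Ψ(B)` at any positive time. With `Φ = Ψ` and `A = B` this is the first
return map. -/
def IsPoincareMap {n : ℕ} (X : Ambient n → Cover n) (U : Set (Ambient n))
    (Φ : Sec n → Cover n) (A : Set (Sec n)) (Ψ : Sec n → Cover n) (B : Set (Sec n))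
    (A' : Set (Sec n)) (f : Sec n → Sec n) : Prop :=
  A' ⊆ A ∧ MapsTo f A' B ∧
  (∀ p ∈ A', ∃ γ : ℝ → Cover n, IsForwardOrbit X U γ ∧ proj (γ 0) = proj (Φ p) ∧
    ∃ t : ℝ, 0 < t ∧ proj (γ t) = proj (Ψ (f p)) ∧
      ∀ s : ℝ, 0 < s → s < t → proj (γ s) ∉ sectionSet Ψ B) ∧
  (∀ p ∈ A \ A', ∃ γ : ℝ → Cover n, IsForwardOrbit X U γ ∧ proj (γ 0) = proj (Φ p) ∧
    ∀ s : ℝ, 0 < s → proj (γ s) ∉ sectionSet Ψ B)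

/-! ### The explicit model maps -/

/-- `B_λ = {|z| ≤ 2 (1 - λ)⁻¹}`. -/
def ballB (lam : ℝ) : Set ℂ := {z | ‖z‖ ≤ 2 * (1 - lam)⁻¹}

/-- The annulus `{(1 - λ)/2 ≤ |z| ≤ 2 (1 - λ)⁻¹ - 1 - λ/2}`. -/
def annulusB (lam : ℝ) : Set ℂ :=
  {z | (1 - lam) / 2 ≤ ‖z‖ ∧ ‖z‖ ≤ 2 * (1 - lam)⁻¹ - 1 - lam / 2}

/-- `C × 𝔻̄ × D^(n-5)`, where `𝔻̄` and `D^(n-5)` are the closed unit balls of `ℂ`, `ℝ^(n-5)`. -/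
def secOver (n : ℕ) (C : Set ℂ) : Set (Sec n) :=
  C ×ˢ (Metric.closedBall 0 1 ×ˢ Metric.closedBall 0 1)

/-- `F_{λ,μ}(z) = (1 - λ + λ |z|^(μ/σ)) (z/|z|)² + 1`. -/
def mapF (sigma lam mu : ℝ) (z : ℂ) : ℂ :=
  ((1 - lam + lam * ‖z‖ ^ (mu / sigma) : ℝ) : ℂ) * (z / (‖z‖ : ℂ)) ^ 2 + 1

/-- `F̂_{λ,μ}(z,w,v) = (F_{λ,μ}(z), z/(2|z|) + β |z|^(η/σ) (|z|/z) w, β |z|^(η/σ) v)`. -/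
def mapFhat (n : ℕ) (eta sigma beta lam mu : ℝ) (p : Sec n) : Sec n :=
  (mapF sigma lam mu p.1,
    p.1 / (2 * (‖p.1‖ : ℂ))
      + ((beta * ‖p.1‖ ^ (eta / sigma) : ℝ) : ℂ) * ((‖p.1‖ : ℂ) / p.1) * p.2.1,
    (beta * ‖p.1‖ ^ (eta / sigma)) • p.2.2)

/-- `T_{λ,μ}(z) = (1 - λ + λ |z|^(μ/σ)) (z/|z|)`. -/
def mapT (sigma lam mu : ℝ) (z : ℂ) : ℂ :=
  ((1 - lam + lam * ‖z‖ ^ (mu / sigma) : ℝ) : ℂ) * (z / (‖z‖ : ℂ))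

/-- `T̂_{λ,μ}(z,w,v) = (T_{λ,μ}(z), β₀ |z|^(η/σ) w, β₀ |z|^(η/σ) v)`. -/
def mapThat (n : ℕ) (eta sigma beta₀ lam mu : ℝ) (p : Sec n) : Sec n :=
  (mapT sigma lam mu p.1, ((beta₀ * ‖p.1‖ ^ (eta / sigma) : ℝ) : ℂ) * p.2.1,
    (beta₀ * ‖p.1‖ ^ (eta / sigma)) • p.2.2)

/-- `G_†(z) = z²/|z| + 1`. -/
def mapG (z : ℂ) : ℂ := z ^ 2 / (‖z‖ : ℂ) + 1

/-- `Ĝ_†(z,w,v) = (G_†(z), z/(2|z|) + β₁ (|z|/z) w, β₁ v)`. -/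
def mapGhat (n : ℕ) (beta₁ : ℝ) (p : Sec n) : Sec n :=
  (mapG p.1, p.1 / (2 * (‖p.1‖ : ℂ)) + (beta₁ : ℂ) * ((‖p.1‖ : ℂ) / p.1) * p.2.1,
    beta₁ • p.2.2)

end

end WildLorenz

open WildLorenz

namespace WildLorenz
noncomputable section

/-! ### Smooth steps -/

/-! The field is built in coordinates (h, z, w, v) on ℝ × ℂ × ℂ × ℝ^(n-5), with period 13 in the
height h. At the end h is divided by 13 and the bounded fibre is squeezed linearly into the unit
ball. Orbits descend through a block that contains the singularity, then through a tube that folds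
the outgoing flow back onto the top of the block.

Block. The coefficients depend only on h, x = |z|² and μ, and are chosen so that the flow has
explicit first integrals. Near the origin the field is (-μh, σz, -ηw, -ηv); high up it is (-1, 0).
In between, the argument of z, the function `Iq` and the vector `pw` • (w, v) are conserved
(`conserved`). At the entrance h = 4 the last two are cs |z|^(μ/σ) and β |z|^(η/σ) (w, v); on the
cylinder |z| = R3 they are the height and (w, v) themselves. If a height I is read as the radius 1 -
λ + λ I / cs, and the fibre of the exit section is scaled by β₁ = ε, the passage to the cylinder is
exactly T̂ with β₀ = β / ε. Beyond the cylinder a bending term, active where T = |z|² exp(-2σh) is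
large, turns the field vertical again. It conserves h + `ps`, so the exit height is stored in log
|z|.

Tube. The map Ĝ wraps an annulus twice. This is not injective in z alone, but the second complex
coordinate separates the sheets, and `iso` deforms the standard annulus to the folded one through
embeddings in ℂ × ℂ. By compactness it remains an embedding for small (w, v) (`exists_chart`), which
limits ε. The tube field is the velocity of this isotopy.

Trapping. U is the set where `Thp` > 1/2, and `Thp` strictly increases along the flow wherever it
lies in [1/4, 1). It is assembled from three barriers: an upper one on `Iq`, a lower one on `I0`,
and one on the fibre size. These quantities are only conserved or weakly monotone, so a strictly
growing function `K` is subtracted (`hasDerivAt_tau`). To keep U independent of μ, the upper barrier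
uses `Iq` at μ = σ; for μ near σ its drift is smaller than the growth of `K` (`exists_good`), which
is the origin of μ₀.

Dynamics. Over the block T grows exponentially when z ≠ 0 but is bounded on the region, so such
orbits leave the block (`reach`) and return to height 4 through the tube (`loop`). Orbits with z = 0
over the block converge to the origin (`stable_tendsto`). The Poincaré maps are read off from the
first integrals and from the isotopy at f = 1. -/

lemma deriv_expNegInvGlue_nonneg (x : ℝ) : 0 ≤ deriv expNegInvGlue x :=
  expNegInvGlue.monotone.deriv_nonneg

lemma contDiff_expNegInvGlue : ContDiff ℝ ∞ expNegInvGlue := expNegInvGlue.contDiff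

lemma hasDerivAt_expNegInvGlue (x : ℝ) :
    HasDerivAt expNegInvGlue (deriv expNegInvGlue x) x :=
  (contDiff_expNegInvGlue.differentiable (by simp) x).hasDerivAt

lemma deriv_expNegInvGlue_pos {x : ℝ} (hx : 0 < x) : 0 < deriv expNegInvGlue x := by
  have h : HasDerivAt (fun y : ℝ => Real.exp (-y⁻¹)) (Real.exp (-x⁻¹) * (x ^ 2)⁻¹) x := by
    have := (hasDerivAt_inv hx.ne').neg.exp
    simpa using this
  have h2 : expNegInvGlue =ᶠ[𝓝 x] fun y : ℝ => Real.exp (-y⁻¹) := by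
    filter_upwards [lt_mem_nhds hx] with y hy
    simp [expNegInvGlue, not_le.2 hy]
  rw [h2.deriv_eq, h.deriv]
  positivity

lemma deriv_expNegInvGlue_of_nonpos {x : ℝ} (hx : x ≤ 0) : deriv expNegInvGlue x = 0 := by
  apply IsLocalMin.deriv_eq_zero
  refine Filter.Eventually.of_forall fun y => ?_
  simp only [expNegInvGlue.zero_of_nonpos hx]
  exact expNegInvGlue.nonneg y

lemma expNegInvGlue_one : expNegInvGlue 1 = Real.exp (-1) := by simp [expNegInvGlue]

lemma expNegInvGlue_lt_one (x : ℝ) : expNegInvGlue x < 1 := by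
  unfold expNegInvGlue
  split_ifs with h
  · norm_num
  · push Not at h
    rw [Real.exp_lt_one_iff]
    have := inv_pos.2 h
    linarith

/-- The value at 1 is e⁻¹. Hence if a sum of such nonnegative terms stays below e⁻¹, every argument
stays below 1; this is why e⁻¹ is the threshold for `tau` and `tauT`. -/
lemma lt_one_of_expNegInvGlue_lt {x : ℝ} (h : expNegInvGlue x < Real.exp (-1)) : x < 1 := by
  by_contra hx
  push Not at hx
  have := expNegInvGlue.monotone hx
  rw [expNegInvGlue_one] at this
  linarith

lemma monotone_smoothTransition : Monotone Real.smoothTransition :=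
  Real.smoothTransition.monotone

lemma contDiff_smoothTransition : ContDiff ℝ ∞ Real.smoothTransition :=
  Real.smoothTransition.contDiff

lemma hasDerivAt_smoothTransition (x : ℝ) :
    HasDerivAt Real.smoothTransition (deriv Real.smoothTransition x) x :=
  (contDiff_smoothTransition.differentiable (by simp) x).hasDerivAt

lemma deriv_smoothTransition_nonneg (x : ℝ) : 0 ≤ deriv Real.smoothTransition x :=
  monotone_smoothTransition.deriv_nonneg

lemma deriv_smoothTransition_of_nonpos {x : ℝ} (hx : x ≤ 0) :
    deriv Real.smoothTransition x = 0 := by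
  apply IsLocalMin.deriv_eq_zero
  refine Filter.Eventually.of_forall fun y => ?_
  simp only [Real.smoothTransition.zero_of_nonpos hx]
  exact Real.smoothTransition.nonneg y

lemma deriv_smoothTransition_of_one_le {x : ℝ} (hx : 1 ≤ x) :
    deriv Real.smoothTransition x = 0 := by
  apply IsLocalMax.deriv_eq_zero
  refine Filter.Eventually.of_forall fun y => ?_
  simp only [Real.smoothTransition.one_of_one_le hx]
  exact Real.smoothTransition.le_one y

lemma deriv_smoothTransition_pos {x : ℝ} (h0 : 0 < x) (h1 : x < 1) :
    0 < deriv Real.smoothTransition x := by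
  have hd := Real.smoothTransition.pos_denom x
  have h := hasDerivAt_expNegInvGlue x
  have h' : HasDerivAt (fun y : ℝ => expNegInvGlue (1 - y))
      (-(deriv expNegInvGlue (1 - x))) x := by
    exact (hasDerivAt_expNegInvGlue (1 - x)).comp_const_sub 1 x
  have h2 := h.div (h.add h') hd.ne'
  have e := h2.deriv
  change deriv Real.smoothTransition x = _ at e
  rw [e]
  have p1 := expNegInvGlue.pos_of_pos h0
  have p2 := expNegInvGlue.pos_of_pos (show 0 < 1 - x by linarith)
  have p3 := deriv_expNegInvGlue_pos h0
  have p4 := deriv_expNegInvGlue_nonneg (1 - x)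
  apply div_pos _ (by positivity)
  simp only [Pi.add_apply]
  have : 0 < deriv expNegInvGlue x * expNegInvGlue (1 - x) := by positivity
  have : 0 ≤ expNegInvGlue x * deriv expNegInvGlue (1 - x) := by positivity
  nlinarith

/-- A smooth step, equal to `1` on `(-∞, a]` and to `0` on `[b, ∞)`. -/
def stp (a b x : ℝ) : ℝ := 1 - Real.smoothTransition ((x - a) / (b - a))

section stp
variable {a b : ℝ}

lemma contDiff_stp (a b : ℝ) : ContDiff ℝ ∞ (stp a b) := by
  unfold stp
  exact contDiff_const.sub (contDiff_smoothTransition.comp (by fun_prop))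

lemma hasDerivAt_stp (a b x : ℝ) : HasDerivAt (stp a b) (deriv (stp a b) x) x :=
  ((contDiff_stp a b).differentiable (by simp) x).hasDerivAt

lemma contDiff_deriv_stp (a b : ℝ) : ContDiff ℝ ∞ (deriv (stp a b)) :=
  (contDiff_infty_iff_deriv.1 (contDiff_stp a b)).2

lemma stp_nonneg (a b x : ℝ) : 0 ≤ stp a b x :=
  sub_nonneg.2 (Real.smoothTransition.le_one _)

lemma stp_le_one (a b x : ℝ) : stp a b x ≤ 1 := by
  unfold stp; linarith [Real.smoothTransition.nonneg ((x - a) / (b - a))]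

lemma stp_of_le (hab : a < b) {x : ℝ} (hx : x ≤ a) : stp a b x = 1 := by
  unfold stp
  rw [Real.smoothTransition.zero_of_nonpos, sub_zero]
  exact div_nonpos_of_nonpos_of_nonneg (by linarith) (by linarith)

lemma stp_of_ge (hab : a < b) {x : ℝ} (hx : b ≤ x) : stp a b x = 0 := by
  unfold stp
  rw [Real.smoothTransition.one_of_one_le, sub_self]
  rw [le_div_iff₀ (by linarith)]; linarith

lemma stp_pos (hab : a < b) {x : ℝ} (hx : x < b) : 0 < stp a b x := by
  unfold stp
  have := Real.smoothTransition.lt_one_of_lt_one (x := (x - a) / (b - a))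
    (by rw [div_lt_one (by linarith)]; linarith)
  linarith

lemma stp_lt_one (hab : a < b) {x : ℝ} (hx : a < x) : stp a b x < 1 := by
  unfold stp
  have := Real.smoothTransition.pos_of_pos (x := (x - a) / (b - a))
    (div_pos (by linarith) (by linarith))
  linarith

lemma deriv_stp_eq (a b x : ℝ) : deriv (stp a b) x =
    -(deriv Real.smoothTransition ((x - a) / (b - a)) * (1 / (b - a))) := by
  have h1 : HasDerivAt (fun y : ℝ => (y - a) / (b - a)) (1 / (b - a)) x :=
    ((hasDerivAt_id x).sub_const a).div_const _
  have := ((hasDerivAt_smoothTransition ((x - a) / (b - a))).comp x h1).const_sub 1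
  exact this.deriv

lemma deriv_stp_nonpos (hab : a < b) (x : ℝ) : deriv (stp a b) x ≤ 0 := by
  rw [deriv_stp_eq]
  have := deriv_smoothTransition_nonneg ((x - a) / (b - a))
  have : 0 ≤ 1 / (b - a) := by apply div_nonneg zero_le_one; linarith
  have := mul_nonneg ‹0 ≤ deriv Real.smoothTransition ((x - a) / (b - a))› this
  linarith

lemma deriv_stp_of_le (hab : a < b) {x : ℝ} (hx : x ≤ a) : deriv (stp a b) x = 0 := by
  rw [deriv_stp_eq, deriv_smoothTransition_of_nonpos, zero_mul, neg_zero]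
  exact div_nonpos_of_nonpos_of_nonneg (by linarith) (by linarith)

lemma deriv_stp_of_ge (hab : a < b) {x : ℝ} (hx : b ≤ x) : deriv (stp a b) x = 0 := by
  rw [deriv_stp_eq, deriv_smoothTransition_of_one_le, zero_mul, neg_zero]
  rw [le_div_iff₀ (by linarith)]; linarith

lemma deriv_stp_neg {x : ℝ} (h0 : a < x) (h1 : x < b) : deriv (stp a b) x < 0 := by
  rw [deriv_stp_eq]
  have hb : 0 < b - a := by linarith
  have := deriv_smoothTransition_pos (x := (x - a) / (b - a)) (div_pos (by linarith) hb)
    (by rw [div_lt_one hb]; linarith)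
  have : 0 < 1 / (b - a) := by positivity
  have := mul_pos ‹0 < deriv Real.smoothTransition ((x - a) / (b - a))› this
  linarith

end stp

/-- The logarithmic derivative of `x ↦ exp (stp a b x * (log x - C))`, a smooth function on the
line that interpolates between `1` and `0`. -/
def gg (a b C x : ℝ) : ℝ := stp a b x + x * deriv (stp a b) x * (Real.log x - C)

section gg
variable {a b C : ℝ}

lemma gg_of_le (hab : a < b) {x : ℝ} (hx : x ≤ a) : gg a b C x = 1 := by
  simp [gg, stp_of_le hab hx, deriv_stp_of_le hab hx]

lemma gg_of_ge (hab : a < b) {x : ℝ} (hx : b ≤ x) : gg a b C x = 0 := by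
  simp [gg, stp_of_ge hab hx, deriv_stp_of_ge hab hx]

/-- On the transition interval the step decreases and log x ≤ log b ≤ C, so the additional term is a
product of two nonpositive factors with the positive factor x. -/
lemma stp_le_gg (ha : 0 < a) (hab : a < b) (hC : Real.log b ≤ C) (x : ℝ) :
    stp a b x ≤ gg a b C x := by
  unfold gg
  rcases le_or_gt x a with h | h
  · simp [deriv_stp_of_le hab h]
  rcases le_or_gt b x with h' | h'
  · simp [deriv_stp_of_ge hab h']
  have hx : 0 < x := ha.trans h
  have h1 := deriv_stp_nonpos hab x
  have h2 : Real.log x ≤ C := (Real.log_le_log hx h'.le).trans hC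
  have : 0 ≤ x * (-deriv (stp a b) x) * (C - Real.log x) := by
    apply mul_nonneg (mul_nonneg hx.le (by linarith)) (by linarith)
  nlinarith

lemma gg_nonneg (ha : 0 < a) (hab : a < b) (hC : Real.log b ≤ C) (x : ℝ) :
    0 ≤ gg a b C x := (stp_nonneg a b x).trans (stp_le_gg ha hab hC x)

/-- The singularity of the logarithm at 0 is harmless: below a > 0 the function is constant. -/
lemma contDiff_gg (ha : 0 < a) (hab : a < b) (C : ℝ) : ContDiff ℝ ∞ (gg a b C) := by
  rw [contDiff_iff_contDiffAt]
  intro x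
  rcases lt_or_ge x a with h | h
  · refine (contDiffAt_const (c := (1 : ℝ))).congr_of_eventuallyEq ?_
    filter_upwards [gt_mem_nhds h] with y hy using gg_of_le hab hy.le
  · have hx : x ≠ 0 := (ha.trans_le h).ne'
    unfold gg
    exact (contDiff_stp a b).contDiffAt.add ((contDiffAt_id.mul
      (contDiff_deriv_stp a b).contDiffAt).mul ((contDiffAt_id.log hx).sub contDiffAt_const))

/-- `gg` is affine in its parameter, so it is jointly smooth. -/
lemma contDiff_gg_param (ha : 0 < a) (hab : a < b) :
    ContDiff ℝ ∞ (fun p : ℝ × ℝ => gg a b p.1 p.2) := by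
  have : (fun p : ℝ × ℝ => gg a b p.1 p.2) =
      fun p => gg a b 0 p.2 - p.2 * deriv (stp a b) p.2 * p.1 := by
    ext p; simp only [gg]; ring
  rw [this]
  exact ((contDiff_gg ha hab 0).comp contDiff_snd).sub
    ((contDiff_snd.mul ((contDiff_deriv_stp a b).comp contDiff_snd)).mul contDiff_fst)

/-- The function `x ↦ exp (κ stp a b x (log x - C))`. -/
def powStp (a b C κ x : ℝ) : ℝ := Real.exp (κ * (stp a b x * (Real.log x - C)))

lemma hasDerivAt_powStp (a b C κ : ℝ) {x : ℝ} (hx : x ≠ 0) :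
    HasDerivAt (powStp a b C κ) (κ * gg a b C x / x * powStp a b C κ x) x := by
  have h1 := ((hasDerivAt_stp a b x).mul ((Real.hasDerivAt_log hx).sub_const C)).const_mul κ
  have h2 := h1.exp
  refine HasDerivAt.congr_deriv (f := powStp a b C κ) h2 ?_
  simp only [powStp, gg, Pi.mul_apply]
  field_simp
  ring

lemma powStp_pos (a b C κ x : ℝ) : 0 < powStp a b C κ x := Real.exp_pos _

lemma powStp_of_ge (hab : a < b) (κ : ℝ) {x : ℝ} (hx : b ≤ x) : powStp a b C κ x = 1 := by
  simp [powStp, stp_of_ge hab hx]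

lemma powStp_of_le (hab : a < b) (κ : ℝ) {x : ℝ} (hx : x ≤ a) :
    powStp a b C κ x = Real.exp (κ * (Real.log x - C)) := by
  simp [powStp, stp_of_le hab hx]

lemma contDiffAt_powStp (a b C κ : ℝ) {x : ℝ} (hx : x ≠ 0) :
    ContDiffAt ℝ ∞ (powStp a b C κ) x :=
  (contDiffAt_const.mul ((contDiff_stp a b).contDiffAt.mul
    ((contDiffAt_id.log hx).sub contDiffAt_const))).exp

end gg

/-- A smooth function equal to `h` for `h ≤ 1` and to `exp C` for `2 ≤ h`. -/
def eFun (C h : ℝ) : ℝ := h * Real.exp ((1 - stp 1 2 h) * (C - Real.log h))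

lemma eFun_of_le {C h : ℝ} (hh : h ≤ 1) : eFun C h = h := by
  simp [eFun, stp_of_le (by norm_num : (1 : ℝ) < 2) hh]

lemma eFun_of_ge {C h : ℝ} (hh : 2 ≤ h) : eFun C h = Real.exp C := by
  have : 0 < h := by linarith
  rw [eFun, stp_of_ge (by norm_num : (1 : ℝ) < 2) hh, sub_zero, one_mul, Real.exp_sub,
    Real.exp_log this]
  field_simp

lemma contDiff_eFun (C : ℝ) : ContDiff ℝ ∞ (eFun C) := by
  rw [contDiff_iff_contDiffAt]
  intro x
  rcases lt_or_ge x 1 with h | h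
  · refine (contDiffAt_id).congr_of_eventuallyEq ?_
    filter_upwards [gt_mem_nhds h] with y hy using eFun_of_le hy.le
  · have hx : x ≠ 0 := (zero_lt_one.trans_le h).ne'
    unfold eFun
    exact contDiffAt_id.mul (((contDiffAt_const.sub (contDiff_stp 1 2).contDiffAt).mul
      (contDiffAt_const.sub (contDiffAt_id.log hx))).exp)

lemma hasDerivAt_eFun (C h : ℝ) : HasDerivAt (eFun C) (deriv (eFun C) h) h :=
  ((contDiff_eFun C).differentiable (by simp) h).hasDerivAt

/-- The logarithmic derivative of `eFun C` in log h is the same `gg 1 2 C` that serves as expansion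
rate of z; this match makes `eFun` times a power of |z| a first integral. -/
lemma mul_deriv_eFun (C h : ℝ) : h * deriv (eFun C) h = gg 1 2 C h * eFun C h := by
  rcases lt_or_ge h 1 with h1 | h1
  · have : deriv (eFun C) h = 1 := by
      have : eFun C =ᶠ[𝓝 h] id := by
        filter_upwards [gt_mem_nhds h1] with y hy using eFun_of_le hy.le
      rw [this.deriv_eq]; simp
    rw [this, gg_of_le (by norm_num) h1.le, eFun_of_le h1.le]; ring
  · have h0 : 0 < h := by linarith
    have hd := (hasDerivAt_id h).mul ((((hasDerivAt_stp 1 2 h).const_sub 1).mul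
      ((Real.hasDerivAt_log h0.ne').const_sub C)).exp)
    have e : deriv (eFun C) h = _ := hd.deriv
    rw [e]
    simp only [gg, eFun, id, Pi.mul_apply]
    field_simp
    ring

lemma deriv_eFun_of_lt {C h : ℝ} (h1 : h < 1) : deriv (eFun C) h = 1 := by
  have : eFun C =ᶠ[𝓝 h] id := by
    filter_upwards [gt_mem_nhds h1] with y hy using eFun_of_le hy.le
  rw [this.deriv_eq]; simp

lemma deriv_eFun_of_ge {C h : ℝ} (h1 : 2 ≤ h) : deriv (eFun C) h = 0 := by
  have := mul_deriv_eFun C h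
  rw [gg_of_ge (by norm_num) h1, zero_mul] at this
  rcases mul_eq_zero.1 this with h0 | h0
  · linarith
  · exact h0

/-- For `1 ≤ h` the values of `eFun` lie between `1` and `exp C`, if `log 2 ≤ C`. -/
lemma one_le_eFun {C h : ℝ} (hC : 0 ≤ C) (hh : 1 ≤ h) : 1 ≤ eFun C h := by
  have h0 : 0 < h := by linarith
  have : eFun C h = Real.exp (stp 1 2 h * Real.log h + (1 - stp 1 2 h) * C) := by
    rw [eFun]
    nth_rw 1 [← Real.exp_log h0]
    rw [← Real.exp_add]; congr 1; ring
  rw [this]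
  apply Real.one_le_exp
  have := stp_nonneg 1 2 h
  have := stp_le_one 1 2 h
  have := Real.log_nonneg hh
  apply add_nonneg <;> apply mul_nonneg <;> linarith

/-- For 1 ≤ h the logarithm of `eFun` is a convex combination of log h and C. -/
lemma eFun_le {C h : ℝ} (hC : Real.log 2 ≤ C) : eFun C h ≤ Real.exp C := by
  rcases lt_or_ge h 1 with h1 | h1
  · rw [eFun_of_le h1.le]
    have := Real.add_one_le_exp C
    have := Real.log_nonneg (by norm_num : (1 : ℝ) ≤ 2)
    linarith
  rcases lt_or_ge h 2 with h2 | h2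
  · have h0 : 0 < h := by linarith
    have : eFun C h = Real.exp (stp 1 2 h * Real.log h + (1 - stp 1 2 h) * C) := by
      rw [eFun]
      nth_rw 1 [← Real.exp_log h0]
      rw [← Real.exp_add]; congr 1; ring
    rw [this]
    apply Real.exp_le_exp.2
    have := stp_nonneg 1 2 h
    have : Real.log h ≤ C := (Real.log_le_log h0 h2.le).trans hC
    nlinarith
  · rw [eFun_of_ge h2]

/-! ### The bending functions -/

/-- `psi k σ T = t · step t` with `t = log T / (2σ) - k`. -/
def psi (k sig T : ℝ) : ℝ :=
  (Real.log T / (2 * sig) - k) * Real.smoothTransition (Real.log T / (2 * sig) - k)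

/-- `chi k σ T = 2 σ T · psi' T`. -/
def chi (k sig T : ℝ) : ℝ :=
  Real.smoothTransition (Real.log T / (2 * sig) - k) + (Real.log T / (2 * sig) - k) *
    deriv Real.smoothTransition (Real.log T / (2 * sig) - k)

section bend
variable {k sig : ℝ}

lemma psi_of_nonpos {T : ℝ} (h : Real.log T / (2 * sig) - k ≤ 0) : psi k sig T = 0 := by
  simp [psi, Real.smoothTransition.zero_of_nonpos h]

lemma chi_of_nonpos {T : ℝ} (h : Real.log T / (2 * sig) - k ≤ 0) : chi k sig T = 0 := by
  simp [chi, Real.smoothTransition.zero_of_nonpos h, deriv_smoothTransition_of_nonpos h]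

lemma psi_of_one_le {T : ℝ} (h : 1 ≤ Real.log T / (2 * sig) - k) :
    psi k sig T = Real.log T / (2 * sig) - k := by
  simp [psi, Real.smoothTransition.one_of_one_le h]

lemma chi_of_one_le {T : ℝ} (h : 1 ≤ Real.log T / (2 * sig) - k) : chi k sig T = 1 := by
  simp [chi, Real.smoothTransition.one_of_one_le h, deriv_smoothTransition_of_one_le h]

/-- Since `Real.log y` is log |y|, and 0 at y = 0, it is nonpositive near 0. So the bending
functions vanish near T = 0 and are smooth there. -/
lemma eventually_log_neg (hk : 0 < k) (hsig : 0 < sig) :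
    ∀ᶠ y in 𝓝 (0 : ℝ), Real.log y / (2 * sig) - k ≤ 0 := by
  filter_upwards [Metric.ball_mem_nhds (0 : ℝ) one_pos] with y hy
  rw [Metric.mem_ball, dist_zero_right, Real.norm_eq_abs] at hy
  have : Real.log y ≤ 0 := by
    rw [← Real.log_abs]; exact Real.log_nonpos (abs_nonneg _) hy.le
  have := div_nonpos_of_nonpos_of_nonneg this (by positivity : 0 ≤ 2 * sig)
  linarith

lemma contDiff_psi (hk : 0 < k) (hsig : 0 < sig) : ContDiff ℝ ∞ (psi k sig) := by
  rw [contDiff_iff_contDiffAt]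
  intro x
  rcases eq_or_ne x 0 with rfl | h
  · refine (contDiffAt_const (c := (0 : ℝ))).congr_of_eventuallyEq ?_
    filter_upwards [eventually_log_neg hk hsig] with y hy using psi_of_nonpos hy
  · unfold psi
    have : ContDiffAt ℝ ∞ (fun T => Real.log T / (2 * sig) - k) x :=
      ((contDiffAt_id.log h).div_const _).sub contDiffAt_const
    exact this.mul (contDiff_smoothTransition.contDiffAt.comp x this)

lemma contDiff_chi (hk : 0 < k) (hsig : 0 < sig) : ContDiff ℝ ∞ (chi k sig) := by
  rw [contDiff_iff_contDiffAt]
  intro x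
  rcases eq_or_ne x 0 with rfl | h
  · refine (contDiffAt_const (c := (0 : ℝ))).congr_of_eventuallyEq ?_
    filter_upwards [eventually_log_neg hk hsig] with y hy using chi_of_nonpos hy
  · unfold chi
    have : ContDiffAt ℝ ∞ (fun T => Real.log T / (2 * sig) - k) x :=
      ((contDiffAt_id.log h).div_const _).sub contDiffAt_const
    exact (contDiff_smoothTransition.contDiffAt.comp x this).add
      (this.mul ((contDiff_infty_iff_deriv.1 contDiff_smoothTransition).2.contDiffAt.comp x this))

/-- At T = 0 the quotient is 0 by convention, which is the correct derivative because `psi` vanishes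
nearby. -/
lemma hasDerivAt_psi (hk : 0 < k) (hsig : 0 < sig) (T : ℝ) :
    HasDerivAt (psi k sig) (chi k sig T / (2 * sig * T)) T := by
  rcases eq_or_ne T 0 with rfl | h
  · have : psi k sig =ᶠ[𝓝 0] fun _ => 0 := by
      filter_upwards [eventually_log_neg hk hsig] with y hy using psi_of_nonpos hy
    simpa using (hasDerivAt_const (0 : ℝ) (0 : ℝ)).congr_of_eventuallyEq this
  · have h1 := ((Real.hasDerivAt_log h).div_const (2 * sig)).sub_const k
    have h2 := h1.mul ((hasDerivAt_smoothTransition _).comp T h1)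
    refine HasDerivAt.congr_deriv (f := psi k sig) h2 ?_
    simp only [chi, Function.comp]
    field_simp

end bend

/-! ### The block: parameters and the reduced vector field -/

/-- The parameters of the construction. -/
structure Par where
  sig : ℝ
  eta : ℝ
  lam : ℝ
  cs : ℝ
  eps : ℝ
  bet : ℝ
  nu : ℝ
  sig_pos : 0 < sig
  eta_pos : 0 < eta
  half_le_lam : 1 / 2 ≤ lam
  lam_lt : lam < 1
  cs_pos : 0 < cs
  -- Exit heights are of order cs |z|; this keeps them below 1/4, well inside the zone h < 1 where b
  -- = 1.
  cs_le : cs * (2 * (1 - lam)⁻¹ + 1) ≤ 1 / 4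
  eps_pos : 0 < eps
  eps_lt : eps < 1 / 5
  bet_pos : 0 < bet
  -- This says β R2^(η/σ) ≤ ε: the fibre has shrunk to size ε before |z| reaches R2.
  bet_le : Real.log bet ≤ Real.log eps - eta / sig * Real.log (8 * (2 * (1 - lam)⁻¹ + 1))
  nu_pos : 0 < nu
  nu_le : nu ≤ cs * (1 - lam) / (2 * lam) / 8
  -- At negative heights, which exceed -cs in the region, the term μ c h reduces the growth rate
  -- `gr`; this limits the loss to 1/2.
  slow : ∀ x, sig * gg ((4 * (2 * (1 - lam)⁻¹ + 1)) ^ 2) ((8 * (2 * (1 - lam)⁻¹ + 1)) ^ 2)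
    (2 * Real.log (4 / cs)) x * cs ≤ 1 / 2

namespace Par
variable (P : Par)

/-- R is the radius of B_λ. Between R1 and R2 the contractions of h and of the fibre are switched
off, and R3 is the radius of the cylinder that carries Σ^s. -/
def R : ℝ := 2 * (1 - P.lam)⁻¹
def R1 : ℝ := 4 * (P.R + 1)
def R2 : ℝ := 8 * (P.R + 1)
def R3 : ℝ := P.R2 + 1
-- The summand 1 delays the bending until after the cylinder |z| = R3, even at slightly negative
-- heights.
def k : ℝ := Real.log P.R3 / P.sig + 1
-- The inner boundary |ζ| = (1 - λ)/2 of the annulus corresponds to the height -dS on the cylinder.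
def dS : ℝ := P.cs * (1 - P.lam) / (2 * P.lam)
-- exp C = cs (4/cs)^(μ/σ) is chosen so that the first integral equals cs |z|^(μ/σ) at the entrance.
def C (mu : ℝ) : ℝ := Real.log P.cs + mu / P.sig * Real.log (4 / P.cs)
-- The factors `c` and `d` are the logarithmic derivatives of the weights `m` and `pw`, up to
-- constants; multiplied by μ and η they are the contraction rates of h and of the fibre.
def c (x : ℝ) : ℝ := gg (P.R1 ^ 2) (P.R2 ^ 2) (2 * Real.log (4 / P.cs)) x
def d (x : ℝ) : ℝ := gg (P.R1 ^ 2) (P.R2 ^ 2) (-(2 * P.sig / P.eta * Real.log P.bet)) x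
def b (mu h : ℝ) : ℝ := gg 1 2 (P.C mu) h
def jj (h : ℝ) : ℝ := 1 - stp 2 3 h
-- The bending adds a multiple of the direction (-1, -σ z) to the field, and this direction leaves
-- |z|² exp(-2σh) unchanged.
def T (h x : ℝ) : ℝ := x * Real.exp (-(2 * P.sig * h))
def tt (h x : ℝ) : ℝ := Real.log (P.T h x) / (2 * P.sig) - P.k
def ps (h x : ℝ) : ℝ := psi P.k P.sig (P.T h x)
def ch (h x : ℝ) : ℝ := chi P.k P.sig (P.T h x)

/-- The components of the block field, as functions of the height `h` and of `x = |z|²`. -/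
def fh (mu h x : ℝ) : ℝ := -(mu * P.c x * h * stp 2 3 h) - jj h - P.ch h x
def fz (mu h x : ℝ) : ℝ := P.sig * (P.b mu h - P.ch h x)
def fw (mu h x : ℝ) : ℝ := -(P.eta * P.b mu h * P.d x)

/-- The growth rate of `log T / (2σ)`. -/
def gr (mu h x : ℝ) : ℝ := P.b mu h + mu * P.c x * h * stp 2 3 h + jj h

/-- Equal to (cs |z| / 4)^(μ/σ) in the core and to 1 beyond R2. -/
def m (mu x : ℝ) : ℝ :=
  powStp (P.R1 ^ 2) (P.R2 ^ 2) (2 * Real.log (4 / P.cs)) (mu / (2 * P.sig)) x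
def Iq (mu h x : ℝ) : ℝ := eFun (P.C mu) h * P.m mu x + P.ps h x
-- Wherever the bending acts it coincides with `Iq` for every μ (`Iq_eq`). Unlike `Iq` it is smooth
-- across z = 0, as the lower barrier requires.
def I0 (h x : ℝ) : ℝ := h + P.ps h x
-- Normalizes the fibre size: allowed values of |w|² + |v|² are of order 1 in the core and of order
-- ε² beyond R2.
def F (x : ℝ) : ℝ := Real.exp (2 * (1 - stp (P.R1 ^ 2) (P.R2 ^ 2) x) * (-Real.log P.eps))
-- A bounded function, |K| < 1, that makes the barriers strict. The first term grows whenever z ≠ 0,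
-- since T does; the second grows on the axis z = 0 at heights above 1/2, where the fibre
-- contraction may be switched off.
def K (h x : ℝ) : ℝ := P.T h x / (1 + P.T h x) - expNegInvGlue (h - 1 / 2)
-- The thresholds lie just outside Σ^s, whose heights fill [-dS, cs (R + 1/2)] and whose fibre
-- satisfies W F ≤ 2. The width ν absorbs the variation of `K`.
def A1 (h x : ℝ) : ℝ := (P.Iq P.sig h x - P.cs * (P.R + 5 / 8)) / P.nu - P.K h x
def A2 (h x : ℝ) : ℝ := (-P.I0 h x - 3 / 2 * P.dS) / P.nu - P.K h x
def A3 (h x W : ℝ) : ℝ := W * P.F x - 3 - P.K h x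
def tau (h x W : ℝ) : ℝ :=
  expNegInvGlue (P.A1 h x) + expNegInvGlue (P.A2 h x) + expNegInvGlue (P.A3 h x W)

/-- The region in which the block field is used. -/
def InV (h x W : ℝ) : Prop := 0 ≤ x ∧ 0 ≤ W ∧ P.tau h x W < Real.exp (-1)

variable {P}

/-! ### Bounds for the parameters and the coefficient functions -/

lemma R_ge : 4 ≤ P.R := by
  have h1 := P.half_le_lam
  have h2 := P.lam_lt
  unfold R
  have : (2 : ℝ) ≤ (1 - P.lam)⁻¹ := by
    rw [le_inv_comm₀ (by norm_num) (by linarith)]; norm_num; linarith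
  linarith

lemma R_mul : (1 - P.lam) * P.R = 2 := by
  have h2 := P.lam_lt
  unfold R
  field_simp [show (1 - P.lam) ≠ 0 by linarith]

lemma R1_pos : 0 < P.R1 := by have := P.R_ge; unfold R1; linarith
lemma R12 : P.R1 < P.R2 := by have := P.R_ge; unfold R1 R2; linarith
lemma R2_pos : 0 < P.R2 := R1_pos.trans R12
lemma R3_pos : 0 < P.R3 := by have := P.R2_pos; unfold R3; linarith
lemma R3_gt : 1 < P.R3 := by have := P.R2_pos; unfold R3; linarith
lemma sq12 : P.R1 ^ 2 < P.R2 ^ 2 := by have := P.R1_pos; have := P.R12; nlinarith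
lemma sq23 : P.R2 ^ 2 < P.R3 ^ 2 := by have := P.R2_pos; unfold R3; nlinarith
lemma sq1_pos : 0 < P.R1 ^ 2 := by have := P.R1_pos; positivity
lemma k_pos : 0 < P.k := by
  have := Real.log_nonneg P.R3_gt.le
  have := div_nonneg this P.sig_pos.le
  unfold k; linarith

lemma cs_R : P.cs * (P.R + 1) ≤ 1 / 4 := P.cs_le
lemma cs_le_one : P.cs ≤ 1 / 20 := by
  have := P.cs_R; have := P.R_ge; have := P.cs_pos; nlinarith
lemma dS_pos : 0 < P.dS := by
  have := P.cs_pos; have := P.half_le_lam; have := P.lam_lt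
  unfold dS
  apply div_pos (mul_pos P.cs_pos (by linarith)) (by linarith)
lemma dS_le : P.dS ≤ P.cs / 2 := by
  have h0 := P.cs_pos; have h1 := P.half_le_lam; have h2 := P.lam_lt
  unfold dS
  rw [div_le_div_iff₀ (by linarith) (by norm_num)]
  nlinarith
lemma nu_le_dS : P.nu ≤ P.dS / 8 := P.nu_le

lemma Pi_ge : P.R2 ≤ 4 / P.cs := by
  rw [le_div_iff₀ P.cs_pos]
  have := P.cs_R
  unfold R2; nlinarith

/-- This is the hypothesis of `stp_le_gg` under which `c` is nonnegative. -/
lemma log_Pi : Real.log (P.R2 ^ 2) ≤ 2 * Real.log (4 / P.cs) := by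
  rw [Real.log_pow]
  have := Real.log_le_log P.R2_pos P.Pi_ge
  push_cast; linarith

lemma log_Pi_pos : 0 < Real.log (4 / P.cs) := by
  apply Real.log_pos
  have := P.R_ge; have := P.Pi_ge; unfold R2 at this; linarith

lemma bet_log : Real.log P.bet ≤ Real.log P.eps - P.eta / P.sig * Real.log P.R2 := P.bet_le

lemma log_eps_neg : Real.log P.eps < 0 :=
  Real.log_neg P.eps_pos (by linarith [P.eps_lt])

lemma log_d : Real.log (P.R2 ^ 2) - 2 * P.sig / P.eta * Real.log P.eps
    ≤ -(2 * P.sig / P.eta * Real.log P.bet) := by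
  rw [Real.log_pow]
  have h := P.bet_log
  have h1 := P.sig_pos
  have h2 := P.eta_pos
  have : 2 * P.sig / P.eta * Real.log P.bet ≤
      2 * P.sig / P.eta * (Real.log P.eps - P.eta / P.sig * Real.log P.R2) :=
    mul_le_mul_of_nonneg_left h (by positivity)
  have e : 2 * P.sig / P.eta * (Real.log P.eps - P.eta / P.sig * Real.log P.R2)
      = 2 * P.sig / P.eta * Real.log P.eps - 2 * Real.log P.R2 := by
    field_simp
  push_cast; linarith

lemma c_nonneg (x : ℝ) : 0 ≤ P.c x := gg_nonneg sq1_pos sq12 log_Pi x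
lemma c_one {x : ℝ} (hx : x ≤ P.R1 ^ 2) : P.c x = 1 := gg_of_le sq12 hx
lemma c_zero {x : ℝ} (hx : P.R2 ^ 2 ≤ x) : P.c x = 0 := gg_of_ge sq12 hx
lemma c_slow (x : ℝ) : P.sig * P.c x * P.cs ≤ 1 / 2 := P.slow x
lemma d_one {x : ℝ} (hx : x ≤ P.R1 ^ 2) : P.d x = 1 := gg_of_le sq12 hx
lemma d_zero {x : ℝ} (hx : P.R2 ^ 2 ≤ x) : P.d x = 0 := gg_of_ge sq12 hx

lemma C_sig : P.C P.sig = Real.log 4 := by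
  unfold C
  rw [div_self P.sig_pos.ne', one_mul, Real.log_div (by norm_num) P.cs_pos.ne']; ring

lemma b_one {mu h : ℝ} (hh : h ≤ 1) : P.b mu h = 1 := gg_of_le (by norm_num) hh
lemma b_zero {mu h : ℝ} (hh : 2 ≤ h) : P.b mu h = 0 := gg_of_ge (by norm_num) hh

/-- The admissible values of `μ`. -/
def Adm (P : Par) (mu : ℝ) : Prop := 0 < mu ∧ mu ≤ P.sig ∧ Real.log 2 ≤ P.C mu

lemma b_nonneg {mu : ℝ} (hmu : P.Adm mu) (h : ℝ) : 0 ≤ P.b mu h :=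
  gg_nonneg (by norm_num) (by norm_num) hmu.2.2 h

lemma b_le {mu : ℝ} (hmu : P.Adm mu) (h : ℝ) : P.b mu h ≤ P.b P.sig h := by
  have e : P.b P.sig h - P.b mu h = -(deriv (stp 1 2) h * h) * (P.C P.sig - P.C mu) := by
    simp only [b, gg]; ring
  have h1 : 0 ≤ P.C P.sig - P.C mu := by
    have : P.C P.sig - P.C mu = (P.sig - mu) / P.sig * Real.log (4 / P.cs) := by
      have := P.sig_pos.ne'
      unfold C; field_simp; ring
    rw [this]
    exact mul_nonneg (div_nonneg (by linarith [hmu.2.1]) P.sig_pos.le) log_Pi_pos.le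
  have h2 : deriv (stp 1 2) h * h ≤ 0 := by
    rcases le_or_gt h 1 with h' | h'
    · rw [deriv_stp_of_le (by norm_num) h', zero_mul]
    · exact mul_nonpos_of_nonpos_of_nonneg (deriv_stp_nonpos (by norm_num) h) (by linarith)
  have := mul_nonneg (neg_nonneg.2 h2) h1
  linarith

lemma jj_nonneg (h : ℝ) : 0 ≤ jj h := sub_nonneg.2 (stp_le_one _ _ _)
lemma jj_zero {h : ℝ} (hh : h ≤ 2) : jj h = 0 := by
  simp [jj, stp_of_le (by norm_num : (2 : ℝ) < 3) hh]
lemma jj_one {h : ℝ} (hh : 3 ≤ h) : jj h = 1 := by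
  simp [jj, stp_of_ge (by norm_num : (2 : ℝ) < 3) hh]

lemma T_nonneg {h x : ℝ} (hx : 0 ≤ x) : 0 ≤ P.T h x := mul_nonneg hx (Real.exp_pos _).le
lemma T_pos {h x : ℝ} (hx : 0 < x) : 0 < P.T h x := mul_pos hx (Real.exp_pos _)
lemma T_zero (h : ℝ) : P.T h 0 = 0 := by simp [T]

lemma ch_of_nonpos {h x : ℝ} (ht : P.tt h x ≤ 0) : P.ch h x = 0 := chi_of_nonpos ht
lemma ps_of_nonpos {h x : ℝ} (ht : P.tt h x ≤ 0) : P.ps h x = 0 := psi_of_nonpos ht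
lemma ch_of_one_le {h x : ℝ} (ht : 1 ≤ P.tt h x) : P.ch h x = 1 := chi_of_one_le ht
lemma ps_of_one_le {h x : ℝ} (ht : 1 ≤ P.tt h x) : P.ps h x = P.tt h x := psi_of_one_le ht

lemma ps_nonneg (h x : ℝ) : 0 ≤ P.ps h x := by
  rcases le_or_gt (P.tt h x) 0 with ht | ht
  · rw [ps_of_nonpos ht]
  · exact mul_nonneg ht.le (Real.smoothTransition.nonneg _)

lemma ps_le {h x : ℝ} (ht : 0 ≤ P.tt h x) : P.ps h x ≤ P.tt h x := by
  have := mul_le_mul_of_nonneg_left (Real.smoothTransition.le_one (P.tt h x)) ht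
  rw [mul_one] at this
  exact this

lemma ch_nonneg (h x : ℝ) : 0 ≤ P.ch h x := by
  rcases le_or_gt (P.tt h x) 0 with ht | ht
  · rw [ch_of_nonpos ht]
  · exact add_nonneg (Real.smoothTransition.nonneg _)
      (mul_nonneg ht.le (deriv_smoothTransition_nonneg _))

lemma tt_zero (h : ℝ) : P.tt h 0 < 0 := by
  have := k_pos (P := P)
  simp [tt, T_zero, this]

lemma tt_eq {h x : ℝ} (hx : 0 < x) : P.tt h x = Real.log x / (2 * P.sig) - h - P.k := by
  have := P.sig_pos.ne'
  rw [tt, T, Real.log_mul hx.ne' (Real.exp_pos _).ne', Real.log_exp]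
  field_simp
  ring

lemma x_pos_of_tt {h x : ℝ} (hx : 0 ≤ x) (ht : 0 ≤ P.tt h x) : 0 < x := by
  rcases hx.eq_or_lt with rfl | h'
  · linarith [tt_zero (P := P) h]
  · exact h'

lemma m_pos (mu x : ℝ) : 0 < P.m mu x := powStp_pos _ _ _ _ _
lemma m_one {mu x : ℝ} (hx : P.R2 ^ 2 ≤ x) : P.m mu x = 1 := powStp_of_ge sq12 _ hx

lemma K_lt {h x : ℝ} (hx : 0 ≤ x) : P.K h x < 1 := by
  have h1 := P.T_nonneg (h := h) hx
  have h2 := expNegInvGlue.nonneg (h - 1 / 2)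
  have : P.T h x / (1 + P.T h x) < 1 := by rw [div_lt_one (by linarith)]; linarith
  unfold K; linarith

lemma K_gt {h x : ℝ} (hx : 0 ≤ x) : -1 < P.K h x := by
  have h1 := P.T_nonneg (h := h) hx
  have h2 := expNegInvGlue_lt_one (h - 1 / 2)
  have : 0 ≤ P.T h x / (1 + P.T h x) := by positivity
  unfold K; linarith

lemma one_le_F (x : ℝ) : 1 ≤ P.F x := by
  apply Real.one_le_exp
  have := stp_le_one (P.R1 ^ 2) (P.R2 ^ 2) x
  have := log_eps_neg (P := P)
  apply mul_nonneg <;> linarith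

lemma F_one {x : ℝ} (hx : x ≤ P.R1 ^ 2) : P.F x = 1 := by
  simp [F, stp_of_le sq12 hx]

lemma F_eps {x : ℝ} (hx : P.R2 ^ 2 ≤ x) : P.F x = (P.eps ^ 2)⁻¹ := by
  rw [F, stp_of_ge sq12 hx, show 2 * (1 - (0 : ℝ)) * -Real.log P.eps = -(2 * Real.log P.eps) by ring,
    Real.exp_neg, show (2 : ℝ) * Real.log P.eps = (2 : ℕ) * Real.log P.eps by norm_num,
    ← Real.log_pow, Real.exp_log (by have := P.eps_pos; positivity)]

/-! ### The geometry of the block region -/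

namespace InV
variable {h x W : ℝ}

lemma A1_lt (H : P.InV h x W) : P.A1 h x < 1 := by
  apply lt_one_of_expNegInvGlue_lt
  have := H.2.2
  have := expNegInvGlue.nonneg (P.A2 h x)
  have := expNegInvGlue.nonneg (P.A3 h x W)
  unfold tau at *; linarith

lemma A2_lt (H : P.InV h x W) : P.A2 h x < 1 := by
  apply lt_one_of_expNegInvGlue_lt
  have := H.2.2
  have := expNegInvGlue.nonneg (P.A1 h x)
  have := expNegInvGlue.nonneg (P.A3 h x W)
  unfold tau at *; linarith

lemma A3_lt (H : P.InV h x W) : P.A3 h x W < 1 := by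
  apply lt_one_of_expNegInvGlue_lt
  have := H.2.2
  have := expNegInvGlue.nonneg (P.A1 h x)
  have := expNegInvGlue.nonneg (P.A2 h x)
  unfold tau at *; linarith

lemma Iq_lt (H : P.InV h x W) : P.Iq P.sig h x < P.cs * (P.R + 7 / 8) := by
  have h1 := H.A1_lt
  have h2 := P.K_lt (h := h) H.1
  have h3 : (P.Iq P.sig h x - P.cs * (P.R + 5 / 8)) / P.nu < 2 := by unfold A1 at h1; linarith
  rw [div_lt_iff₀ P.nu_pos] at h3
  have := P.nu_le_dS; have := P.dS_le; have := P.cs_pos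
  nlinarith

lemma I0_gt (H : P.InV h x W) : -(7 / 4 * P.dS) < P.I0 h x := by
  have h1 := H.A2_lt
  have h2 := P.K_lt (h := h) H.1
  have h3 : (-P.I0 h x - 3 / 2 * P.dS) / P.nu < 2 := by unfold A2 at h1; linarith
  rw [div_lt_iff₀ P.nu_pos] at h3
  have := P.nu_le_dS
  linarith

lemma WF_lt (H : P.InV h x W) : W * P.F x < 5 := by
  have h1 := H.A3_lt
  have h2 := P.K_lt (h := h) H.1
  unfold A3 at h1; linarith

lemma W_lt (H : P.InV h x W) : W < 5 := by
  have := H.WF_lt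
  have := P.one_le_F x
  have := H.2.1
  nlinarith

lemma I0_gt' (H : P.InV h x W) : -(7 / 8 * P.cs) < P.I0 h x := by
  have := H.I0_gt; have := P.dS_le; linarith

/-- Since `ps` ≤ `tt`, the lower barrier gives log x / (2σ) - k ≥ I0 > -1, and the summand 1 in k
cancels the -1. -/
lemma sq_le (H : P.InV h x W) (ht : 0 ≤ P.tt h x) : P.R3 ^ 2 ≤ x := by
  have hx := x_pos_of_tt H.1 ht
  have h1 := tt_eq (P := P) (h := h) hx
  have h2 := ps_le ht
  have h3 := H.I0_gt'
  have h4 := P.cs_le_one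
  have hs := P.sig_pos
  have : Real.log P.R3 / P.sig ≤ Real.log x / (2 * P.sig) := by
    unfold I0 at h3
    unfold k at h1
    linarith
  rw [div_le_div_iff₀ hs (by linarith)] at this
  have h5 : Real.log (P.R3 ^ 2) ≤ Real.log x := by
    rw [Real.log_pow]; push_cast
    nlinarith
  exact (Real.log_le_log_iff (by have := P.R3_pos; positivity) hx).1 h5

/-- Beyond R2 the weight is 1, so a height of at least 1 would give Iq ≥ 1, whereas the upper
barrier keeps it below 1/4. -/
lemma h_lt_one (H : P.InV h x W) (ht : 0 ≤ P.tt h x) : h < 1 := by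
  by_contra hh
  push Not at hh
  have h1 := H.sq_le ht
  have h2 : P.m P.sig x = 1 := m_one (P.sq23.le.trans h1)
  have h3 := one_le_eFun (C := P.C P.sig) (by rw [C_sig]; exact Real.log_nonneg (by norm_num)) hh
  have h4 := P.ps_nonneg h x
  have h5 := H.Iq_lt
  have := P.cs_R; have := P.cs_pos
  rw [Iq, h2] at h5
  nlinarith

lemma Iq_eq (H : P.InV h x W) (ht : 0 ≤ P.tt h x) (mu : ℝ) : P.Iq mu h x = P.I0 h x := by
  rw [Iq, I0, m_one (P.sq23.le.trans (H.sq_le ht)), eFun_of_le (H.h_lt_one ht).le, mul_one]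

lemma h_lt (H : P.InV h x W) (ht : 0 ≤ P.tt h x) : h < 1 / 4 := by
  have h1 := H.Iq_lt
  rw [H.Iq_eq ht, I0] at h1
  have := P.ps_nonneg h x
  have := P.cs_R; have := P.cs_pos
  nlinarith

lemma c_eq_zero (H : P.InV h x W) (ht : 0 ≤ P.tt h x) : P.c x = 0 :=
  c_zero (P.sq23.le.trans (H.sq_le ht))

lemma d_eq_zero (H : P.InV h x W) (ht : 0 ≤ P.tt h x) : P.d x = 0 :=
  d_zero (P.sq23.le.trans (H.sq_le ht))

lemma tt_neg (H : P.InV h x W) (hh : 1 / 4 ≤ h) : P.tt h x < 0 := by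
  by_contra ht
  push Not at ht
  linarith [H.h_lt ht]

/-- R1 = 4(R + 1) is chosen so that |z| ≥ R1 at such a height forces Iq ≥ cs (R + 1), above the
barrier. -/
lemma x_lt (H : P.InV h x W) (hh : 1 ≤ h) : x < P.R1 ^ 2 := by
  by_contra hx
  push Not at hx
  have ht := H.tt_neg (by linarith)
  have h1 := H.Iq_lt
  rw [Iq, ps_of_nonpos ht.le, add_zero] at h1
  have h3 := one_le_eFun (C := P.C P.sig) (by rw [C_sig]; exact Real.log_nonneg (by norm_num)) hh
  have h4 : P.R1 / (4 / P.cs) ≤ P.m P.sig x := by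
    have hx0 : 0 < x := sq1_pos.trans_le hx
    have e : P.R1 / (4 / P.cs) = Real.exp (Real.log P.R1 - Real.log (4 / P.cs)) := by
      rw [Real.exp_sub, Real.exp_log R1_pos, Real.exp_log (by have := P.cs_pos; positivity)]
    rw [e, m, powStp]
    apply Real.exp_le_exp.2
    have e2 : P.sig / (2 * P.sig) = 1 / 2 := by have := P.sig_pos.ne'; field_simp
    rw [e2]
    have h5 : 2 * Real.log P.R1 ≤ Real.log x := by
      have := Real.log_le_log sq1_pos hx
      rw [Real.log_pow] at this; exact_mod_cast this
    have h6 : Real.log P.R1 ≤ Real.log (4 / P.cs) :=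
      Real.log_le_log R1_pos (P.R12.le.trans P.Pi_ge)
    have s0 := stp_nonneg (P.R1 ^ 2) (P.R2 ^ 2) x
    have s1 := stp_le_one (P.R1 ^ 2) (P.R2 ^ 2) x
    nlinarith
  have h7 : P.R1 / (4 / P.cs) = P.cs * (P.R + 1) := by
    have := P.cs_pos.ne'
    unfold R1; field_simp
  have := P.cs_pos
  have := P.m_pos P.sig x
  nlinarith

lemma c_eq_one (H : P.InV h x W) (hh : 1 ≤ h) : P.c x = 1 := c_one (H.x_lt hh).le

/-- Where the bending is active the block field is explicit. -/
lemma gr_eq_one (H : P.InV h x W) (ht : 0 ≤ P.tt h x) (mu : ℝ) : P.gr mu h x = 1 := by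
  have := H.h_lt_one ht
  rw [gr, b_one this.le, H.c_eq_zero ht, jj_zero (by linarith)]; ring

lemma gr_ge (H : P.InV h x W) {mu : ℝ} (hmu : P.Adm mu) : min mu 1 / 2 ≤ P.gr mu h x := by
  have m0 : 0 < min mu 1 := lt_min hmu.1 one_pos
  have m1 := min_le_left mu 1
  have m2 := min_le_right mu 1
  rcases le_or_gt 0 (P.tt h x) with ht | ht
  · rw [H.gr_eq_one ht]; linarith
  rcases le_or_gt h 1 with h1 | h1
  · rw [gr, b_one h1, jj_zero (by linarith), stp_of_le (by norm_num) (by linarith)]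
    have hc := P.c_nonneg x
    rcases le_or_gt 0 h with h0 | h0
    · have : 0 ≤ mu * P.c x * h := mul_nonneg (mul_nonneg hmu.1.le hc) h0
      linarith
    · have e := H.I0_gt'
      rw [I0, ps_of_nonpos ht.le, add_zero] at e
      have s := P.c_slow x
      have := P.cs_pos
      have a1 : mu * P.c x ≤ P.sig * P.c x := mul_le_mul_of_nonneg_right hmu.2.1 hc
      have a2 : mu * P.c x * (-h) ≤ P.sig * P.c x * P.cs := by
        apply mul_le_mul a1 (by linarith) (by linarith) (mul_nonneg P.sig_pos.le hc)
      linarith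
  · rw [gr, H.c_eq_one h1.le]
    have hb := b_nonneg hmu h
    have s0 := stp_nonneg 2 3 h
    have s1 := stp_le_one 2 3 h
    have : mu ≤ mu * h := by nlinarith [hmu.1]
    unfold jj
    nlinarith [mul_nonneg s0 (sub_nonneg.2 this)]

lemma gr_pos (H : P.InV h x W) {mu : ℝ} (hmu : P.Adm mu) : 0 < P.gr mu h x := by
  have : 0 < min mu 1 := lt_min hmu.1 one_pos
  linarith [H.gr_ge hmu]

end InV

lemma fh_nonpos {mu h : ℝ} (hmu : P.Adm mu) (x : ℝ) (hh : 0 ≤ h) : P.fh mu h x ≤ 0 := by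
  have := jj_nonneg h
  have := P.ch_nonneg h x
  have : 0 ≤ mu * P.c x * h * stp 2 3 h :=
    mul_nonneg (mul_nonneg (mul_nonneg hmu.1.le (P.c_nonneg x)) hh) (stp_nonneg _ _ _)
  unfold fh; linarith

end Par
namespace Par
variable {P : Par}

/-! ### Derivatives along orbits in the block -/

section curve
variable {h x W : ℝ → ℝ} {t mu : ℝ}

/-- The bending terms of h' and z' cancel in the logarithmic derivative of T. -/
lemma hasDerivAt_T (hh : HasDerivAt h (P.fh mu (h t) (x t)) t)
    (hx : HasDerivAt x (2 * P.fz mu (h t) (x t) * x t) t) :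
    HasDerivAt (fun s => P.T (h s) (x s))
      (2 * P.sig * P.T (h t) (x t) * P.gr mu (h t) (x t)) t := by
  have h1 := hx.mul ((hh.const_mul (2 * P.sig)).neg.exp)
  refine HasDerivAt.congr_deriv (f := fun s => P.T (h s) (x s)) h1 ?_
  simp only [T, fz, fh, gr, jj, Pi.neg_apply]
  ring

/-- Bending acts only where the growth rate is 1. This turns the derivative of `ps` into exactly
`ch`, the amount that the bending takes from h. -/
lemma ch_mul_gr (H : P.InV (h t) (x t) (W t)) :
    P.ch (h t) (x t) * P.gr mu (h t) (x t) = P.ch (h t) (x t) := by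
  rcases le_or_gt (P.tt (h t) (x t)) 0 with ht | ht
  · rw [ch_of_nonpos ht, zero_mul]
  · rw [H.gr_eq_one ht.le, mul_one]

lemma hasDerivAt_ps (hh : HasDerivAt h (P.fh mu (h t) (x t)) t)
    (hx : HasDerivAt x (2 * P.fz mu (h t) (x t) * x t) t) (H : P.InV (h t) (x t) (W t)) :
    HasDerivAt (fun s => P.ps (h s) (x s)) (P.ch (h t) (x t)) t := by
  have h1 := (hasDerivAt_psi P.k_pos P.sig_pos (P.T (h t) (x t))).comp t (hasDerivAt_T hh hx)
  refine HasDerivAt.congr_deriv (f := fun s => P.ps (h s) (x s)) h1 ?_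
  rw [← ch_mul_gr (mu := mu) H]
  rcases eq_or_ne (P.T (h t) (x t)) 0 with h0 | h0
  · have : P.ch (h t) (x t) = 0 := by
      apply ch_of_nonpos
      have := k_pos (P := P)
      simp [tt, h0, this.le]
    rw [h0, this]; simp
  · have := P.sig_pos.ne'
    unfold ch
    field_simp

/-- The evolution of the quasi-invariant `Iq nu` under the field with parameter `mu`. -/
lemma hasDerivAt_Iq (nu : ℝ) (hh : HasDerivAt h (P.fh mu (h t) (x t)) t)
    (hx : HasDerivAt x (2 * P.fz mu (h t) (x t) * x t) t) (H : P.InV (h t) (x t) (W t))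
    (hx0 : 0 < x t) :
    HasDerivAt (fun s => P.Iq nu (h s) (x s)) (P.m nu (x t) * eFun (P.C nu) (h t) * P.c (x t) *
      (nu * P.b mu (h t) - mu * P.b nu (h t))) t := by
  have hm := (hasDerivAt_powStp (P.R1 ^ 2) (P.R2 ^ 2) (2 * Real.log (4 / P.cs))
    (nu / (2 * P.sig)) hx0.ne').comp t hx
  have he := (hasDerivAt_eFun (P.C nu) (h t)).comp t hh
  refine HasDerivAt.congr_deriv (f := fun s => P.Iq nu (h s) (x s))
    ((he.mul hm).add (hasDerivAt_ps hh hx H)) ?_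
  have hs := P.sig_pos.ne'
  have e1 := mul_deriv_eFun (P.C nu) (h t)
  have e2 : deriv (eFun (P.C nu)) (h t) * jj (h t) = 0 := by
    rcases le_or_gt (h t) 2 with h2 | h2
    · rw [jj_zero h2, mul_zero]
    · rw [deriv_eFun_of_ge h2.le, zero_mul]
  have e4 : P.m nu (x t) = powStp (P.R1 ^ 2) (P.R2 ^ 2) (2 * Real.log (4 / P.cs))
    (nu / (2 * P.sig)) (x t) := rfl
  have e5 : P.c (x t) = gg (P.R1 ^ 2) (P.R2 ^ 2) (2 * Real.log (4 / P.cs)) (x t) := rfl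
  have e6 : P.b nu (h t) = gg 1 2 (P.C nu) (h t) := rfl
  simp only [Function.comp]
  rw [← e4, ← e5]
  rw [← e6] at e1
  have e7 : nu / (2 * P.sig) * P.c (x t) / x t * P.m nu (x t) *
      (2 * P.fz mu (h t) (x t) * x t) = nu * P.c (x t) * P.m nu (x t) *
      (P.b mu (h t) - P.ch (h t) (x t)) := by
    unfold fz; field_simp
  rw [e7]
  -- Without bending, the logarithmic derivatives of `eFun` and `m` balance. With bending, h has
  -- slope -ch and `ps` has slope ch, while the weight is 1.
  rcases le_or_gt (P.tt (h t) (x t)) 0 with ht | ht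
  · rw [ch_of_nonpos ht, fh, ch_of_nonpos ht]
    simp only [jj] at e2 ⊢
    linear_combination (-(mu * P.c (x t)) * P.m nu (x t)) * e1 +
      (-1 + mu * P.c (x t) * h t) * P.m nu (x t) * e2
  · have h1 := H.h_lt_one ht.le
    rw [fh, H.c_eq_zero ht.le, jj_zero (by linarith), deriv_eFun_of_lt h1,
      m_one (P.sq23.le.trans (H.sq_le ht.le))]
    ring

lemma hasDerivAt_I0 (hh : HasDerivAt h (P.fh mu (h t) (x t)) t)
    (hx : HasDerivAt x (2 * P.fz mu (h t) (x t) * x t) t) (H : P.InV (h t) (x t) (W t)) :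
    HasDerivAt (fun s => P.I0 (h s) (x s))
      (-(mu * P.c (x t) * h t * stp 2 3 (h t)) - jj (h t)) t := by
  refine HasDerivAt.congr_deriv (f := fun s => P.I0 (h s) (x s))
    (hh.add (hasDerivAt_ps hh hx H)) ?_
  unfold fh; ring

lemma hasDerivAt_K (hh : HasDerivAt h (P.fh mu (h t) (x t)) t)
    (hx : HasDerivAt x (2 * P.fz mu (h t) (x t) * x t) t) (hx0 : 0 ≤ x t) :
    HasDerivAt (fun s => P.K (h s) (x s))
      (2 * P.sig * P.T (h t) (x t) * P.gr mu (h t) (x t) / (1 + P.T (h t) (x t)) ^ 2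
        - deriv expNegInvGlue (h t - 1 / 2) * P.fh mu (h t) (x t)) t := by
  have hT := hasDerivAt_T hh hx
  have h0 := P.T_nonneg (h := h t) hx0
  have h1 := (hT.div (hT.const_add 1) (by linarith)).sub
    ((hasDerivAt_expNegInvGlue (h t - 1 / 2)).comp t (hh.sub_const (1 / 2)))
  refine HasDerivAt.congr_deriv (f := fun s => P.K (h s) (x s)) h1 ?_
  congr 1
  have : (1 + P.T (h t) (x t)) ≠ 0 := by linarith
  field_simp
  ring

lemma hasDerivAt_F (hx : HasDerivAt x (2 * P.fz mu (h t) (x t) * x t) t) :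
    HasDerivAt (fun s => P.F (x s)) (P.F (x t) * (4 * P.fz mu (h t) (x t) * x t *
      deriv (stp (P.R1 ^ 2) (P.R2 ^ 2)) (x t) * Real.log P.eps)) t := by
  have h1 := ((hasDerivAt_stp (P.R1 ^ 2) (P.R2 ^ 2) (x t)).comp t hx)
  have h2 := (((h1.const_sub 1).const_mul 2).mul_const (-Real.log P.eps)).exp
  refine HasDerivAt.congr_deriv (f := fun s => P.F (x s)) h2 ?_
  simp only [F, Function.comp]
  ring

/-- The fibre size `W F(x)` is contracted. -/
lemma WF_rate {h x W : ℝ} (hmu : P.Adm mu) (H : P.InV h x W) :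
    2 * P.fw mu h x + 4 * P.fz mu h x * x * deriv (stp (P.R1 ^ 2) (P.R2 ^ 2)) x *
      Real.log P.eps ≤ -(2 * P.eta * P.b mu h * stp (P.R1 ^ 2) (P.R2 ^ 2) x) := by
  have hS : deriv (stp (P.R1 ^ 2) (P.R2 ^ 2)) x ≤ 0 := deriv_stp_nonpos P.sq12 x
  have e : P.ch h x * deriv (stp (P.R1 ^ 2) (P.R2 ^ 2)) x = 0 := by
    rcases le_or_gt (P.tt h x) 0 with ht | ht
    · rw [ch_of_nonpos ht, zero_mul]
    · rw [deriv_stp_of_ge P.sq12 (P.sq23.le.trans (H.sq_le ht.le)), mul_zero]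
  have hb := b_nonneg hmu h
  have he := P.eta_pos
  -- In the transition zone the decay produced by `d` outweighs the growth of F from 1 to ε⁻²; this
  -- is where β must be small (`log_d`).
  have key : 0 ≤ P.b mu h * (-(x * deriv (stp (P.R1 ^ 2) (P.R2 ^ 2)) x) *
      (P.eta * (-(2 * P.sig / P.eta * Real.log P.bet) - Real.log x) +
        2 * P.sig * Real.log P.eps)) := by
    rcases le_or_gt (P.R2 ^ 2) x with hx | hx
    · rw [deriv_stp_of_ge P.sq12 hx]; simp
    rcases le_or_gt x (P.R1 ^ 2) with hx' | hx'
    · rw [deriv_stp_of_le P.sq12 hx']; simp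
    have hx0 : 0 < x := P.sq1_pos.trans hx'
    apply mul_nonneg hb
    apply mul_nonneg
    · nlinarith
    · have h1 := P.log_d
      have h2 := Real.log_le_log hx0 hx.le
      have h3 : 0 ≤ P.eta * (-(2 * P.sig / P.eta * Real.log P.bet) - Real.log x +
        2 * P.sig / P.eta * Real.log P.eps) := mul_nonneg he.le (by linarith)
      have h4 : P.eta * (-(2 * P.sig / P.eta * Real.log P.bet) - Real.log x +
        2 * P.sig / P.eta * Real.log P.eps) = P.eta * (-(2 * P.sig / P.eta * Real.log P.bet) -
          Real.log x) + 2 * P.sig * Real.log P.eps := by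
        field_simp
      linarith
  simp only [fw, fz, d, gg]
  have e' : P.sig * (P.b mu h - P.ch h x) * x * deriv (stp (P.R1 ^ 2) (P.R2 ^ 2)) x =
      P.sig * P.b mu h * x * deriv (stp (P.R1 ^ 2) (P.R2 ^ 2)) x := by
    linear_combination (-P.sig * x) * e
  have e2 : 4 * (P.sig * (P.b mu h - P.ch h x)) * x * deriv (stp (P.R1 ^ 2) (P.R2 ^ 2)) x *
      Real.log P.eps = 4 * (P.sig * P.b mu h * x * deriv (stp (P.R1 ^ 2) (P.R2 ^ 2)) x) *
      Real.log P.eps := by rw [← e']; ring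
  rw [e2]
  nlinarith [key]

/-- The condition on `μ` under which the upper barrier is strict. -/
def Good (P : Par) (mu : ℝ) : Prop := P.Adm mu ∧ ∀ h x W, h ≤ 10 → P.InV h x W → 0 < P.A1 h x →
  P.m P.sig x * eFun (P.C P.sig) h * P.c x * (P.sig * P.b mu h - mu * P.b P.sig h) / P.nu <
    2 * P.sig * P.T h x * P.gr mu h x / (1 + P.T h x) ^ 2

/-- The weight `m` involves log |z| and is not smooth at z = 0. There it is at most cs/4, so the
upper barrier is inactive and its contribution to `tau` vanishes. -/
lemma A1_nonpos_of_small {h x : ℝ} (hx : 0 ≤ x) (hx1 : x ≤ 1) (ht : P.tt h x ≤ 0) :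
    P.A1 h x ≤ 0 := by
  have hm : P.m P.sig x ≤ (4 / P.cs)⁻¹ := by
    have h1 : x ≤ P.R1 ^ 2 := by
      have := P.R_ge
      have : 1 ≤ P.R1 := by unfold R1; linarith
      nlinarith
    rw [m, powStp_of_le P.sq12 _ h1, ← Real.exp_log (show 0 < (4 / P.cs)⁻¹ by
      have := P.cs_pos; positivity), Real.log_inv]
    apply Real.exp_le_exp.2
    have e2 : P.sig / (2 * P.sig) = 1 / 2 := by have := P.sig_pos.ne'; field_simp
    rw [e2]
    have := Real.log_nonpos hx hx1
    linarith
  have hq : P.Iq P.sig h x ≤ P.cs := by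
    rw [Iq, ps_of_nonpos ht, add_zero, C_sig]
    have h4 : eFun (Real.log 4) h ≤ 4 := by
      have := eFun_le (C := Real.log 4) (h := h)
        (Real.log_le_log (by norm_num) (by norm_num))
      rwa [Real.exp_log (by norm_num)] at this
    have hp := P.m_pos P.sig x
    have e : (4 / P.cs)⁻¹ = P.cs / 4 := inv_div _ _
    rw [e] at hm
    have := P.cs_pos
    nlinarith
  have hK := P.K_gt (h := h) hx
  have : (P.Iq P.sig h x - P.cs * (P.R + 5 / 8)) / P.nu ≤ -1 := by
    rw [div_le_iff₀ P.nu_pos]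
    have := P.nu_le_dS; have := P.dS_le; have := P.R_ge; have := P.cs_pos
    nlinarith
  unfold A1; linarith

lemma K_deriv_nonneg (hmu : P.Adm mu) (h x : ℝ) :
    0 ≤ -(deriv expNegInvGlue (h - 1 / 2) * P.fh mu h x) := by
  rcases le_or_gt h (1 / 2) with hh | hh
  · rw [deriv_expNegInvGlue_of_nonpos (by linarith)]; simp
  · have := deriv_expNegInvGlue_nonneg (h - 1 / 2)
    have := fh_nonpos hmu x (by linarith : 0 ≤ h)
    nlinarith

/-- The Lyapunov function `tau` is strictly decreasing along orbits in the block, wherever it is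
positive. -/
lemma hasDerivAt_tau (hg : P.Good mu) (hh : HasDerivAt h (P.fh mu (h t) (x t)) t)
    (hx : HasDerivAt x (2 * P.fz mu (h t) (x t) * x t) t)
    (hW : HasDerivAt W (2 * P.fw mu (h t) (x t) * W t) t) (hpos : ∀ s, 0 ≤ x s)
    (H : P.InV (h t) (x t) (W t)) (h10 : h t ≤ 10) :
    ∃ D, HasDerivAt (fun s => P.tau (h s) (x s) (W s)) D t ∧ D ≤ 0 ∧
      (0 < P.tau (h t) (x t) (W t) → D < 0) := by
  have hmu := hg.1
  have hK := hasDerivAt_K hh hx H.1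
  set DK := 2 * P.sig * P.T (h t) (x t) * P.gr mu (h t) (x t) / (1 + P.T (h t) (x t)) ^ 2
        - deriv expNegInvGlue (h t - 1 / 2) * P.fh mu (h t) (x t) with hDK
  have k1 := K_deriv_nonneg hmu (h t) (x t)
  have hgr := H.gr_pos hmu
  have hs := P.sig_pos
  have k2 : 0 ≤ 2 * P.sig * P.T (h t) (x t) * P.gr mu (h t) (x t) /
      (1 + P.T (h t) (x t)) ^ 2 := by
    have := P.T_nonneg (h := h t) H.1
    positivity
  have k3 : 0 < x t → 0 < 2 * P.sig * P.T (h t) (x t) * P.gr mu (h t) (x t) /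
      (1 + P.T (h t) (x t)) ^ 2 := by
    intro h0
    have := P.T_pos (h := h t) h0
    positivity
  have hDK0 : 0 ≤ DK := by linarith
  -- the three summands
  have c1 : ∃ D, HasDerivAt (fun s => expNegInvGlue (P.A1 (h s) (x s))) D t ∧ D ≤ 0 ∧
      (0 < P.A1 (h t) (x t) → D < 0) := by
    rcases H.1.eq_or_lt with h0 | h0
    -- On the axis the summand is identically zero near t, so its derivative needs no derivative of
    -- `m`.
    · have hn : P.A1 (h t) (x t) ≤ 0 :=
        A1_nonpos_of_small H.1 (by rw [← h0]; norm_num) (by rw [← h0]; exact (tt_zero _).le)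
      refine ⟨0, ?_, le_rfl, fun h1 => absurd h1 (not_lt.2 hn)⟩
      have hTc : ContinuousAt (fun s => P.T (h s) (x s)) t := (hasDerivAt_T hh hx).continuousAt
      have ev1 : ∀ᶠ s in 𝓝 t, Real.log (P.T (h s) (x s)) / (2 * P.sig) - P.k ≤ 0 := by
        have := eventually_log_neg P.k_pos hs
        have e : P.T (h t) (x t) = 0 := by rw [← h0, T_zero]
        rw [← e] at this
        exact hTc.eventually (p := fun y => Real.log y / (2 * P.sig) - P.k ≤ 0) (by
          simpa only [e] using this)
      have ev2 : ∀ᶠ s in 𝓝 t, x s < 1 := by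
        apply hx.continuousAt.eventually_lt_const
        rw [← h0]; norm_num
      refine (hasDerivAt_const t (0 : ℝ)).congr_of_eventuallyEq ?_
      filter_upwards [ev1, ev2] with s h1 h2
      exact expNegInvGlue.zero_of_nonpos (A1_nonpos_of_small (hpos s) h2.le h1)
    · have hI := hasDerivAt_Iq P.sig hh hx H h0
      have hA := ((hI.sub_const (P.cs * (P.R + 5 / 8))).div_const P.nu).sub hK
      have hN := (hasDerivAt_expNegInvGlue (P.A1 (h t) (x t))).comp t hA
      refine ⟨_, hN, ?_, ?_⟩
      · rcases le_or_gt (P.A1 (h t) (x t)) 0 with h1 | h1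
        · rw [deriv_expNegInvGlue_of_nonpos h1, zero_mul]
        · have := hg.2 _ _ _ h10 H h1
          exact mul_nonpos_of_nonneg_of_nonpos (deriv_expNegInvGlue_nonneg _) (by linarith)
      · intro h1
        have := hg.2 _ _ _ h10 H h1
        exact mul_neg_of_pos_of_neg (deriv_expNegInvGlue_pos h1) (by linarith)
  have c2 : ∃ D, HasDerivAt (fun s => expNegInvGlue (P.A2 (h s) (x s))) D t ∧ D ≤ 0 ∧
      (0 < P.A2 (h t) (x t) → D < 0) := by
    have hI := hasDerivAt_I0 hh hx H
    have hA := ((hI.neg.sub_const (3 / 2 * P.dS)).div_const P.nu).sub hK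
    have hN := (hasDerivAt_expNegInvGlue (P.A2 (h t) (x t))).comp t hA
    have hstrict : 0 < P.A2 (h t) (x t) →
        -(-(mu * P.c (x t) * h t * stp 2 3 (h t)) - jj (h t)) / P.nu - DK < 0 := by
      intro h1
      -- An active lower barrier forces a negative height, and there -μ c h pushes the height up.
      have hI0 : P.I0 (h t) (x t) < 0 := by
        have hKg := P.K_gt (h := h t) H.1
        have h2 : -1 < (-P.I0 (h t) (x t) - 3 / 2 * P.dS) / P.nu := by
          unfold A2 at h1; linarith
        rw [lt_div_iff₀ P.nu_pos] at h2
        have := P.nu_le_dS; have := P.dS_pos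
        linarith
      have hlt : h t < 0 := by have := P.ps_nonneg (h t) (x t); unfold I0 at hI0; linarith
      rw [jj_zero (by linarith), stp_of_le (by norm_num) (by linarith)]
      have hc := P.c_nonneg (x t)
      have hneg : mu * P.c (x t) * h t ≤ 0 :=
        mul_nonpos_of_nonneg_of_nonpos (mul_nonneg hmu.1.le hc) hlt.le
      have hdiv : -(-(mu * P.c (x t) * h t * 1) - 0) / P.nu ≤ 0 :=
        div_nonpos_of_nonpos_of_nonneg (by linarith) P.nu_pos.le
      rcases H.1.eq_or_lt with h0 | h0
      · have : -(-(mu * P.c (x t) * h t * 1) - 0) / P.nu < 0 := by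
          apply div_neg_of_neg_of_pos _ P.nu_pos
          rw [← h0, c_one P.sq1_pos.le]
          nlinarith [hmu.1]
        linarith
      · have := k3 h0; linarith
    refine ⟨_, hN, ?_, ?_⟩
    · rcases le_or_gt (P.A2 (h t) (x t)) 0 with h1 | h1
      · rw [deriv_expNegInvGlue_of_nonpos h1, zero_mul]
      · exact mul_nonpos_of_nonneg_of_nonpos (deriv_expNegInvGlue_nonneg _) (hstrict h1).le
    · intro h1
      exact mul_neg_of_pos_of_neg (deriv_expNegInvGlue_pos h1) (hstrict h1)
  have c3 : ∃ D, HasDerivAt (fun s => expNegInvGlue (P.A3 (h s) (x s) (W s))) D t ∧ D ≤ 0 ∧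
      (0 < P.A3 (h t) (x t) (W t) → D < 0) := by
    have hA := ((hW.mul (hasDerivAt_F hx)).sub_const 3).sub hK
    have hN := (hasDerivAt_expNegInvGlue (P.A3 (h t) (x t) (W t))).comp t hA
    have hstrict : 0 < P.A3 (h t) (x t) (W t) → 2 * P.fw mu (h t) (x t) * W t * P.F (x t) +
        W t * (P.F (x t) * (4 * P.fz mu (h t) (x t) * x t *
          deriv (stp (P.R1 ^ 2) (P.R2 ^ 2)) (x t) * Real.log P.eps)) - DK < 0 := by
      intro h1
      have hWF : 0 < W t * P.F (x t) := by
        have := P.K_gt (h := h t) H.1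
        unfold A3 at h1; linarith
      have hr := WF_rate hmu H
      have hb := b_nonneg hmu (h t)
      have hS := stp_nonneg (P.R1 ^ 2) (P.R2 ^ 2) (x t)
      have he := P.eta_pos
      have e : 2 * P.fw mu (h t) (x t) * W t * P.F (x t) +
        W t * (P.F (x t) * (4 * P.fz mu (h t) (x t) * x t *
          deriv (stp (P.R1 ^ 2) (P.R2 ^ 2)) (x t) * Real.log P.eps)) = W t * P.F (x t) *
          (2 * P.fw mu (h t) (x t) + 4 * P.fz mu (h t) (x t) * x t *
          deriv (stp (P.R1 ^ 2) (P.R2 ^ 2)) (x t) * Real.log P.eps) := by ring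
      rw [e]
      have hle := mul_le_mul_of_nonneg_left hr hWF.le
      have hn : 0 ≤ 2 * P.eta * P.b mu (h t) * stp (P.R1 ^ 2) (P.R2 ^ 2) (x t) := by positivity
      have hn2 := mul_nonneg hWF.le hn
      -- Strictness comes from T if z ≠ 0. On the axis it comes from the fibre contraction if h ≤
      -- 1/2, and from the second term of `K` if h > 1/2.
      rcases H.1.eq_or_lt with h0 | h0
      · rcases le_or_gt (h t) (1 / 2) with hh2 | hh2
        · have : 0 < W t * P.F (x t) *
              (2 * P.eta * P.b mu (h t) * stp (P.R1 ^ 2) (P.R2 ^ 2) (x t)) := by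
            rw [b_one (by linarith), ← h0, stp_of_le P.sq12 P.sq1_pos.le]
            rw [← h0] at hWF
            positivity
          linarith
        · have hfh : P.fh mu (h t) (x t) < 0 := by
            rw [fh, ← h0, c_one P.sq1_pos.le, ch_of_nonpos (tt_zero _).le]
            have s0 := stp_nonneg 2 3 (h t)
            have s1 := stp_le_one 2 3 (h t)
            have : 0 < mu * h t := mul_pos hmu.1 (by linarith)
            unfold jj
            rcases s0.eq_or_lt with s | s
            · rw [← s]; norm_num
            · have := mul_pos this s
              nlinarith
          have := deriv_expNegInvGlue_pos (show 0 < h t - 1 / 2 by linarith)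
          have := mul_neg_of_pos_of_neg this hfh
          linarith
      · have := k3 h0; linarith
    refine ⟨_, hN, ?_, ?_⟩
    · rcases le_or_gt (P.A3 (h t) (x t) (W t)) 0 with h1 | h1
      · rw [deriv_expNegInvGlue_of_nonpos h1, zero_mul]
      · exact mul_nonpos_of_nonneg_of_nonpos (deriv_expNegInvGlue_nonneg _) (hstrict h1).le
    · intro h1
      exact mul_neg_of_pos_of_neg (deriv_expNegInvGlue_pos h1) (hstrict h1)
  obtain ⟨D1, d1, n1, s1⟩ := c1
  obtain ⟨D2, d2, n2, s2⟩ := c2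
  obtain ⟨D3, d3, n3, s3⟩ := c3
  refine ⟨D1 + D2 + D3, (d1.add d2).add d3, by linarith, fun hpos => ?_⟩
  by_contra hD
  push Not at hD
  have q1 : P.A1 (h t) (x t) ≤ 0 := by by_contra hc; push Not at hc; linarith [s1 hc]
  have q2 : P.A2 (h t) (x t) ≤ 0 := by by_contra hc; push Not at hc; linarith [s2 hc]
  have q3 : P.A3 (h t) (x t) (W t) ≤ 0 := by by_contra hc; push Not at hc; linarith [s3 hc]
  unfold tau at hpos
  rw [expNegInvGlue.zero_of_nonpos q1, expNegInvGlue.zero_of_nonpos q2,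
    expNegInvGlue.zero_of_nonpos q3] at hpos
  linarith

end curve

/-- When the upper barrier is active and bending is off, h and x range in a bounded set with x ≥ 1,
so `K` grows at a uniform rate. The drift of `Iq` σ is of order σ - μ. When bending acts there is no
drift, since c = 0. -/
lemma exists_good (P : Par) : ∃ mu₀ ∈ Ioo 0 P.sig, ∀ mu ∈ Icc mu₀ P.sig, P.Good mu := by
  obtain ⟨B, hB⟩ := (isCompact_Icc (a := (0 : ℝ)) (b := 2)).exists_bound_of_continuousOn
    (f := P.b P.sig) (contDiff_gg (by norm_num) (by norm_num) _).continuous.continuousOn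
  have hs := P.sig_pos
  have hcs := P.cs_pos
  have hn := P.nu_pos
  have hL := P.log_Pi_pos
  have h2 : 0 < Real.log 2 := Real.log_pos (by norm_num)
  set Cc := 1 / (2 * P.sig * P.cs) with hCc
  have hCc0 : 0 < Cc := by positivity
  set κ := min (P.sig / 2) 1 / 2 with hκ
  have hκ0 : 0 < κ := by have : 0 < min (P.sig / 2) 1 := lt_min (by linarith) one_pos
                         positivity
  -- A lower bound for the growth of T/(1+T): x ≥ 1 and h ≤ 10 bound T below, `tt` < 0 bounds it
  -- above, and κ bounds `gr` below for μ ≥ σ/2.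
  set r0 := 2 * P.sig * Real.exp (-(2 * P.sig * 10)) * κ / (1 + Real.exp (2 * P.sig * P.k)) ^ 2
    with hr0
  have hr0p : 0 < r0 := by positivity
  set B' := max B 1 with hB'
  have hB'1 : 1 ≤ B' := le_max_right _ _
  -- The three entries give μ ≥ σ/2, then C μ ≥ log 2, then a drift smaller than r0.
  set δ := min (P.sig / 2) (min (P.sig * Real.log 2 / Real.log (4 / P.cs))
    (r0 * P.nu / (B' * Cc))) with hδ
  have hδ0 : 0 < δ := by
    refine lt_min (by linarith) (lt_min (by positivity) (by positivity))
  have hδ1 : δ ≤ P.sig / 2 := min_le_left _ _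
  have hδ2 : δ ≤ P.sig * Real.log 2 / Real.log (4 / P.cs) :=
    (min_le_right _ _).trans (min_le_left _ _)
  have hδ3 : δ ≤ r0 * P.nu / (B' * Cc) := (min_le_right _ _).trans (min_le_right _ _)
  refine ⟨P.sig - δ, ⟨by linarith, by linarith⟩, fun mu hmu => ?_⟩
  have hd : P.sig - mu ≤ δ := by linarith [hmu.1]
  have hmu0 : P.sig / 2 ≤ mu := by linarith
  have hadm : P.Adm mu := by
    refine ⟨by linarith, hmu.2, ?_⟩
    have e : P.C mu = Real.log 4 - (P.sig - mu) / P.sig * Real.log (4 / P.cs) := by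
      rw [← C_sig (P := P)]
      unfold C; field_simp; ring
    have e2 : (P.sig - mu) / P.sig * Real.log (4 / P.cs) ≤ Real.log 2 := by
      rw [div_mul_eq_mul_div, div_le_iff₀ hs]
      have := hd.trans hδ2
      rw [le_div_iff₀ hL] at this
      linarith
    have e3 : Real.log 4 = 2 * Real.log 2 := by
      rw [show (4 : ℝ) = 2 ^ 2 by norm_num, Real.log_pow]; norm_num
    linarith
  refine ⟨hadm, fun h x W h10 H hA => ?_⟩
  have hx : 0 < x := by
    rcases H.1.eq_or_lt with rfl | h0
    · exact absurd hA (not_lt.2 (A1_nonpos_of_small le_rfl (by norm_num) (tt_zero h).le))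
    · exact h0
  have hT := P.T_pos (h := h) hx
  have hgr := H.gr_pos hadm
  rcases le_or_gt 0 (P.tt h x) with ht | ht
  · rw [H.c_eq_zero ht]
    simp only [mul_zero, zero_mul, zero_div]
    positivity
  have hI : P.cs * P.R < P.Iq P.sig h x := by
    have hK := P.K_gt (h := h) hx.le
    have h3 : -1 < (P.Iq P.sig h x - P.cs * (P.R + 5 / 8)) / P.nu := by
      unfold A1 at hA; linarith
    rw [lt_div_iff₀ hn] at h3
    have := P.nu_le_dS; have := P.dS_le
    nlinarith
  have hI2 := H.Iq_lt
  rw [Iq, ps_of_nonpos ht.le, add_zero] at hI hI2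
  have hm := P.m_pos P.sig x
  have hRp := P.R_ge
  have he : 0 < eFun (P.C P.sig) h := by
    by_contra hc
    push Not at hc
    have h0 : 0 < P.cs * P.R := by positivity
    have := mul_nonpos_of_nonpos_of_nonneg hc hm.le
    linarith
  have hh : 0 < h := by
    by_contra hc
    push Not at hc
    rw [eFun_of_le (by linarith)] at he
    linarith
  have he4 : eFun (P.C P.sig) h ≤ 4 := by
    have := eFun_le (C := P.C P.sig) (h := h)
      (by rw [C_sig]; exact Real.log_le_log (by norm_num) (by norm_num))
    rwa [C_sig (P := P), Real.exp_log (by norm_num), ← C_sig (P := P)] at this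
  -- Iq > cs R ≥ 4 cs and eFun ≤ 4 force m > cs, whereas m ≤ cs/4 for x < 1.
  have hx1 : 1 ≤ x := by
    by_contra hc
    push Not at hc
    have hm2 : P.cs * P.R / 4 < P.m P.sig x := by
      have := mul_le_mul_of_nonneg_right he4 hm.le
      linarith
    have h1 : x ≤ P.R1 ^ 2 := by
      have : 1 ≤ P.R1 := by unfold R1; linarith
      nlinarith
    rw [m, powStp_of_le P.sq12 _ h1] at hm2
    have e2 : P.sig / (2 * P.sig) = 1 / 2 := by field_simp
    rw [e2] at hm2
    have h3 : Real.exp (1 / 2 * (Real.log x - 2 * Real.log (4 / P.cs))) ≤ P.cs / 4 := by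
      rw [← Real.exp_log (show 0 < P.cs / 4 by positivity)]
      apply Real.exp_le_exp.2
      have : Real.log (P.cs / 4) = -Real.log (4 / P.cs) := by
        rw [← Real.log_inv, inv_div]
      have := Real.log_nonpos hx.le hc.le
      linarith
    have : P.cs * 4 ≤ P.cs * P.R := mul_le_mul_of_nonneg_left hRp hcs.le
    linarith
  have hTl : Real.exp (-(2 * P.sig * 10)) ≤ P.T h x := by
    have : Real.exp (-(2 * P.sig * 10)) ≤ Real.exp (-(2 * P.sig * h)) :=
      Real.exp_le_exp.2 (neg_le_neg (mul_le_mul_of_nonneg_left h10 (by linarith)))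
    exact this.trans (le_mul_of_one_le_left (Real.exp_pos _).le hx1)
  have hTu : P.T h x ≤ Real.exp (2 * P.sig * P.k) := by
    rw [← Real.log_le_iff_le_exp hT]
    have : Real.log (P.T h x) / (2 * P.sig) < P.k := by unfold tt at ht; linarith
    rw [div_lt_iff₀ (by positivity)] at this
    linarith
  have hκle : κ ≤ P.gr mu h x := by
    refine le_trans ?_ (H.gr_ge hadm)
    rw [hκ]
    have := min_le_min_right 1 hmu0
    linarith
  have hr : r0 ≤ 2 * P.sig * P.T h x * P.gr mu h x / (1 + P.T h x) ^ 2 := by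
    rw [hr0]
    gcongr
  refine lt_of_lt_of_le ?_ hr
  rw [div_lt_iff₀ hn]
  have hc0 := P.c_nonneg x
  have hc1 : P.c x ≤ Cc := by
    have := P.c_slow x
    rw [hCc, le_div_iff₀ (by positivity)]
    linarith
  have hbs0 : 0 ≤ P.b P.sig h := (b_nonneg hadm h).trans (b_le hadm h)
  have hbB : P.b P.sig h ≤ B' := by
    rcases le_or_gt h 2 with h' | h'
    · exact ((le_abs_self _).trans (hB h ⟨hh.le, h'⟩)).trans (le_max_left _ _)
    · rw [b_zero h'.le]; linarith
  have hbb : P.sig * P.b mu h - mu * P.b P.sig h ≤ δ * B' := by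
    have := mul_le_mul_of_nonneg_left (b_le hadm h) hs.le
    have := mul_le_mul hd hbB hbs0 hδ0.le
    linarith
  have hme : P.m P.sig x * eFun (P.C P.sig) h ≤ 1 / 2 := by
    have := P.cs_R
    linarith
  have hme0 : 0 ≤ P.m P.sig x * eFun (P.C P.sig) h := by positivity
  have step1 : P.m P.sig x * eFun (P.C P.sig) h * P.c x ≤ 1 / 2 * Cc :=
    mul_le_mul hme hc1 hc0 (by norm_num)
  have step2 : P.m P.sig x * eFun (P.C P.sig) h * P.c x *
      (P.sig * P.b mu h - mu * P.b P.sig h) ≤ 1 / 2 * Cc * (δ * B') := by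
    have h0 : 0 ≤ P.m P.sig x * eFun (P.C P.sig) h * P.c x := mul_nonneg hme0 hc0
    have : 0 ≤ δ * B' := by positivity
    calc _ ≤ P.m P.sig x * eFun (P.C P.sig) h * P.c x * (δ * B') :=
          mul_le_mul_of_nonneg_left hbb h0
      _ ≤ _ := mul_le_mul_of_nonneg_right step1 this
  have step3 : δ * (B' * Cc) ≤ r0 * P.nu := by
    rwa [le_div_iff₀ (by positivity)] at hδ3
  have : 0 < r0 * P.nu := by positivity
  linarith

end Par

/-! ### The block field and its Lyapunov function on the model space -/

/-- The model space: height and fibre. -/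
abbrev Mod (n : ℕ) : Type := ℝ × Sec n

/-- `|z|²`. -/
def xx {n : ℕ} (p : Mod n) : ℝ := ‖p.2.1‖ ^ 2
/-- `|w|² + |v|²`. -/
def ww {n : ℕ} (p : Mod n) : ℝ := ‖p.2.2.1‖ ^ 2 + ‖p.2.2.2‖ ^ 2

lemma xx_nonneg {n : ℕ} (p : Mod n) : 0 ≤ xx p := sq_nonneg _
lemma ww_nonneg {n : ℕ} (p : Mod n) : 0 ≤ ww p := add_nonneg (sq_nonneg _) (sq_nonneg _)
lemma xx_pos {n : ℕ} {p : Mod n} (h : p.2.1 ≠ 0) : 0 < xx p := by unfold xx; positivity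

lemma contDiff_xx {n : ℕ} : ContDiff ℝ ∞ (xx (n := n)) :=
  (contDiff_norm_sq ℝ).comp contDiff_snd.fst
lemma contDiff_ww {n : ℕ} : ContDiff ℝ ∞ (ww (n := n)) :=
  ((contDiff_norm_sq ℝ).comp contDiff_snd.snd.fst).add
    ((contDiff_norm_sq ℝ).comp contDiff_snd.snd.snd)

namespace Par
variable {P : Par} {n : ℕ}

/-- The block field. -/
def XB (P : Par) (mu : ℝ) (p : Mod n) : Mod n :=
  (P.fh mu p.1 (xx p), P.fz mu p.1 (xx p) • p.2.1, P.fw mu p.1 (xx p) • p.2.2.1,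
    P.fw mu p.1 (xx p) • p.2.2.2)

def tauB (P : Par) (p : Mod n) : ℝ := P.tau p.1 (xx p) (ww p)

/-- The normalization of the Lyapunov functions. -/
def bump (s : ℝ) : ℝ := expNegInvGlue (Real.exp (-1) - s) / expNegInvGlue (Real.exp (-1))

lemma bump_denom : 0 < expNegInvGlue (Real.exp (-1)) :=
  expNegInvGlue.pos_of_pos (Real.exp_pos _)

lemma bump_nonneg (s : ℝ) : 0 ≤ bump s := div_nonneg (expNegInvGlue.nonneg _) bump_denom.le
lemma bump_pos_iff {s : ℝ} : 0 < bump s ↔ s < Real.exp (-1) := by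
  unfold bump
  rw [div_pos_iff_of_pos_right bump_denom]
  constructor
  · intro h
    by_contra hc
    push Not at hc
    rw [expNegInvGlue.zero_of_nonpos (by linarith)] at h
    exact lt_irrefl _ h
  · intro h
    exact expNegInvGlue.pos_of_pos (by linarith)
lemma bump_le_one {s : ℝ} (hs : 0 ≤ s) : bump s ≤ 1 := by
  unfold bump
  rw [div_le_one bump_denom]
  exact expNegInvGlue.monotone (by linarith)
lemma bump_zero : bump 0 = 1 := by
  unfold bump; rw [sub_zero]; exact div_self bump_denom.ne'
lemma contDiff_bump : ContDiff ℝ ∞ bump :=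
  (contDiff_expNegInvGlue.comp (contDiff_const.sub contDiff_id)).div_const _
lemma hasDerivAt_bump {s : ℝ} (hs : s < Real.exp (-1)) :
    ∃ D < 0, HasDerivAt bump D s := by
  have h := ((hasDerivAt_expNegInvGlue (Real.exp (-1) - s)).comp s
    ((hasDerivAt_id s).const_sub (Real.exp (-1)))).div_const (expNegInvGlue (Real.exp (-1)))
  refine ⟨_, ?_, h⟩
  have := deriv_expNegInvGlue_pos (show 0 < Real.exp (-1) - s by linarith)
  apply div_neg_of_neg_of_pos _ bump_denom
  linarith

def ThB (P : Par) (p : Mod n) : ℝ := bump (P.tauB p)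

lemma tau_nonneg (h x W : ℝ) : 0 ≤ P.tau h x W :=
  add_nonneg (add_nonneg (expNegInvGlue.nonneg _) (expNegInvGlue.nonneg _))
    (expNegInvGlue.nonneg _)

lemma ThB_nonneg (p : Mod n) : 0 ≤ P.ThB p := bump_nonneg _
lemma ThB_le_one (p : Mod n) : P.ThB p ≤ 1 := bump_le_one (tau_nonneg _ _ _)

lemma inV_iff {p : Mod n} : P.InV p.1 (xx p) (ww p) ↔ 0 < P.ThB p :=
  ⟨fun h => bump_pos_iff.2 h.2.2, fun h => ⟨xx_nonneg p, ww_nonneg p, bump_pos_iff.1 h⟩⟩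

lemma contDiff_T : ContDiff ℝ ∞ (fun p : Mod n => P.T p.1 (xx p)) :=
  contDiff_xx.mul ((contDiff_const.mul contDiff_fst).neg.exp)

lemma contDiff_ps : ContDiff ℝ ∞ (fun p : Mod n => P.ps p.1 (xx p)) :=
  (contDiff_psi P.k_pos P.sig_pos).comp contDiff_T

lemma contDiff_K : ContDiff ℝ ∞ (fun p : Mod n => P.K p.1 (xx p)) :=
  (contDiff_T.div (contDiff_const.add contDiff_T) (fun p => by
    have := P.T_nonneg (h := p.1) (xx_nonneg p); linarith)).sub
    (contDiff_expNegInvGlue.comp (contDiff_fst.sub contDiff_const))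

lemma eventually_small {p : Mod n} (hz : p.2.1 = 0) :
    ∀ᶠ q in 𝓝 p, xx q ≤ 1 ∧ P.tt q.1 (xx q) ≤ 0 := by
  have h0 : xx p = 0 := by simp [xx, hz]
  have e1 : ∀ᶠ q in 𝓝 p, xx q < 1 :=
    (contDiff_xx.continuous.continuousAt).eventually_lt_const (by rw [h0]; norm_num)
  have e2 := eventually_log_neg P.k_pos P.sig_pos
  have hc : Tendsto (fun q : Mod n => P.T q.1 (xx q)) (𝓝 p) (𝓝 0) := by
    have := (contDiff_T (P := P) (n := n)).continuous.tendsto p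
    rwa [h0, T_zero] at this
  filter_upwards [e1, hc.eventually e2] with q h1 h2
  exact ⟨h1.le, h2⟩

lemma contDiff_tauB : ContDiff ℝ ∞ (P.tauB (n := n)) := by
  have c2 : ContDiff ℝ ∞ (fun p : Mod n => expNegInvGlue (P.A2 p.1 (xx p))) :=
    contDiff_expNegInvGlue.comp ((((contDiff_fst.add contDiff_ps).neg.sub
      contDiff_const).div_const _).sub contDiff_K)
  have c3 : ContDiff ℝ ∞ (fun p : Mod n => expNegInvGlue (P.A3 p.1 (xx p) (ww p))) := by
    refine contDiff_expNegInvGlue.comp (((contDiff_ww.mul ?_).sub contDiff_const).sub contDiff_K)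
    exact ((contDiff_const.mul (contDiff_const.sub ((contDiff_stp _ _).comp contDiff_xx))).mul
      contDiff_const).exp
  have c1 : ContDiff ℝ ∞ (fun p : Mod n => expNegInvGlue (P.A1 p.1 (xx p))) := by
    rw [contDiff_iff_contDiffAt]
    intro p
    -- The only obstruction to smoothness is the logarithm in `m`, and near z = 0 the whole term
    -- vanishes.
    rcases eq_or_ne p.2.1 0 with hz | hz
    · refine (contDiffAt_const (c := (0 : ℝ))).congr_of_eventuallyEq ?_
      filter_upwards [eventually_small (P := P) hz] with q hq
      exact expNegInvGlue.zero_of_nonpos (A1_nonpos_of_small (xx_nonneg q) hq.1 hq.2)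
    · refine contDiff_expNegInvGlue.contDiffAt.comp p (ContDiffAt.sub (ContDiffAt.div_const
        (ContDiffAt.sub (ContDiffAt.add (ContDiffAt.mul ?_ ?_) contDiff_ps.contDiffAt)
          contDiffAt_const) _) contDiff_K.contDiffAt)
      · exact ((contDiff_eFun _).comp contDiff_fst).contDiffAt
      · exact (contDiffAt_powStp _ _ _ _ (xx_pos hz).ne').comp p contDiff_xx.contDiffAt
  exact (c1.add c2).add c3

lemma contDiff_ThB : ContDiff ℝ ∞ (P.ThB (n := n)) := contDiff_bump.comp contDiff_tauB

lemma contDiff_XB : ContDiff ℝ ∞ (fun q : ℝ × Mod n => P.XB q.1 q.2) := by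
  have hx : ContDiff ℝ ∞ (fun q : ℝ × Mod n => xx q.2) := contDiff_xx.comp contDiff_snd
  have hh : ContDiff ℝ ∞ (fun q : ℝ × Mod n => q.2.1) := contDiff_snd.fst
  have hch : ContDiff ℝ ∞ (fun q : ℝ × Mod n => P.ch q.2.1 (xx q.2)) :=
    ((contDiff_chi P.k_pos P.sig_pos).comp contDiff_T).comp contDiff_snd
  have hc : ContDiff ℝ ∞ (fun q : ℝ × Mod n => P.c (xx q.2)) :=
    (contDiff_gg P.sq1_pos P.sq12 _).comp hx
  have hd : ContDiff ℝ ∞ (fun q : ℝ × Mod n => P.d (xx q.2)) :=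
    (contDiff_gg P.sq1_pos P.sq12 _).comp hx
  have hs : ContDiff ℝ ∞ (fun q : ℝ × Mod n => stp 2 3 q.2.1) := (contDiff_stp 2 3).comp hh
  have hC : ContDiff ℝ ∞ (fun q : ℝ × Mod n => P.C q.1) :=
    contDiff_const.add ((contDiff_fst.div_const _).mul contDiff_const)
  have hb : ContDiff ℝ ∞ (fun q : ℝ × Mod n => P.b q.1 q.2.1) :=
    (contDiff_gg_param (a := 1) (b := 2) (by norm_num) (by norm_num)).comp (hC.prodMk hh)
  have hw : ContDiff ℝ ∞ (fun q : ℝ × Mod n => P.fw q.1 q.2.1 (xx q.2)) :=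
    ((contDiff_const.mul hb).mul hd).neg
  have hz : ContDiff ℝ ∞ (fun q : ℝ × Mod n => P.fz q.1 q.2.1 (xx q.2)) :=
    contDiff_const.mul (hb.sub hch)
  have hf : ContDiff ℝ ∞ (fun q : ℝ × Mod n => P.fh q.1 q.2.1 (xx q.2)) :=
    ((((contDiff_fst.mul hc).mul hh).mul hs).neg.sub (contDiff_const.sub hs)).sub hch
  exact hf.prodMk ((hz.smul contDiff_snd.snd.fst).prodMk
    ((hw.smul contDiff_snd.snd.snd.fst).prodMk (hw.smul contDiff_snd.snd.snd.snd)))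

section curve
variable {γ : ℝ → Mod n} {t mu : ℝ}

lemma curve_h (hγ : HasDerivAt γ (P.XB mu (γ t)) t) :
    HasDerivAt (fun s => (γ s).1) (P.fh mu (γ t).1 (xx (γ t))) t := hγ.fst

lemma curve_x (hγ : HasDerivAt γ (P.XB mu (γ t)) t) :
    HasDerivAt (fun s => xx (γ s)) (2 * P.fz mu (γ t).1 (xx (γ t)) * xx (γ t)) t := by
  have h2 : HasDerivAt (fun s => (γ s).2) (P.XB mu (γ t)).2 t := hγ.snd
  have h3 : HasDerivAt (fun s => (γ s).2.1) (P.XB mu (γ t)).2.1 t := h2.fst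
  refine HasDerivAt.congr_deriv (f := fun s => xx (γ s)) h3.norm_sq ?_
  simp only [XB, inner_smul_right, real_inner_self_eq_norm_sq, xx]
  ring

lemma curve_W (hγ : HasDerivAt γ (P.XB mu (γ t)) t) :
    HasDerivAt (fun s => ww (γ s)) (2 * P.fw mu (γ t).1 (xx (γ t)) * ww (γ t)) t := by
  have h2 : HasDerivAt (fun s => (γ s).2) (P.XB mu (γ t)).2 t := hγ.snd
  have h3 : HasDerivAt (fun s => (γ s).2.2) (P.XB mu (γ t)).2.2 t := h2.snd
  have h4 : HasDerivAt (fun s => (γ s).2.2.1) (P.XB mu (γ t)).2.2.1 t := h3.fst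
  have h5 : HasDerivAt (fun s => (γ s).2.2.2) (P.XB mu (γ t)).2.2.2 t := h3.snd
  refine HasDerivAt.congr_deriv (f := fun s => ww (γ s)) (h4.norm_sq.add h5.norm_sq) ?_
  simp only [XB, inner_smul_right, real_inner_self_eq_norm_sq, ww]
  ring

/-- `ThB` increases along orbits of the block field. -/
lemma hasDerivAt_ThB (hg : P.Good mu) (hγ : HasDerivAt γ (P.XB mu (γ t)) t)
    (H : 0 < P.ThB (γ t)) (h10 : (γ t).1 ≤ 10) :
    ∃ D, HasDerivAt (fun s => P.ThB (γ s)) D t ∧ 0 ≤ D ∧ (P.ThB (γ t) < 1 → 0 < D) := by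
  have HV := inV_iff.2 H
  obtain ⟨D, hD, hD0, hD1⟩ := hasDerivAt_tau (x := fun s => xx (γ s)) (h := fun s => (γ s).1)
    (W := fun s => ww (γ s)) hg (curve_h hγ) (curve_x hγ) (curve_W hγ)
    (fun s => xx_nonneg _) HV h10
  obtain ⟨E, hE, hE'⟩ := hasDerivAt_bump HV.2.2
  have hc : HasDerivAt (fun s => P.ThB (γ s)) (E * D) t := HasDerivAt.comp t hE' hD
  refine ⟨_, hc, by nlinarith, fun h1 => ?_⟩
  have : 0 < P.tau (γ t).1 (xx (γ t)) (ww (γ t)) := by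
    rcases (tau_nonneg (P := P) (γ t).1 (xx (γ t)) (ww (γ t))).eq_or_lt with h0 | h0
    · rw [ThB, tauB, ← h0, bump_zero] at h1
      exact absurd h1 (lt_irrefl _)
    · exact h0
  have := hD1 this
  nlinarith

end curve

/-- At height at least `3` the block field is vertical. -/
lemma XB_of_three_le {p : Mod n} {mu : ℝ} (H : 0 < P.ThB p) (hp : 3 ≤ p.1) :
    P.XB mu p = (-1, 0) := by
  have HV := inV_iff.2 H
  have ht := (HV.tt_neg (by linarith)).le
  rw [XB, fh, fz, fw, ch_of_nonpos ht, b_zero (by linarith), jj_one hp,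
    stp_of_ge (by norm_num : (2 : ℝ) < 3) hp]
  simp

/-- The lower barrier bounds h + `ps` below, so a low height forces `ps`, hence `tt`, to be large.
-/
lemma tt_of_low {h x W : ℝ} (H : P.InV h x W) (hp : h ≤ -2) : 1 ≤ P.tt h x := by
  have h1 := H.I0_gt'
  have := P.cs_le_one
  have hp : 1 < P.ps h x := by unfold I0 at h1; linarith
  have h0 : 0 ≤ P.tt h x := by
    by_contra hc
    push Not at hc
    rw [ps_of_nonpos hc.le] at hp
    linarith
  have := ps_le h0
  linarith

/-- At height at most `-2` the block field is vertical. -/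
lemma XB_of_low {p : Mod n} {mu : ℝ} (H : 0 < P.ThB p) (hp : p.1 ≤ -2) :
    P.XB mu p = (-1, 0) := by
  have HV := inV_iff.2 H
  have ht := tt_of_low HV hp
  rw [XB, fh, fz, fw, ch_of_one_le ht, b_one (by linarith), jj_zero (by linarith),
    HV.c_eq_zero (by linarith), HV.d_eq_zero (by linarith)]
  simp

/-- The zero of the block field. -/
lemma XB_eq_zero_iff {p : Mod n} {mu : ℝ} (hmu : P.Adm mu) (H : 0 < P.ThB p) :
    P.XB mu p = 0 ↔ p = 0 := by
  have HV := inV_iff.2 H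
  have hs := P.sig_pos
  constructor
  · intro h0
    have e1 : P.fh mu p.1 (xx p) = 0 := congrArg (fun q : Mod n => q.1) h0
    have e2 : P.fz mu p.1 (xx p) • p.2.1 = 0 := congrArg (fun q : Mod n => q.2.1) h0
    have e3 : P.fw mu p.1 (xx p) • p.2.2.1 = 0 := congrArg (fun q : Mod n => q.2.2.1) h0
    have e4 : P.fw mu p.1 (xx p) • p.2.2.2 = 0 := congrArg (fun q : Mod n => q.2.2.2) h0
    have hg := HV.gr_pos hmu
    -- If z ≠ 0, the vanishing of `fh` and `fz` together would make the growth rate `gr` zero.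
    have hz : p.2.1 = 0 := by
      rcases smul_eq_zero.1 e2 with h | h
      · have : P.gr mu p.1 (xx p) = 0 := by
          have h' : P.b mu p.1 - P.ch p.1 (xx p) = 0 :=
            (mul_eq_zero.1 h).resolve_left hs.ne'
          unfold fh at e1; unfold gr; linarith
        linarith
      · exact h
    have hx : xx p = 0 := by simp [xx, hz]
    rw [hx, fh, ch_of_nonpos (tt_zero _).le, c_one P.sq1_pos.le] at e1
    have hh : p.1 = 0 := by
      rcases le_or_gt p.1 2 with h2 | h2
      · rw [jj_zero h2, stp_of_le (by norm_num) h2] at e1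
        have : mu * p.1 = 0 := by linarith
        exact (mul_eq_zero.1 this).resolve_left hmu.1.ne'
      · have s0 := stp_nonneg 2 3 p.1
        have s1 := stp_le_one 2 3 p.1
        have : 0 < mu * p.1 := mul_pos hmu.1 (by linarith)
        unfold jj at e1
        rcases s0.eq_or_lt with s | s
        · rw [← s] at e1; linarith
        · have := mul_pos this s; nlinarith
    have hfw : P.fw mu p.1 (xx p) ≠ 0 := by
      rw [hx, hh, fw, b_one (by norm_num), d_one P.sq1_pos.le]
      have := P.eta_pos; simp; linarith
    have hw := (smul_eq_zero.1 e3).resolve_left hfw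
    have hv := (smul_eq_zero.1 e4).resolve_left hfw
    exact Prod.ext hh (Prod.ext hz (Prod.ext hw hv))
  · rintro rfl
    have : xx (0 : Mod n) = 0 := by simp [xx]
    simp only [XB, this, fh, ch_of_nonpos (tt_zero (P := P) _).le, Prod.fst_zero,
      jj_zero (by norm_num : (0 : ℝ) ≤ 2), Prod.snd_zero, smul_zero, mul_zero, zero_mul, sub_zero,
      neg_zero]
    rfl

end Par

/-! ### Smooth inverses near compact sets -/

lemma det_ne_zero_of_ker {X : Type*} [NormedAddCommGroup X] [NormedSpace ℝ X]
    (f : X →L[ℝ] X) [FiniteDimensional ℝ X] (h : ∀ v, f v = 0 → v = 0) : f.det ≠ 0 := by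
  intro h0
  have h0' : LinearMap.det (f : X →ₗ[ℝ] X) = 0 := h0
  have h1 := LinearMap.bot_lt_ker_of_det_eq_zero h0'
  obtain ⟨v, hv, hv0⟩ := (Submodule.ne_bot_iff _).1 h1.ne'
  exact hv0 (h v hv)

/-- A smooth map that is injective on a compact set, with invertible derivative there, has a smooth
inverse near this set. -/
lemma exists_smooth_inverse {X : Type*} [NormedAddCommGroup X] [NormedSpace ℝ X]
    [FiniteDimensional ℝ X] {f : X → X} {s A : Set X} (hs : IsCompact s) (hA : IsOpen A)
    (hsA : s ⊆ A) (hf : ContDiffOn ℝ ∞ f A) (inj : InjOn f s)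
    (hker : ∀ x ∈ s, ∀ v, fderiv ℝ f x v = 0 → v = 0) :
    ∃ O : Set X, IsOpen O ∧ s ⊆ O ∧ IsOpen (f '' O) ∧
      ∃ g : X → X, ContDiffOn ℝ ∞ g (f '' O) ∧ ∀ x ∈ O, g (f x) = x := by
  have : CompleteSpace X := FiniteDimensional.complete ℝ X
  set D : Set X := A ∩ {x | (fderiv ℝ f x).det ≠ 0} with hD
  have hDo : IsOpen D := by
    have hc : ContinuousOn (fun x => (fderiv ℝ f x).det) A :=
      ContinuousLinearMap.continuous_det.comp_continuousOn
        (hf.continuousOn_fderiv_of_isOpen hA (by simp))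
    exact hc.isOpen_inter_preimage hA isOpen_ne
  have hcd : ∀ x ∈ D, ContDiffAt ℝ ∞ f x := fun x hx => hf.contDiffAt (hA.mem_nhds hx.1)
  have hst : ∀ x ∈ D, ∃ f' : X ≃L[ℝ] X, HasStrictFDerivAt f (f' : X →L[ℝ] X) x := by
    intro x hx
    refine ⟨(fderiv ℝ f x).toContinuousLinearEquivOfDetNeZero hx.2, ?_⟩
    have := (hcd x hx).hasStrictFDerivAt (by simp)
    rwa [ContinuousLinearMap.coe_toContinuousLinearEquivOfDetNeZero]
  have hsD : s ⊆ D := fun x hx => ⟨hsA hx, det_ne_zero_of_ker _ (hker x hx)⟩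
  -- Injectivity on the compact set, together with local injectivity, persists on a neighbourhood of
  -- the set.
  obtain ⟨t, ht, htinj⟩ := inj.exists_mem_nhdsSet hs
    (fun x hx => (hcd x (hsD hx)).continuousAt) (fun x hx => by
      obtain ⟨f', hf'⟩ := hst x (hsD hx)
      exact ⟨_, (hf'.toOpenPartialHomeomorph f).open_source.mem_nhds
        hf'.mem_toOpenPartialHomeomorph_source, (hf'.toOpenPartialHomeomorph f).injOn⟩)
  obtain ⟨O', hO', hsO', hO't⟩ := mem_nhdsSet_iff_exists.1 ht
  have hinj : InjOn f (O' ∩ D) := htinj.mono (inter_subset_left.trans hO't)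
  have hopen : IsOpen (O' ∩ D) := hO'.inter hDo
  rcases isEmpty_or_nonempty X with hX | hX
  · exact ⟨O' ∩ D, hopen, subset_inter hsO' hsD, by rw [eq_empty_of_isEmpty (f '' _)]; simp, f,
      by rw [eq_empty_of_isEmpty (f '' _)]; exact contDiffOn_empty, fun x => (hX.false x).elim⟩
  have hleft : ∀ x ∈ O' ∩ D, Function.invFunOn f (O' ∩ D) (f x) = x :=
    fun x hx => hinj.leftInvOn_invFunOn hx
  refine ⟨O' ∩ D, hopen, subset_inter hsO' hsD, ?_, Function.invFunOn f (O' ∩ D), ?_, hleft⟩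
  · rw [isOpen_iff_mem_nhds]
    rintro _ ⟨x, hx, rfl⟩
    obtain ⟨f', hf'⟩ := hst x hx.2
    rw [← hf'.map_nhds_eq_of_equiv]
    exact image_mem_map (hopen.mem_nhds hx)
  · rintro _ ⟨x, hx, rfl⟩
    apply ContDiffAt.contDiffWithinAt
    obtain ⟨f', hf'⟩ := hst x hx.2
    have hc := hcd x hx.2
    refine (hc.to_localInverse hf'.hasFDerivAt (by simp)).congr_of_eventuallyEq ?_
    have hs' := hc.hasStrictFDerivAt' hf'.hasFDerivAt (by simp)
    filter_upwards [hs'.eventually_right_inverse,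
      hs'.localInverse_tendsto.eventually (hopen.mem_nhds hx)] with y h1 h2
    calc Function.invFunOn f (O' ∩ D) y = Function.invFunOn f (O' ∩ D)
          (f (HasStrictFDerivAt.localInverse f f' x hs' y)) := by rw [h1]
      _ = _ := hleft _ h2

/-! ### The tube isotopy -/

def uu (z : ℂ) : ℂ := ((‖z‖⁻¹ : ℝ) : ℂ) * z

/-- The inverse of the radius function I ↦ 1 - λ + λ I / cs. -/
def hI (cs lam y : ℝ) : ℝ := cs / lam * (y - (1 - lam))

/-- Both terms increase with y and they never vanish together, so the radius is a strictly monotone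
coordinate for every f. -/
def rad (cs lam sig k f y : ℝ) : ℝ :=
  (1 - f) ^ 2 * Real.exp (sig * (hI cs lam y + k)) + f ^ 2 * y

/-- For y > 0 and f in [0, 1] the real coefficient of `uu` is positive, so on w = 0 this component
determines the angle. The coordinate w moves from `isoB` at f = 0 to this component at f = 1. -/
def isoA (cs lam sig k f : ℝ) {n : ℕ} (q : Sec n) : ℂ :=
  (((1 - f) * rad cs lam sig k f ‖q.1‖ + f ^ 2 / 2 : ℝ) : ℂ) * uu q.1
    + (f : ℂ) * (starRingEnd ℂ (uu q.1) * q.2.1)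

def isoB (cs lam sig k f : ℝ) {n : ℕ} (q : Sec n) : ℂ :=
  (((1 - f) * f / 2 : ℝ) : ℂ) * uu q.1 - ((f * rad cs lam sig k f ‖q.1‖ : ℝ) : ℂ) * uu q.1 ^ 2
    + ((1 - f : ℝ) : ℂ) * q.2.1

/-- The isotopy from the exit of the block (`f = 0`) to the folding map (`f = 1`). -/
def iso (cs lam sig k f : ℝ) {n : ℕ} (q : Sec n) : Sec n :=
  (((1 - f : ℝ) : ℂ) * isoA cs lam sig k f q - (f : ℂ) * isoB cs lam sig k f q + (f : ℂ),
    (f : ℂ) * isoA cs lam sig k f q + ((1 - f : ℝ) : ℂ) * isoB cs lam sig k f q, q.2.2)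

lemma norm_uu {z : ℂ} (hz : z ≠ 0) : ‖uu z‖ = 1 := by
  have : ‖z‖ ≠ 0 := norm_ne_zero_iff.2 hz
  rw [uu, norm_mul, Complex.norm_real, norm_inv, norm_norm, inv_mul_cancel₀ this]

lemma uu_ne_zero {z : ℂ} (hz : z ≠ 0) : uu z ≠ 0 := by
  rw [← norm_ne_zero_iff, norm_uu hz]; exact one_ne_zero

lemma norm_mul_uu {z : ℂ} (hz : z ≠ 0) : (‖z‖ : ℂ) * uu z = z := by
  have : (‖z‖ : ℂ) ≠ 0 := by exact_mod_cast norm_ne_zero_iff.2 hz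
  rw [uu]; push_cast; field_simp

lemma uu_mul_conj {z : ℂ} (hz : z ≠ 0) : uu z * starRingEnd ℂ (uu z) = 1 := by
  rw [Complex.mul_conj, Complex.normSq_eq_norm_sq, norm_uu hz]; simp

lemma uu_smul {r : ℝ} (hr : 0 < r) (z : ℂ) : uu ((r : ℂ) * z) = uu z := by
  rcases eq_or_ne z 0 with rfl | hz
  · simp [uu]
  have h1 : (r : ℂ) ≠ 0 := by exact_mod_cast hr.ne'
  have h2 : (‖z‖ : ℂ) ≠ 0 := by exact_mod_cast norm_ne_zero_iff.2 hz
  simp only [uu, norm_mul, Complex.norm_real, Real.norm_of_nonneg hr.le]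
  push_cast; field_simp

lemma uu_of_norm_one {z : ℂ} (h : ‖z‖ = 1) : uu z = z := by simp [uu, h]

lemma uu_eq_div (z : ℂ) : uu z = z / (‖z‖ : ℂ) := by
  rw [uu]; push_cast; ring

lemma contDiffAt_uu {z : ℂ} (hz : z ≠ 0) : ContDiffAt ℝ ∞ uu z := by
  have h1 : ContDiffAt ℝ ∞ (fun z : ℂ => ‖z‖) z := contDiffAt_norm ℝ hz
  have h2 : ContDiffAt ℝ ∞ (fun z : ℂ => ((‖z‖⁻¹ : ℝ) : ℂ)) z :=
    Complex.ofRealCLM.contDiff.contDiffAt.comp z (h1.inv (norm_ne_zero_iff.2 hz))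
  exact h2.mul contDiffAt_id

section iso
variable {cs lam sig k : ℝ} {n : ℕ}

lemma contDiffAt_iso {y : ℝ × Sec n} (hz : y.2.1 ≠ 0) :
    ContDiffAt ℝ ∞ (fun y : ℝ × Sec n => iso cs lam sig k y.1 y.2) y := by
  have hf : ContDiffAt ℝ ∞ (fun y : ℝ × Sec n => y.1) y := contDiffAt_fst
  have hzz : ContDiffAt ℝ ∞ (fun y : ℝ × Sec n => y.2.1) y := contDiff_snd.fst.contDiffAt
  have hw : ContDiffAt ℝ ∞ (fun y : ℝ × Sec n => y.2.2.1) y := contDiff_snd.snd.fst.contDiffAt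
  have hv : ContDiffAt ℝ ∞ (fun y : ℝ × Sec n => y.2.2.2) y := contDiff_snd.snd.snd.contDiffAt
  have hof : ∀ {g : ℝ × Sec n → ℝ}, ContDiffAt ℝ ∞ g y →
      ContDiffAt ℝ ∞ (fun y => ((g y : ℝ) : ℂ)) y :=
    fun h => Complex.ofRealCLM.contDiff.contDiffAt.comp y h
  have hu : ContDiffAt ℝ ∞ (fun y : ℝ × Sec n => uu y.2.1) y :=
    ContDiffAt.comp (g := uu) (f := fun y : ℝ × Sec n => y.2.1) y (contDiffAt_uu hz) hzz
  have hub : ContDiffAt ℝ ∞ (fun y : ℝ × Sec n => starRingEnd ℂ (uu y.2.1)) y :=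
    Complex.conjCLE.contDiff.contDiffAt.comp y hu
  have hn : ContDiffAt ℝ ∞ (fun y : ℝ × Sec n => ‖y.2.1‖) y := (contDiffAt_norm ℝ hz).comp y hzz
  have hc : ContDiffAt ℝ ∞ (fun y : ℝ × Sec n => 1 - y.1) y := contDiffAt_const.sub hf
  have hr : ContDiffAt ℝ ∞ (fun y : ℝ × Sec n => rad cs lam sig k y.1 ‖y.2.1‖) y :=
    ((hc.pow 2).mul (contDiffAt_const.mul ((contDiffAt_const.mul
      (hn.sub contDiffAt_const)).add contDiffAt_const)).exp).add ((hf.pow 2).mul hn)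
  have ha : ContDiffAt ℝ ∞ (fun y : ℝ × Sec n => isoA cs lam sig k y.1 y.2) y :=
    ((hof ((hc.mul hr).add ((hf.pow 2).div_const 2))).mul hu).add ((hof hf).mul (hub.mul hw))
  have hb : ContDiffAt ℝ ∞ (fun y : ℝ × Sec n => isoB cs lam sig k y.1 y.2) y :=
    (((hof ((hc.mul hf).div_const 2)).mul hu).sub ((hof (hf.mul hr)).mul (hu.pow 2))).add
      ((hof hc).mul hw)
  exact ((((hof hc).mul ha).sub ((hof hf).mul hb)).add (hof hf)).prodMk
    ((((hof hf).mul ha).add ((hof hc).mul hb)).prodMk hv)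

lemma rad_pos {f y : ℝ} (hy : 0 < y) : 0 < rad cs lam sig k f y := by
  unfold rad
  rcases eq_or_ne f 0 with rfl | hf
  · simp [Real.exp_pos]
  · have : 0 < f ^ 2 * y := by positivity
    have : 0 ≤ (1 - f) ^ 2 * Real.exp (sig * (hI cs lam y + k)) := by positivity
    linarith

lemma rad_strictMono (hcs : 0 < cs) (hlam : 0 < lam) (hsig : 0 < sig) (f : ℝ) :
    StrictMono (rad cs lam sig k f) := by
  intro y y' h
  have hI' : hI cs lam y < hI cs lam y' :=
    mul_lt_mul_of_pos_left (by linarith) (div_pos hcs hlam)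
  have he : Real.exp (sig * (hI cs lam y + k)) < Real.exp (sig * (hI cs lam y' + k)) :=
    Real.exp_lt_exp.2 (mul_lt_mul_of_pos_left (by linarith) hsig)
  unfold rad
  rcases eq_or_ne f 0 with rfl | hf
  · simpa using he
  · have h1 : f ^ 2 * y < f ^ 2 * y' := mul_lt_mul_of_pos_left h (by positivity)
    have h2 := mul_le_mul_of_nonneg_left he.le (sq_nonneg (1 - f))
    linarith

/-- The rotation in the first two complex coordinates is injective. -/
lemma rot_inj {f : ℝ} {a b : ℂ} (h1 : ((1 - f : ℝ) : ℂ) * a - (f : ℂ) * b = 0)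
    (h2 : (f : ℂ) * a + ((1 - f : ℝ) : ℂ) * b = 0) : a = 0 ∧ b = 0 := by
  have hd : (((1 - f) ^ 2 + f ^ 2 : ℝ) : ℂ) ≠ 0 := by
    norm_cast; nlinarith [sq_nonneg (1 - 2 * f)]
  have ea : (((1 - f) ^ 2 + f ^ 2 : ℝ) : ℂ) * a = 0 := by
    push_cast at h1 h2 ⊢; linear_combination (1 - (f : ℂ)) * h1 + (f : ℂ) * h2
  have eb : (((1 - f) ^ 2 + f ^ 2 : ℝ) : ℂ) * b = 0 := by
    push_cast at h1 h2 ⊢; linear_combination (1 - (f : ℂ)) * h2 - (f : ℂ) * h1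
  exact ⟨(mul_eq_zero.1 ea).resolve_left hd, (mul_eq_zero.1 eb).resolve_left hd⟩

/-- After undoing the rotation, the A-component gives the angle. The radius then follows from the
B-component if f ≠ 0 and from the A-component if f = 0. -/
lemma iso_inj_core (hcs : 0 < cs) (hlam : 0 < lam) (hsig : 0 < sig) {f : ℝ} (hf : f ∈ Icc (0 : ℝ) 1)
    {z z' : ℂ} (hz : z ≠ 0) (hz' : z' ≠ 0)
    (h : iso cs lam sig k f ((z, 0) : Sec n) = iso cs lam sig k f ((z', 0) : Sec n)) : z = z' := by
  have e1 := congrArg (fun q : Sec n => q.1) h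
  have e2 := congrArg (fun q : Sec n => q.2.1) h
  simp only [iso] at e1 e2
  obtain ⟨ha, hb⟩ := rot_inj (f := f)
    (a := isoA cs lam sig k f ((z, 0) : Sec n) - isoA cs lam sig k f ((z', 0) : Sec n))
    (b := isoB cs lam sig k f ((z, 0) : Sec n) - isoB cs lam sig k f ((z', 0) : Sec n))
    (by linear_combination e1) (by linear_combination e2)
  rw [sub_eq_zero] at ha hb
  simp only [isoA, isoB, Prod.fst_zero, mul_zero, add_zero] at ha hb
  have nz := norm_pos_iff.2 hz
  have nz' := norm_pos_iff.2 hz'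
  have c0 : 0 ≤ 1 - f := by linarith [hf.2]
  have p1 : ∀ {y : ℝ}, 0 < y → 0 < (1 - f) * rad cs lam sig k f y + f ^ 2 / 2 := by
    intro y hy
    have := rad_pos (cs := cs) (lam := lam) (sig := sig) (k := k) (f := f) hy
    rcases hf.1.eq_or_lt with h0 | h0
    · rw [← h0] at this ⊢; simpa using this
    · have : 0 ≤ (1 - f) * rad cs lam sig k f y := mul_nonneg c0 this.le
      have : 0 < f ^ 2 / 2 := by positivity
      linarith
  have hn := congrArg norm ha
  rw [norm_mul, norm_mul, norm_uu hz, norm_uu hz', Complex.norm_real, Complex.norm_real,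
    Real.norm_of_nonneg (p1 nz).le, Real.norm_of_nonneg (p1 nz').le, mul_one, mul_one] at hn
  rw [hn] at ha
  have hu : uu z = uu z' := mul_left_cancel₀ (by exact_mod_cast (p1 nz').ne') ha
  rw [hu] at hb
  have hr : rad cs lam sig k f ‖z‖ = rad cs lam sig k f ‖z'‖ := by
    rcases eq_or_ne f 0 with h0 | h0
    · subst h0; simpa using hn
    · have : ((f * rad cs lam sig k f ‖z‖ : ℝ) : ℂ) * uu z' ^ 2
          = ((f * rad cs lam sig k f ‖z'‖ : ℝ) : ℂ) * uu z' ^ 2 := by linear_combination -hb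
      have := mul_right_cancel₀ (pow_ne_zero 2 (uu_ne_zero hz')) this
      have : f * rad cs lam sig k f ‖z‖ = f * rad cs lam sig k f ‖z'‖ := by exact_mod_cast this
      exact mul_left_cancel₀ h0 this
  have hn2 : ‖z‖ = ‖z'‖ := (rad_strictMono hcs hlam hsig f).injective hr
  rw [← norm_mul_uu hz, ← norm_mul_uu hz', hu, hn2]

lemma hasDerivAt_rad {f y D : ℝ} {r : ℝ → ℝ} {t : ℝ} (hr : HasDerivAt r D t) (hy : r t = y) :
    HasDerivAt (fun s => rad cs lam sig k f (r s))
      (((1 - f) ^ 2 * (Real.exp (sig * (hI cs lam y + k)) * (sig * (cs / lam))) + f ^ 2) * D) t := by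
  subst hy
  have h1 : HasDerivAt (fun s => sig * (hI cs lam (r s) + k)) (sig * (cs / lam * D)) t :=
    (((hr.sub_const _).const_mul _).add_const _).const_mul _
  refine ((h1.exp.const_mul ((1 - f) ^ 2)).add (hr.const_mul (f ^ 2))).congr_deriv ?_
  ring

lemma re_im_of_eq_zero {a t b c : ℝ} {u : ℂ}
    (h : (a : ℂ) + (t : ℂ) * Complex.I * ((b : ℂ) - (c : ℂ) * u) = 0) :
    t * (b - c * u.re) = 0 ∧ a + t * (c * u.im) = 0 := by
  have h1 := congrArg Complex.im h
  have h2 := congrArg Complex.re h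
  simp at h1 h2
  refine ⟨by rcases h1 with h1 | h1 <;> simp [h1], by linarith⟩

/-- The infinitesimal form of `iso_inj_core`, in logarithmic polar coordinates: with vz = z ω, the
real part of ω moves the radius and the imaginary part the angle. -/
lemma iso_ker (hcs : 0 < cs) (hlam : 0 < lam) (hsig : 0 < sig) {f : ℝ} (hf : f ∈ Icc (0 : ℝ) 1)
    {z : ℂ} (hz : z ≠ 0) {v : ℝ × Sec n}
    (h : fderiv ℝ (fun y : ℝ × Sec n => (y.1, iso cs lam sig k y.1 y.2)) (f, z, 0) v = 0) :
    v = 0 := by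
  set F : ℝ × Sec n → ℝ × Sec n := fun y => (y.1, iso cs lam sig k y.1 y.2) with hF
  have hFd : HasFDerivAt F (fderiv ℝ F (f, z, 0)) (f, z, 0) :=
    ((contDiffAt_fst.prodMk (contDiffAt_iso (y := (f, z, 0)) hz)).differentiableAt
      (by simp)).hasFDerivAt
  have nz := norm_pos_iff.2 hz
  obtain ⟨v0, vz, vw, vv⟩ := v
  have h0 : v0 = 0 := by
    have h1 := hFd.fst.unique hasFDerivAt_fst
    have h2 := congrArg (fun L : ℝ × Sec n →L[ℝ] ℝ => L (v0, vz, vw, vv)) h1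
    have h3 : (fderiv ℝ F (f, z, 0) (v0, vz, vw, vv)).1 = v0 := h2
    rw [h] at h3
    exact h3.symm
  subst h0
  set om : ℂ := vz / z with hom
  have hvz : vz = z * om := by rw [hom]; field_simp
  -- Along this curve |z| and z/|z| are exponentials, so no derivative of the norm has to be
  -- computed.
  set γ : ℝ → ℝ × Sec n := fun t => (f, z * Complex.exp (t * om), t • vw, t • vv) with hγ
  have hexp : ∀ c : ℂ, HasDerivAt (fun t : ℝ => Complex.exp (t * c)) c 0 := by
    intro c
    have h1 : HasDerivAt (fun t : ℝ => (t : ℂ) * c) (1 * c) 0 :=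
      Complex.ofRealCLM.hasDerivAt.mul_const c
    have h2 := HasDerivAt.cexp h1
    simpa using h2
  have hγd : HasDerivAt γ (0, vz, vw, vv) 0 := by
    refine (hasDerivAt_const _ _).prodMk (HasDerivAt.prodMk ?_ (HasDerivAt.prodMk ?_ ?_))
    · rw [hvz]; exact (hexp om).const_mul z
    · simpa using (hasDerivAt_id (0 : ℝ)).smul_const vw
    · simpa using (hasDerivAt_id (0 : ℝ)).smul_const vv
  have hγ0 : γ 0 = (f, z, 0) := by simp [hγ]
  have hFγ : HasDerivAt (fun t => F (γ t)) 0 0 := by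
    rw [← h]
    exact HasFDerivAt.comp_hasDerivAt (0 : ℝ) (by rw [hγ0]; exact hFd) hγd
  have hE : HasDerivAt (fun t => iso cs lam sig k f (γ t).2) 0 0 := hFγ.snd
  -- the polar coordinates along the curve
  have hnorm : ∀ t : ℝ, ‖z * Complex.exp (t * om)‖ = ‖z‖ * Real.exp (t * om.re) := by
    intro t; rw [norm_mul, Complex.norm_exp]; simp
  have huu : ∀ t : ℝ, uu (z * Complex.exp (t * om))
      = uu z * Complex.exp (t * ((om.im : ℂ) * Complex.I)) := by
    intro t
    have e : z * Complex.exp (t * om) = (Real.exp (t * om.re) : ℂ) *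
        (z * Complex.exp (t * ((om.im : ℂ) * Complex.I))) := by
      rw [mul_left_comm, Complex.ofReal_exp, ← Complex.exp_add]
      congr 2
      conv_lhs => rw [← Complex.re_add_im om]
      push_cast; ring
    rw [e, uu_smul (Real.exp_pos _)]
    have : ‖Complex.exp (t * ((om.im : ℂ) * Complex.I))‖ = 1 := by
      rw [Complex.norm_exp]; simp
    rw [uu, norm_mul, this, mul_one, ← mul_assoc, ← uu]
  have hu : HasDerivAt (fun t : ℝ => uu (γ t).2.1) (uu z * ((om.im : ℂ) * Complex.I)) 0 := by
    simp only [hγ, huu]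
    exact (hexp _).const_mul _
  have hub : HasDerivAt (fun t : ℝ => starRingEnd ℂ (uu (γ t).2.1))
      (starRingEnd ℂ (uu z * ((om.im : ℂ) * Complex.I))) 0 :=
    Complex.conjCLE.toContinuousLinearMap.hasFDerivAt.comp_hasDerivAt (0 : ℝ) hu
  have hn : HasDerivAt (fun t : ℝ => ‖(γ t).2.1‖) (‖z‖ * om.re) 0 := by
    simp only [hγ, hnorm]
    have h1 : HasDerivAt (fun t : ℝ => t * om.re) (1 * om.re) 0 :=
      (hasDerivAt_id (0 : ℝ)).mul_const _
    simpa using h1.exp.const_mul ‖z‖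
  have hn0 : ‖(γ 0).2.1‖ = ‖z‖ := by rw [hγ0]
  set r := rad cs lam sig k f ‖z‖ with hr
  set D := ((1 - f) ^ 2 * (Real.exp (sig * (hI cs lam ‖z‖ + k)) * (sig * (cs / lam))) + f ^ 2)
    * (‖z‖ * om.re) with hD
  have hrd : HasDerivAt (fun t : ℝ => rad cs lam sig k f ‖(γ t).2.1‖) D 0 :=
    hasDerivAt_rad (r := fun t : ℝ => ‖(γ t).2.1‖) hn hn0
  have hrpos : 0 < r := rad_pos nz
  have hw : HasDerivAt (fun t : ℝ => (γ t).2.2.1) vw 0 := by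
    have h1 : HasDerivAt (fun t => (γ t).2) ((vz, vw, vv) : Sec n) 0 := hγd.snd
    have h2 : HasDerivAt (fun t => (γ t).2.2) ((vw, vv) : ℂ × _) 0 := h1.snd
    exact h2.fst
  have hof : ∀ {g : ℝ → ℝ} {g' : ℝ}, HasDerivAt g g' 0 →
      HasDerivAt (fun t => ((g t : ℝ) : ℂ)) (g' : ℂ) 0 := fun hg => hg.ofReal_comp
  have hA := ((hof ((hrd.const_mul (1 - f)).add_const (f ^ 2 / 2))).mul hu).add
    ((hub.mul hw).const_mul (f : ℂ))
  have hB := ((hu.const_mul (((1 - f) * f / 2 : ℝ) : ℂ)).sub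
    ((hof (hrd.const_mul f)).mul (hu.pow 2))).add (hw.const_mul ((1 - f : ℝ) : ℂ))
  have hE1 : HasDerivAt (fun t => (iso cs lam sig k f (γ t).2).1) 0 0 := hE.fst
  have hE2 : HasDerivAt (fun t => (iso cs lam sig k f (γ t).2).2) 0 0 := hE.snd
  have hE3 : HasDerivAt (fun t => (iso cs lam sig k f (γ t).2).2.1) 0 0 := hE2.fst
  have hE4 : HasDerivAt (fun t => (iso cs lam sig k f (γ t).2).2.2) 0 0 := hE2.snd
  have hv0 : vv = 0 := by
    have h1 : HasDerivAt (fun t : ℝ => t • vv) vv 0 := by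
      simpa using (hasDerivAt_id (0 : ℝ)).smul_const vv
    exact h1.unique hE4
  have k1 := (((hA.const_mul ((1 - f : ℝ) : ℂ)).sub (hB.const_mul (f : ℂ))).add_const
    (f : ℂ)).unique hE1
  have k2 := ((hA.const_mul (f : ℂ)).add (hB.const_mul ((1 - f : ℝ) : ℂ))).unique hE3
  obtain ⟨ka, kb⟩ := rot_inj k1 k2
  have hw0 : (γ 0).2.2.1 = 0 := by rw [hγ0]; rfl
  have hu0 : uu (γ 0).2.1 = uu z := by rw [hγ0]
  simp only [hn0, hw0, hu0, ← hr, mul_zero, zero_add, Pi.pow_apply] at ka kb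
  have huc := uu_mul_conj hz
  set u := uu z
  set ub := starRingEnd ℂ u with hub'
  have hre : ub.re ≤ 1 := by
    refine (Complex.re_le_norm _).trans ?_
    rw [hub', Complex.norm_conj, norm_uu hz]
  -- The combination (1 - f) ū ka - f ū² kb eliminates the derivative of w.
  have key : ((D * ((1 - f) ^ 2 + f ^ 2) : ℝ) : ℂ) + (om.im : ℂ) * Complex.I *
      ((((1 - f) ^ 2 * r + (1 - f) * f ^ 2 / 2 + 2 * f ^ 2 * r : ℝ) : ℂ)
        - (((1 - f) * f ^ 2 / 2 : ℝ) : ℂ) * ub) = 0 := by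
    push_cast at ka kb ⊢
    linear_combination ub * ((1 - (f : ℂ)) * ka - (f : ℂ) * ub * kb) -
      (D * (1 - (f : ℂ)) ^ 2 + (1 - (f : ℂ)) * ((1 - (f : ℂ)) * r + (f : ℂ) ^ 2 / 2)
        * (om.im * Complex.I) - (1 - (f : ℂ)) * (f : ℂ) ^ 2 / 2 * (om.im * Complex.I) * ub
        + ((f : ℂ) ^ 2 * D + 2 * (f : ℂ) ^ 2 * r * (om.im * Complex.I)) * (u * ub + 1)) * huc
  have c0 : 0 ≤ 1 - f := by linarith [hf.2]
  have hq : 0 < (1 - f) ^ 2 + f ^ 2 := by nlinarith [sq_nonneg (1 - 2 * f)]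
  obtain ⟨him, hre'⟩ := re_im_of_eq_zero key
  -- Since Re ū ≤ 1, the factor beside Im ω is at least ((1 - f)² + 2 f²) r, which is positive.
  have hth : om.im = 0 := by
    refine (mul_eq_zero.1 him).resolve_right (ne_of_gt ?_)
    have h2 : (1 - f) * f ^ 2 / 2 * ub.re ≤ (1 - f) * f ^ 2 / 2 * 1 :=
      mul_le_mul_of_nonneg_left hre (by positivity)
    have h3 : 0 < ((1 - f) ^ 2 + f ^ 2) * r := mul_pos hq hrpos
    have h4 : 0 ≤ f ^ 2 * r := by positivity
    linarith
  have hD0 : D = 0 := by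
    rw [hth, zero_mul, add_zero] at hre'
    exact (mul_eq_zero.1 hre').resolve_right hq.ne'
  have hx : om.re = 0 := by
    have h1 : 0 < (1 - f) ^ 2 * (Real.exp (sig * (hI cs lam ‖z‖ + k)) * (sig * (cs / lam)))
        + f ^ 2 := by
      have hp : 0 < Real.exp (sig * (hI cs lam ‖z‖ + k)) * (sig * (cs / lam)) := by positivity
      rcases eq_or_ne f 0 with h0 | h0
      · rw [h0]; simpa using hp
      · have : 0 < f ^ 2 := by positivity
        have : 0 ≤ (1 - f) ^ 2 * (Real.exp (sig * (hI cs lam ‖z‖ + k)) * (sig * (cs / lam))) := by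
          positivity
        linarith
    have h2 := (mul_eq_zero.1 (hD.symm.trans hD0)).resolve_left h1.ne'
    exact (mul_eq_zero.1 h2).resolve_left nz.ne'
  have hom0 : om = 0 := Complex.ext hx hth
  have hwv : vw = 0 := by
    simp only [hD0, hth, Complex.ofReal_zero, zero_mul, mul_zero, zero_add, sub_zero] at ka kb
    rcases mul_eq_zero.1 kb with h1 | h1
    · have hf1 : (f : ℂ) = 1 := by
        have : 1 - f = 0 := by exact_mod_cast h1
        exact_mod_cast (by linarith : f = 1)
      rw [hf1, one_mul] at ka
      exact (mul_eq_zero.1 ka).resolve_left (by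
        rw [hub']; exact (map_ne_zero _).2 (uu_ne_zero hz))
    · exact h1
  rw [hvz, hom0, hwv, hv0, mul_zero]
  rfl

/-- The isotopy is a smooth family of embeddings near the annulus `w = v = 0`. -/
lemma exists_chart (n : ℕ) (k : ℝ) (hcs : 0 < cs) (hlam : 0 < lam) (hsig : 0 < sig) {r0 : ℝ}
    (r1 : ℝ) (hr0 : 0 < r0) :
    ∃ δ > 0, ∃ (S : Set (ℝ × Sec n)) (g : ℝ × Sec n → ℝ × Sec n), IsOpen S ∧ ContDiffOn ℝ ∞ g S ∧
      (∀ y ∈ S, ((g y).1, iso cs lam sig k (g y).1 (g y).2) = y) ∧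
      ∀ f ∈ Icc (0 : ℝ) 1, ∀ q : Sec n, r0 ≤ ‖q.1‖ → ‖q.1‖ ≤ r1 → ‖q.2.1‖ < δ → ‖q.2.2‖ < δ →
        (f, iso cs lam sig k f q) ∈ S ∧ g (f, iso cs lam sig k f q) = (f, q) := by
  set F : ℝ × Sec n → ℝ × Sec n := fun y => (y.1, iso cs lam sig k y.1 y.2) with hF
  set s : Set (ℝ × Sec n) := Icc (0 : ℝ) 1 ×ˢ ((Metric.closedBall 0 r1 ∩ {z : ℂ | r0 ≤ ‖z‖}) ×ˢ {0})
    with hs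
  have hsc : IsCompact s := isCompact_Icc.prod
    (((isCompact_closedBall _ _).inter_right (isClosed_le continuous_const continuous_norm)).prod
      isCompact_singleton)
  have hne : ∀ y ∈ s, y.2.1 ≠ 0 := by
    intro y hy h0
    have := hy.2.1.2
    simp only [mem_ofPred_eq, h0, norm_zero] at this
    linarith
  have h0 : ∀ y ∈ s, y = (y.1, y.2.1, 0) := by
    intro y hy
    have : y.2.2 = 0 := hy.2.2
    rw [← this]
  have hA : IsOpen {y : ℝ × Sec n | y.2.1 ≠ 0} :=
    isOpen_ne.preimage (continuous_fst.comp continuous_snd)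
  obtain ⟨O, hO, hsO, hO', g, hg, hgl⟩ := exists_smooth_inverse (f := F) hsc hA hne
    (fun y hy => (contDiffAt_fst.prodMk (contDiffAt_iso hy)).contDiffWithinAt) (by
      intro y hy y' hy' h
      have e1 : (F y).1 = (F y').1 := congrArg Prod.fst h
      have e2 : (F y).2 = (F y').2 := congrArg Prod.snd h
      simp only [hF] at e1 e2
      rw [h0 y hy, h0 y' hy', ← e1] at e2 ⊢
      have := iso_inj_core hcs hlam hsig hy.1 (hne y hy) (hne y' hy') e2
      rw [this]) (by
      intro y hy v hv
      rw [h0 y hy] at hv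
      exact iso_ker hcs hlam hsig hy.1 (hne y hy) hv)
  -- One δ serves all f and z by compactness; in the product metric the distance to w = v = 0 is
  -- max(|w|, |v|).
  obtain ⟨δ, hδ, hth⟩ := hsc.exists_thickening_subset_open hO hsO
  refine ⟨δ, hδ, F '' O, g, hO', hg, ?_, ?_⟩
  · rintro _ ⟨y, hy, rfl⟩
    rw [hgl y hy]
  · intro f hf q h1 h2 h3 h4
    have hq : (f, q) ∈ O := by
      apply hth
      rw [Metric.mem_thickening_iff]
      refine ⟨(f, q.1, 0), ⟨hf, ⟨by simpa using h2, h1⟩, rfl⟩, ?_⟩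
      simp only [Prod.dist_eq, dist_self, dist_zero_right, Prod.norm_def]
      simp [h3, h4]
    exact ⟨⟨_, hq, rfl⟩, hgl _ hq⟩

end iso

/-! ### The tube -/

/-- A smooth inverse of the isotopy over the part of the section that is needed. -/
structure Tube (n : ℕ) (P : Par) where
  S : Set (ℝ × Sec n)
  g : ℝ × Sec n → ℝ × Sec n
  isOpen_S : IsOpen S
  contDiffOn_g : ContDiffOn ℝ ∞ g S
  right : ∀ y ∈ S, ((g y).1, iso P.cs P.lam P.sig P.k (g y).1 (g y).2) = y
  left : ∀ f ∈ Icc (0 : ℝ) 1, ∀ q : Sec n, (1 - P.lam) / 20 ≤ ‖q.1‖ → ‖q.1‖ ≤ P.R →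
    ‖q.2.1‖ < 3 * P.eps → ‖q.2.2‖ < 3 * P.eps →
    (f, iso P.cs P.lam P.sig P.k f q) ∈ S ∧ g (f, iso P.cs P.lam P.sig P.k f q) = (f, q)

/-! ### The barrier function of the tube -/

namespace Par
variable (P : Par)

/-- The height in the block that corresponds to `|ζ| = y`. -/
def II (y : ℝ) : ℝ := hI P.cs P.lam y

/-- This is T at the point of the bent flow with section radius y, one period (13) lower; `tau_seam`
relies on it. -/
def TT (h y : ℝ) : ℝ := Real.exp (2 * P.sig * (P.II y - (h - 13) + P.k))
def KT (h y : ℝ) : ℝ := P.TT h y / (1 + P.TT h y)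
-- The form that `tau` takes where the bending is complete. Along the tube only the height inside
-- `KT` varies, so `KT` alone provides the monotonicity.
def tauT (h y W : ℝ) : ℝ :=
  expNegInvGlue ((P.II y - P.cs * (P.R + 5 / 8)) / P.nu - P.KT h y) +
    expNegInvGlue ((-P.II y - 3 / 2 * P.dS) / P.nu - P.KT h y) +
      expNegInvGlue (W * (P.eps ^ 2)⁻¹ - 3 - P.KT h y)

/-- The part of the section on which the chart is used. -/
def Ann (n : ℕ) : Set (Sec n) := {q | (1 - P.lam) / 20 < ‖q.1‖ ∧ ‖q.1‖ < P.R ∧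
    ‖q.2.1‖ < 3 * P.eps ∧ ‖q.2.2‖ < 3 * P.eps}

/-- A compact part of the section that contains the support of the tube. -/
def Cpt (n : ℕ) : Set (Sec n) := {q | (1 - P.lam) / 8 ≤ ‖q.1‖ ∧ ‖q.1‖ ≤ P.R - 1 ∧
    ‖q.2.1‖ ≤ 5 / 2 * P.eps ∧ ‖q.2.2‖ ≤ 5 / 2 * P.eps}

variable {P} {n : ℕ}

lemma TT_pos (h y : ℝ) : 0 < P.TT h y := Real.exp_pos _
lemma KT_lt (h y : ℝ) : P.KT h y < 1 := by
  have := P.TT_pos h y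
  rw [KT, div_lt_one (by linarith)]; linarith

lemma tauT_nonneg (h y W : ℝ) : 0 ≤ P.tauT h y W :=
  add_nonneg (add_nonneg (expNegInvGlue.nonneg _) (expNegInvGlue.nonneg _))
    (expNegInvGlue.nonneg _)

lemma lam_mul_R : P.lam * P.R = P.R - 2 := by have := P.R_mul; linarith

lemma II_eq (y : ℝ) : P.lam * P.II y = P.cs * (y - (1 - P.lam)) := by
  have : P.lam ≠ 0 := by have := P.half_le_lam; linarith
  rw [II, hI]; field_simp

lemma lt_of_II_lt {y a : ℝ} (h : P.II y < a) : P.cs * (y - (1 - P.lam)) < P.lam * a := by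
  rw [← II_eq]; exact mul_lt_mul_of_pos_left h (by have := P.half_le_lam; linarith)

lemma lt_of_lt_II {y a : ℝ} (h : a < P.II y) : P.lam * a < P.cs * (y - (1 - P.lam)) := by
  rw [← II_eq]; exact mul_lt_mul_of_pos_left h (by have := P.half_le_lam; linarith)

lemma lam_dS : P.lam * P.dS = P.cs * ((1 - P.lam) / 2) := by
  have : P.lam ≠ 0 := by have := P.half_le_lam; linarith
  unfold dS; field_simp

lemma norm_lt_of_II {y : ℝ} (h : P.II y < P.cs * (P.R + 7 / 8)) :
    y < P.R - 1 - P.lam / 8 := by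
  have h1 := lt_of_II_lt h
  have h2 : P.lam * (P.cs * (P.R + 7 / 8)) = P.cs * (P.R - 2 + 7 / 8 * P.lam) := by
    rw [← lam_mul_R]; ring
  rw [h2] at h1
  have := lt_of_mul_lt_mul_left h1 P.cs_pos.le
  linarith

lemma lt_norm_of_II {y : ℝ} (h : -(7 / 4 * P.dS) < P.II y) : (1 - P.lam) / 8 < y := by
  have h1 := lt_of_lt_II h
  have h2 : P.lam * -(7 / 4 * P.dS) = P.cs * (-(7 / 8 * (1 - P.lam))) := by
    have := P.lam_dS; linarith
  rw [h2] at h1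
  have := lt_of_mul_lt_mul_left h1 P.cs_pos.le
  linarith

lemma tauT_bounds {h y W : ℝ} (H : P.tauT h y W < Real.exp (-1)) :
    P.II y < P.cs * (P.R + 7 / 8) ∧ -(7 / 4 * P.dS) < P.II y ∧ W < 5 * P.eps ^ 2 := by
  unfold tauT at H
  have n1 := expNegInvGlue.nonneg ((P.II y - P.cs * (P.R + 5 / 8)) / P.nu - P.KT h y)
  have n2 := expNegInvGlue.nonneg ((-P.II y - 3 / 2 * P.dS) / P.nu - P.KT h y)
  have n3 := expNegInvGlue.nonneg (W * (P.eps ^ 2)⁻¹ - 3 - P.KT h y)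
  have a1 := lt_one_of_expNegInvGlue_lt (show expNegInvGlue _ < Real.exp (-1) by linarith)
  have a2 := lt_one_of_expNegInvGlue_lt (x := (-P.II y - 3 / 2 * P.dS) / P.nu - P.KT h y)
    (by linarith)
  have a3 := lt_one_of_expNegInvGlue_lt (x := W * (P.eps ^ 2)⁻¹ - 3 - P.KT h y) (by linarith)
  have a1 := lt_one_of_expNegInvGlue_lt
    (x := (P.II y - P.cs * (P.R + 5 / 8)) / P.nu - P.KT h y) (by linarith)
  have hk := P.KT_lt h y
  have hnu := P.nu_le_dS
  have hdS := P.dS_le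
  have hcs := P.cs_pos
  have e1 : (P.II y - P.cs * (P.R + 5 / 8)) / P.nu < 2 := by linarith
  have e2 : (-P.II y - 3 / 2 * P.dS) / P.nu < 2 := by linarith
  have e3 : W * (P.eps ^ 2)⁻¹ < 5 := by linarith
  have he : 0 < P.eps ^ 2 := pow_pos P.eps_pos 2
  rw [div_lt_iff₀ P.nu_pos] at e1 e2
  rw [← div_eq_mul_inv, div_lt_iff₀ he] at e3
  exact ⟨by linarith, by linarith, e3⟩

lemma mem_Cpt {h : ℝ} {q : Sec n} (H : P.tauT h ‖q.1‖ (‖q.2.1‖ ^ 2 + ‖q.2.2‖ ^ 2) < Real.exp (-1)) :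
    q ∈ P.Cpt n := by
  obtain ⟨h1, h2, h3⟩ := tauT_bounds H
  have := norm_lt_of_II h1
  have := P.half_le_lam
  have he := P.eps_pos
  refine ⟨(lt_norm_of_II h2).le, by linarith, ?_, ?_⟩
  · apply abs_le_of_sq_le_sq' _ (by linarith) |>.2
    nlinarith [sq_nonneg ‖q.2.2‖]
  · apply abs_le_of_sq_le_sq' _ (by linarith) |>.2
    nlinarith [sq_nonneg ‖q.2.1‖]

lemma Cpt_subset : P.Cpt n ⊆ P.Ann n := by
  rintro q ⟨h1, h2, h3, h4⟩
  have := P.lam_lt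
  have := P.eps_pos
  exact ⟨by linarith, by linarith, by linarith, by linarith⟩

lemma isOpen_Ann : IsOpen (P.Ann n) := by
  refine (isOpen_lt continuous_const continuous_fst.norm).inter
    ((isOpen_lt continuous_fst.norm continuous_const).inter
      ((isOpen_lt continuous_snd.fst.norm continuous_const).inter
        (isOpen_lt continuous_snd.snd.norm continuous_const)))

lemma isCompact_Cpt : IsCompact (P.Cpt n) := by
  have hc : IsClosed (P.Cpt n) := (isClosed_le continuous_const continuous_fst.norm).inter
    ((isClosed_le continuous_fst.norm continuous_const).inter
      ((isClosed_le continuous_snd.fst.norm continuous_const).inter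
        (isClosed_le continuous_snd.snd.norm continuous_const)))
  refine ((isCompact_closedBall (0 : ℂ) (P.R - 1)).prod
    ((isCompact_closedBall (0 : ℂ) (5 / 2 * P.eps)).prod
      (isCompact_closedBall (0 : EuclideanSpace ℝ (Fin (n - 5))) (5 / 2 * P.eps)))).of_isClosed_subset
    hc ?_
  rintro q ⟨_, h2, h3, h4⟩
  exact ⟨by simpa using h2, by simpa using h3, by simpa using h4⟩

lemma Ann_ne_zero {q : Sec n} (hq : q ∈ P.Ann n) : q.1 ≠ 0 := by
  have h1 := hq.1
  have := P.lam_lt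
  intro h0
  rw [h0, norm_zero] at h1
  linarith

lemma hasDerivAt_KT (h y : ℝ) :
    HasDerivAt (fun h => P.KT h y) (-(2 * P.sig * P.TT h y / (1 + P.TT h y) ^ 2)) h := by
  have h1 : HasDerivAt (fun h => 2 * P.sig * (P.II y - (h - 13) + P.k)) (2 * P.sig * -1) h :=
    ((((hasDerivAt_id h).sub_const 13).const_sub _).add_const _).const_mul _
  have h2 : HasDerivAt (fun h => P.TT h y) (P.TT h y * (2 * P.sig * -1)) h := h1.exp
  have hT := P.TT_pos h y
  refine HasDerivAt.congr_deriv (f := fun h => P.KT h y)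
    (h2.div (h2.const_add 1) (by linarith)) ?_
  field_simp
  ring

/-- Along the tube the Lyapunov function `tauT` decreases with the height. -/
lemma hasDerivAt_tauT (h y W : ℝ) : ∃ D, HasDerivAt (fun h => P.tauT h y W) D h ∧ 0 ≤ D ∧
    (0 < P.tauT h y W → 0 < D) := by
  have hk := P.hasDerivAt_KT h y
  set κ := 2 * P.sig * P.TT h y / (1 + P.TT h y) ^ 2 with hκ
  have hκ0 : 0 < κ := by
    have := P.TT_pos h y; have := P.sig_pos; positivity
  have hN : ∀ a : ℝ, HasDerivAt (fun h => expNegInvGlue (a - P.KT h y))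
      (deriv expNegInvGlue (a - P.KT h y) * κ) h := by
    intro a
    have := HasDerivAt.comp h (hasDerivAt_expNegInvGlue (a - P.KT h y)) (hk.const_sub a)
    refine HasDerivAt.congr_deriv (f := fun h => expNegInvGlue (a - P.KT h y)) this ?_
    rw [neg_neg]
  have hN0 : ∀ a : ℝ, 0 ≤ deriv expNegInvGlue (a - P.KT h y) * κ := fun a =>
    mul_nonneg (deriv_expNegInvGlue_nonneg _) hκ0.le
  have hN1 : ∀ a : ℝ, 0 < expNegInvGlue (a - P.KT h y) →
      0 < deriv expNegInvGlue (a - P.KT h y) * κ := by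
    intro a ha
    refine mul_pos (deriv_expNegInvGlue_pos ?_) hκ0
    by_contra hc
    rw [expNegInvGlue.zero_of_nonpos (not_lt.1 hc)] at ha
    exact lt_irrefl _ ha
  refine ⟨_, ((hN _).add (hN _)).add (hN _), add_nonneg (add_nonneg (hN0 _) (hN0 _)) (hN0 _), ?_⟩
  intro hp
  unfold tauT at hp
  set a1 := (P.II y - P.cs * (P.R + 5 / 8)) / P.nu
  set a2 := (-P.II y - 3 / 2 * P.dS) / P.nu
  set a3 := W * (P.eps ^ 2)⁻¹ - 3
  have b1 := hN0 a1
  have b2 := hN0 a2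
  have b3 := hN0 a3
  rcases (expNegInvGlue.nonneg (a1 - P.KT h y)).eq_or_lt with c1 | c1
  · rcases (expNegInvGlue.nonneg (a2 - P.KT h y)).eq_or_lt with c2 | c2
    · have b3 := hN1 a3 (by linarith)
      linarith
    · have b2 := hN1 a2 c2
      linarith
  · have b1 := hN1 a1 c1
    linarith

lemma contDiffAt_tauT {y : ℝ × Sec n} (hz : y.2.1 ≠ 0) :
    ContDiffAt ℝ ∞ (fun y : ℝ × Sec n => P.tauT y.1 ‖y.2.1‖ (‖y.2.2.1‖ ^ 2 + ‖y.2.2.2‖ ^ 2)) y := by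
  have hn : ContDiffAt ℝ ∞ (fun y : ℝ × Sec n => ‖y.2.1‖) y :=
    ContDiffAt.comp (g := fun z : ℂ => ‖z‖) (f := fun y : ℝ × Sec n => y.2.1) y
      (contDiffAt_norm ℝ hz) contDiff_snd.fst.contDiffAt
  have hI : ContDiffAt ℝ ∞ (fun y : ℝ × Sec n => P.II ‖y.2.1‖) y :=
    contDiffAt_const.mul (hn.sub contDiffAt_const)
  have hT : ContDiffAt ℝ ∞ (fun y : ℝ × Sec n => P.TT y.1 ‖y.2.1‖) y :=
    (contDiffAt_const.mul ((hI.sub (contDiffAt_fst.sub contDiffAt_const)).add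
      contDiffAt_const)).exp
  have hK : ContDiffAt ℝ ∞ (fun y : ℝ × Sec n => P.KT y.1 ‖y.2.1‖) y :=
    hT.div (contDiffAt_const.add hT) (by have := P.TT_pos y.1 ‖y.2.1‖; linarith)
  have hW : ContDiffAt ℝ ∞ (fun y : ℝ × Sec n => ‖y.2.2.1‖ ^ 2 + ‖y.2.2.2‖ ^ 2) y :=
    (contDiff_ww (n := n)).contDiffAt
  have hN : ∀ {f : ℝ × Sec n → ℝ}, ContDiffAt ℝ ∞ f y →
      ContDiffAt ℝ ∞ (fun y => expNegInvGlue (f y)) y :=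
    fun h => contDiff_expNegInvGlue.contDiffAt.comp y h
  exact ((hN (((hI.sub contDiffAt_const).div_const _).sub hK)).add
    (hN (((hI.neg.sub contDiffAt_const).div_const _).sub hK))).add
      (hN (((hW.mul contDiffAt_const).sub contDiffAt_const).sub hK))

end Par

namespace Tube
-- The tube field and its Lyapunov function
open Par
variable {n : ℕ} {P : Par} (Q : Tube n P)

/-- The isotopy along the tube, as a function of the height. -/
def emb (P : Par) (h : ℝ) (q : Sec n) : Mod n := (h, iso P.cs P.lam P.sig P.k (stp 8 9 h) q)

/-- The section coordinate of a point of the tube. -/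
def gq (p : Mod n) : Sec n := (Q.g (stp 8 9 p.1, p.2)).2

def Dom : Set (Mod n) := {p | (stp 8 9 p.1, p.2) ∈ Q.S ∧ Q.gq p ∈ P.Ann n}

variable {Q}

lemma stp_mem (h : ℝ) : stp 8 9 h ∈ Icc (0 : ℝ) 1 := ⟨stp_nonneg _ _ _, stp_le_one _ _ _⟩

lemma contDiff_pre : ContDiff ℝ ∞ (fun p : Mod n => (stp 8 9 p.1, p.2)) :=
  ((contDiff_stp 8 9).comp contDiff_fst).prodMk contDiff_snd

lemma contDiffOn_gq' : ContDiffOn ℝ ∞ Q.gq {p | (stp 8 9 p.1, p.2) ∈ Q.S} :=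
  (contDiff_snd.comp_contDiffOn Q.contDiffOn_g).comp contDiff_pre.contDiffOn (fun _ hp => hp)

lemma isOpen_Dom : IsOpen Q.Dom :=
  contDiffOn_gq'.continuousOn.isOpen_inter_preimage
    (Q.isOpen_S.preimage contDiff_pre.continuous) isOpen_Ann

lemma contDiffAt_gq {p : Mod n} (hp : p ∈ Q.Dom) : ContDiffAt ℝ ∞ Q.gq p :=
  (contDiffOn_gq'.mono inter_subset_left).contDiffAt (isOpen_Dom.mem_nhds hp)

lemma emb_gq {p : Mod n} (hp : p ∈ Q.Dom) : emb P p.1 (Q.gq p) = p := by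
  have h := Q.right _ hp.1
  have h1 := congrArg Prod.fst h
  have h2 := congrArg Prod.snd h
  simp only at h1 h2
  rw [h1] at h2
  exact Prod.ext rfl h2

lemma emb_mem {q : Sec n} (hq : q ∈ P.Ann n) (h : ℝ) : emb P h q ∈ Q.Dom ∧ Q.gq (emb P h q) = q := by
  obtain ⟨h1, h2⟩ := Q.left (stp 8 9 h) (stp_mem h) q hq.1.le hq.2.1.le hq.2.2.1 hq.2.2.2
  have h3 : Q.gq (emb P h q) = q := congrArg Prod.snd h2
  exact ⟨⟨h1, by rw [h3]; exact hq⟩, h3⟩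

/-- The vertical component of the isotopy field. -/
def dIso (P : Par) (y : ℝ × Sec n) : Sec n :=
  fderiv ℝ (fun y : ℝ × Sec n => iso P.cs P.lam P.sig P.k y.1 y.2) y (1, 0)

lemma contDiffAt_dIso {y : ℝ × Sec n} (hz : y.2.1 ≠ 0) : ContDiffAt ℝ ∞ (dIso (n := n) P) y :=
  ((contDiffAt_iso hz).fderiv_right (m := ∞) (by simp)).clm_apply contDiffAt_const

variable (Q) in
/-- The tube field. -/
def XT (p : Mod n) : Mod n :=
  (-1, -(deriv (stp 8 9) p.1 • dIso P (stp 8 9 p.1, Q.gq p)))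

lemma hasDerivAt_emb {q : Sec n} (hq : q ∈ P.Ann n) (h : ℝ) :
    HasDerivAt (fun h => emb P h q) (-(Q.XT (emb P h q))) h := by
  have h1 : HasDerivAt (fun h => (stp 8 9 h, q)) (deriv (stp 8 9) h, (0 : Sec n)) h :=
    (hasDerivAt_stp 8 9 h).prodMk (hasDerivAt_const _ _)
  have h2 : HasFDerivAt (fun y : ℝ × Sec n => iso P.cs P.lam P.sig P.k y.1 y.2) _
      (stp 8 9 h, q) :=
    ((contDiffAt_iso (y := (stp 8 9 h, q)) (Ann_ne_zero hq)).differentiableAt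
      (by simp)).hasFDerivAt
  have h3 := h2.comp_hasDerivAt h h1
  refine HasDerivAt.congr_deriv (f := fun h => emb P h q) ((hasDerivAt_id h).prodMk h3) ?_
  have e : ((deriv (stp 8 9) h, (0 : Sec n)) : ℝ × Sec n)
      = deriv (stp 8 9) h • ((1 : ℝ), (0 : Sec n)) := by simp
  rw [e, map_smul, XT, (emb_mem hq h).2]
  simp [emb, dIso]

lemma XT_vert {p : Mod n} (hp : p.1 ≤ 8 ∨ 9 ≤ p.1) : Q.XT p = (-1, 0) := by
  have : deriv (stp 8 9) p.1 = 0 := by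
    rcases hp with h | h
    · exact deriv_stp_of_le (by norm_num) h
    · exact deriv_stp_of_ge (by norm_num) h
  rw [XT, this]; simp

lemma contDiffAt_XT {p : Mod n} (hp : p ∈ Q.Dom) : ContDiffAt ℝ ∞ Q.XT p := by
  have h1 : ContDiffAt ℝ ∞ (fun p : Mod n => deriv (stp 8 9) p.1) p :=
    ((contDiff_deriv_stp 8 9).comp contDiff_fst).contDiffAt
  have h2 : ContDiffAt ℝ ∞ (fun p : Mod n => dIso P (stp 8 9 p.1, Q.gq p)) p :=
    ContDiffAt.comp (g := dIso P) (f := fun p : Mod n => (stp 8 9 p.1, Q.gq p)) p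
      (contDiffAt_dIso (Ann_ne_zero hp.2))
      (((contDiff_stp 8 9).comp contDiff_fst).contDiffAt.prodMk (contDiffAt_gq hp))
  exact contDiffAt_const.prodMk (h1.smul h2).neg

/-- Directional derivatives along the tube field are derivatives along the isotopy. -/
lemma fderiv_XT {F : Type*} [NormedAddCommGroup F] [NormedSpace ℝ F] {f : Mod n → F} {p : Mod n}
    (hp : p ∈ Q.Dom) (hf : DifferentiableAt ℝ f p) {D : F}
    (hD : HasDerivAt (fun h => f (emb P h (Q.gq p))) D p.1) : fderiv ℝ f p (Q.XT p) = -D := by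
  have h1 := hasDerivAt_emb (Q := Q) hp.2 p.1
  have h2 := HasFDerivAt.comp_hasDerivAt p.1 (f := fun h => emb P h (Q.gq p)) (l := f)
    (l' := fderiv ℝ f p) (by rw [emb_gq hp]; exact hf.hasFDerivAt) h1
  have h3 := h2.unique hD
  rw [emb_gq hp, map_neg] at h3
  rw [← h3, neg_neg]

variable (Q) in
open Classical in
/-- The Lyapunov function of the tube. -/
def ThT (p : Mod n) : ℝ := if p ∈ Q.Dom then
  bump (P.tauT p.1 ‖(Q.gq p).1‖ (‖(Q.gq p).2.1‖ ^ 2 + ‖(Q.gq p).2.2‖ ^ 2)) else 0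

lemma ThT_emb {q : Sec n} (hq : q ∈ P.Ann n) (h : ℝ) :
    Q.ThT (emb P h q) = bump (P.tauT h ‖q.1‖ (‖q.2.1‖ ^ 2 + ‖q.2.2‖ ^ 2)) := by
  rw [ThT, if_pos (emb_mem hq h).1, (emb_mem hq h).2]
  rfl

lemma ThT_nonneg (p : Mod n) : 0 ≤ Q.ThT p := by
  unfold ThT; split_ifs
  · exact bump_nonneg _
  · exact le_rfl

lemma ThT_le_one (p : Mod n) : Q.ThT p ≤ 1 := by
  unfold ThT; split_ifs
  · exact bump_le_one (tauT_nonneg _ _ _)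
  · exact zero_le_one

lemma ThT_pos {p : Mod n} (hp : 0 < Q.ThT p) : p ∈ Q.Dom ∧
    P.tauT p.1 ‖(Q.gq p).1‖ (‖(Q.gq p).2.1‖ ^ 2 + ‖(Q.gq p).2.2‖ ^ 2) < Real.exp (-1) := by
  unfold ThT at hp
  split_ifs at hp with h
  · exact ⟨h, bump_pos_iff.1 hp⟩
  · exact absurd hp (lt_irrefl _)

lemma gq_mem_Cpt {p : Mod n} (hp : 0 < Q.ThT p) : Q.gq p ∈ P.Cpt n := mem_Cpt (ThT_pos hp).2

/-- Outside this closed set `ThT` is zero, and the set lies in the open `Dom`; this makes the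
extension by zero smooth. -/
lemma isClosed_tube : IsClosed {p : Mod n | ∃ q ∈ P.Cpt n, emb P p.1 q = p} := by
  have hc : IsCompact ((fun y : ℝ × Sec n => (y.1, iso P.cs P.lam P.sig P.k y.1 y.2)) ''
      (Icc (0 : ℝ) 1 ×ˢ P.Cpt n)) := by
    refine (isCompact_Icc.prod isCompact_Cpt).image_of_continuousOn ?_
    intro y hy
    exact (contDiffAt_fst.prodMk (contDiffAt_iso (Ann_ne_zero
      (Cpt_subset hy.2)))).continuousAt.continuousWithinAt
  have e : {p : Mod n | ∃ q ∈ P.Cpt n, emb P p.1 q = p} = (fun p : Mod n => (stp 8 9 p.1, p.2)) ⁻¹'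
      ((fun y : ℝ × Sec n => (y.1, iso P.cs P.lam P.sig P.k y.1 y.2)) ''
        (Icc (0 : ℝ) 1 ×ˢ P.Cpt n)) := by
    ext p
    constructor
    · rintro ⟨q, hq, h⟩
      have h2 : (emb P p.1 q).2 = p.2 := congrArg Prod.snd h
      exact ⟨(stp 8 9 p.1, q), ⟨stp_mem _, hq⟩, Prod.ext rfl h2⟩
    · rintro ⟨⟨f, q⟩, ⟨_, hq⟩, h⟩
      have h1 : f = stp 8 9 p.1 := congrArg Prod.fst h
      subst h1
      have h2 : iso P.cs P.lam P.sig P.k (stp 8 9 p.1) q = p.2 := congrArg Prod.snd h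
      exact ⟨q, hq, Prod.ext rfl h2⟩
  rw [e]
  exact hc.isClosed.preimage (contDiff_pre (n := n)).continuous

lemma contDiff_ThT : ContDiff ℝ ∞ Q.ThT := by
  rw [contDiff_iff_contDiffAt]
  intro p
  by_cases hp : p ∈ Q.Dom
  · have h1 : ContDiffAt ℝ ∞ (fun p : Mod n => bump
        (P.tauT p.1 ‖(Q.gq p).1‖ (‖(Q.gq p).2.1‖ ^ 2 + ‖(Q.gq p).2.2‖ ^ 2))) p := by
      refine contDiff_bump.contDiffAt.comp p (ContDiffAt.comp (f := fun p : Mod n => (p.1, Q.gq p))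
        p (contDiffAt_tauT (Ann_ne_zero hp.2)) ?_)
      exact contDiffAt_fst.prodMk (contDiffAt_gq hp)
    refine h1.congr_of_eventuallyEq ?_
    filter_upwards [isOpen_Dom.mem_nhds hp] with x hx
    rw [ThT, if_pos hx]
  · have hn : p ∉ {p : Mod n | ∃ q ∈ P.Cpt n, emb P p.1 q = p} := by
      rintro ⟨q, hq, h⟩
      rw [← h] at hp
      exact hp (emb_mem (Cpt_subset hq) _).1
    refine (contDiffAt_const (c := (0 : ℝ))).congr_of_eventuallyEq ?_
    filter_upwards [isClosed_tube.isOpen_compl.mem_nhds hn] with x hx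
    by_contra h0
    have hx' := lt_of_le_of_ne (ThT_nonneg x) (Ne.symm h0)
    exact hx ⟨Q.gq x, gq_mem_Cpt hx', emb_gq (ThT_pos hx').1⟩

/-- `ThT` increases along the tube field. -/
lemma fderiv_ThT {p : Mod n} (hp : 0 < Q.ThT p) :
    0 ≤ fderiv ℝ Q.ThT p (Q.XT p) ∧ (Q.ThT p < 1 → 0 < fderiv ℝ Q.ThT p (Q.XT p)) := by
  obtain ⟨hd, ht⟩ := ThT_pos hp
  obtain ⟨D, hD, hD0, hD1⟩ := P.hasDerivAt_tauT p.1 ‖(Q.gq p).1‖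
    (‖(Q.gq p).2.1‖ ^ 2 + ‖(Q.gq p).2.2‖ ^ 2)
  obtain ⟨E, hE, hE'⟩ := hasDerivAt_bump ht
  have h1 : HasDerivAt (fun h => Q.ThT (emb P h (Q.gq p))) (E * D) p.1 := by
    simp_rw [ThT_emb hd.2]
    exact HasDerivAt.comp p.1 hE' hD
  rw [fderiv_XT hd (contDiff_ThT.differentiable (by simp) p) h1]
  refine ⟨by nlinarith, fun h => ?_⟩
  have hpos : 0 < P.tauT p.1 ‖(Q.gq p).1‖ (‖(Q.gq p).2.1‖ ^ 2 + ‖(Q.gq p).2.2‖ ^ 2) := by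
    rcases (P.tauT_nonneg p.1 ‖(Q.gq p).1‖
      (‖(Q.gq p).2.1‖ ^ 2 + ‖(Q.gq p).2.2‖ ^ 2)).eq_or_lt with h0 | h0
    · rw [ThT, if_pos hd, ← h0, bump_zero] at h
      exact absurd h (lt_irrefl _)
    · exact h0
  have := hD1 hpos
  nlinarith

end Tube

/-! ### Gluing the block and the tube -/

namespace Tube
open Par
variable {n : ℕ} {P : Par} {Q : Tube n P}

lemma iso_zero {cs lam sig k : ℝ} (q : Sec n) : iso cs lam sig k 0 q =
    (((Real.exp (sig * (hI cs lam ‖q.1‖ + k)) : ℝ) : ℂ) * uu q.1, q.2.1, q.2.2) := by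
  simp [iso, isoA, isoB, rad]

lemma iso_one {cs lam sig k : ℝ} (q : Sec n) : iso cs lam sig k 1 q =
    ((‖q.1‖ : ℂ) * uu q.1 ^ 2 + 1, uu q.1 / 2 + starRingEnd ℂ (uu q.1) * q.2.1, q.2.2) := by
  simp only [iso, isoA, isoB, rad]
  refine Prod.ext ?_ (Prod.ext ?_ rfl)
  · push_cast; ring
  · push_cast; ring

lemma II_gt {y : ℝ} (h : (1 - P.lam) / 20 < y) : -1 < P.II y := by
  have h1 : P.lam * P.II y = P.cs * (y - (1 - P.lam)) := II_eq y
  have h2 := P.half_le_lam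
  have h3 := P.lam_lt
  have h4 := P.cs_le_one
  have h5 := P.cs_pos
  by_contra hc
  push Not at hc
  have h6 : P.lam * P.II y ≤ P.lam * (-1) := mul_le_mul_of_nonneg_left hc (by linarith)
  nlinarith

/-- Over a low point, `tauT` and `tauB` agree. -/
lemma tau_seam {q : Sec n} (hq : q ∈ P.Ann n) {h : ℝ} (hh : h ≤ -2) :
    P.tauB (h, iso P.cs P.lam P.sig P.k 0 q) =
      P.tauT (h + 13) ‖q.1‖ (‖q.2.1‖ ^ 2 + ‖q.2.2‖ ^ 2) := by
  have hs := P.sig_pos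
  have hx : xx ((h, iso P.cs P.lam P.sig P.k 0 q) : Mod n)
      = Real.exp (2 * P.sig * (P.II ‖q.1‖ + P.k)) := by
    rw [xx, iso_zero]
    simp only [norm_mul, Complex.norm_real, norm_uu (Ann_ne_zero hq),
      Real.norm_of_nonneg (Real.exp_pos _).le, mul_one, ← Real.exp_nat_mul]
    congr 1
    rw [II]; push_cast; ring
  have hw : ww ((h, iso P.cs P.lam P.sig P.k 0 q) : Mod n) = ‖q.2.1‖ ^ 2 + ‖q.2.2‖ ^ 2 := by
    rw [ww, iso_zero]
  have hI := II_gt hq.1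
  rw [tauB, hx, hw]
  set I := P.II ‖q.1‖
  set x := Real.exp (2 * P.sig * (I + P.k)) with hxd
  have hx0 : 0 < x := Real.exp_pos _
  have hlog : Real.log x = 2 * P.sig * (I + P.k) := Real.log_exp _
  have htt : P.tt h x = I - h := by
    rw [tt_eq hx0, hlog]; field_simp; ring
  have hps : P.ps h x = I - h := by rw [ps_of_one_le (by linarith), htt]
  -- Because I > -1, the summand 1 in k puts the whole exit beyond R3, where all weights are
  -- constant.
  have hx3 : P.R2 ^ 2 ≤ x := by
    refine P.sq23.le.trans ?_
    rw [← Real.log_le_log_iff (by have := P.R3_pos; positivity) hx0, hlog, Real.log_pow]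
    have : P.k = Real.log P.R3 / P.sig + 1 := rfl
    have e : 2 * P.sig * (I + P.k) = 2 * Real.log P.R3 + 2 * P.sig * (I + 1) := by
      rw [this]; field_simp; ring
    rw [e]
    have := mul_pos hs (by linarith : 0 < I + 1)
    push_cast; linarith
  have hT : P.T h x = P.TT (h + 13) ‖q.1‖ := by
    rw [T, hxd, ← Real.exp_add, TT]
    congr 1; ring
  have hK : P.K h x = P.KT (h + 13) ‖q.1‖ := by
    rw [K, hT, expNegInvGlue.zero_of_nonpos (by linarith), sub_zero, KT]
  have hIq : P.Iq P.sig h x = I := by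
    rw [Iq, m_one hx3, eFun_of_le (by linarith), hps]; ring
  have hI0 : P.I0 h x = I := by rw [I0, hps]; ring
  rw [tau, tauT, A1, A2, A3, hIq, hI0, hK, F_eps hx3]

lemma emb_low {q : Sec n} {h : ℝ} (hh : 9 ≤ h) : emb P h q = (h, iso P.cs P.lam P.sig P.k 0 q) := by
  rw [emb, stp_of_ge (by norm_num : (8 : ℝ) < 9) hh]

lemma emb_high {q : Sec n} {h : ℝ} (hh : h ≤ 8) :
    emb P h q = (h, iso P.cs P.lam P.sig P.k 1 q) := by
  rw [emb, stp_of_le (by norm_num : (8 : ℝ) < 9) hh]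

/-- The section coordinate of a low point of the block. -/
def lowq (P : Par) (h : ℝ) (s : Sec n) : Sec n :=
  (((1 - P.lam + P.lam / P.cs * P.I0 h (xx ((h, s) : Mod n)) : ℝ) : ℂ) * uu s.1, s.2)

/-- A low point of the block lies in the image of the isotopy. -/
lemma lowq_mem {h : ℝ} {s : Sec n} (hh : h ≤ -2) (H : 0 < P.ThB (h, s)) :
    s.1 ≠ 0 ∧ lowq P h s ∈ P.Ann n ∧ iso P.cs P.lam P.sig P.k 0 (lowq P h s) = s := by
  have HV := inV_iff.2 H
  set x := xx ((h, s) : Mod n) with hxd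
  have ht1 : 1 ≤ P.tt h x := tt_of_low HV hh
  have hx0 : 0 < x := x_pos_of_tt HV.1 (by linarith)
  have hs0 : s.1 ≠ 0 := by
    intro h0
    rw [hxd, xx, h0, norm_zero] at hx0
    norm_num at hx0
  have hsig := P.sig_pos
  have hcs := P.cs_pos
  have hlam := P.half_le_lam
  have hlam1 := P.lam_lt
  set I := P.I0 h x with hI0
  have hIe : I = Real.log x / (2 * P.sig) - P.k := by
    rw [hI0, I0, ps_of_one_le ht1, tt_eq hx0]; ring
  have hIlt : I < P.cs * (P.R + 7 / 8) := by
    have := HV.Iq_lt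
    rwa [HV.Iq_eq (by linarith)] at this
  have hIgt : -(7 / 4 * P.dS) < I := HV.I0_gt
  set y := 1 - P.lam + P.lam / P.cs * I with hy
  have hIy : P.II y = I := by
    rw [II, WildLorenz.hI, hy]
    have : P.lam ≠ 0 := by linarith
    field_simp; ring
  have hy1 : (1 - P.lam) / 8 < y := lt_norm_of_II (by rwa [hIy])
  have hy2 : y < P.R - 1 - P.lam / 8 := norm_lt_of_II (by rwa [hIy])
  have hy0 : 0 < y := by linarith
  have hnz : ‖(y : ℂ) * uu s.1‖ = y := by
    rw [norm_mul, norm_uu hs0, Complex.norm_real, Real.norm_of_nonneg hy0.le, mul_one]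
  have hW : ww ((h, s) : Mod n) < 5 * P.eps ^ 2 := by
    have h1 := HV.WF_lt
    rw [F_eps (P.sq23.le.trans (HV.sq_le (by linarith))), ← div_eq_mul_inv,
      div_lt_iff₀ (pow_pos P.eps_pos 2)] at h1
    exact h1
  have he := P.eps_pos
  have hW' : ‖s.2.1‖ ^ 2 + ‖s.2.2‖ ^ 2 < 5 * P.eps ^ 2 := hW
  have hlow : lowq P h s = ((y : ℂ) * uu s.1, s.2.1, s.2.2) := rfl
  rw [hlow]
  refine ⟨hs0, ⟨?_, ?_, ?_, ?_⟩, ?_⟩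
  · simp only [hnz]; linarith
  · simp only [hnz]; linarith
  · apply lt_of_pow_lt_pow_left₀ 2 (by linarith)
    nlinarith [sq_nonneg ‖s.2.2‖]
  · apply lt_of_pow_lt_pow_left₀ 2 (by linarith)
    nlinarith [sq_nonneg ‖s.2.1‖]
  · rw [iso_zero]
    simp only [hnz, uu_smul hy0]
    have e1 : hI P.cs P.lam y = I := hIy
    rw [e1]
    have e2 : P.sig * (I + P.k) = Real.log ‖s.1‖ := by
      rw [hIe, hxd, xx, Real.log_pow]; push_cast; field_simp; ring
    rw [e2, Real.exp_log (norm_pos_iff.2 hs0)]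
    have e3 : uu (uu s.1) = uu s.1 := uu_of_norm_one (norm_uu hs0)
    rw [e3, norm_mul_uu hs0]

/-- Either the point lies on the isotopy at f = 0 and `tau_seam` applies, or both functions vanish:
a low point with `ThB` > 0 is in that image by `lowq_mem`. -/
lemma ThT_seam {h : ℝ} (s : Sec n) (h9 : 9 ≤ h) (h11 : h ≤ 11) :
    Q.ThT (h, s) = P.ThB (h - 13, s) := by
  by_cases hq : ∃ q ∈ P.Ann n, iso P.cs P.lam P.sig P.k 0 q = s
  · obtain ⟨q, hq, rfl⟩ := hq
    rw [← emb_low h9, ThT_emb hq, ThB, tau_seam hq (by linarith), sub_add_cancel]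
  · have h1 : Q.ThT (h, s) = 0 := by
      by_contra h0
      have hp := lt_of_le_of_ne (ThT_nonneg _) (Ne.symm h0)
      have hd := (ThT_pos hp).1
      have := emb_gq hd
      rw [emb_low h9] at this
      exact hq ⟨_, hd.2, congrArg Prod.snd this⟩
    have h2 : P.ThB (h - 13, s) = 0 := by
      by_contra h0
      have hp := lt_of_le_of_ne (ThB_nonneg _) (Ne.symm h0)
      exact hq ⟨_, (lowq_mem (by linarith) hp).2⟩
    rw [h1, h2]

/-- A sufficient condition for a point to lie deep inside the block. -/
lemma ThB_eq_one {p : Mod n} (h1 : P.A1 p.1 (xx p) ≤ 0) (h2 : P.A2 p.1 (xx p) ≤ 0)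
    (h3 : P.A3 p.1 (xx p) (ww p) ≤ 0) : P.ThB p = 1 := by
  rw [ThB, tauB, tau, expNegInvGlue.zero_of_nonpos h1, expNegInvGlue.zero_of_nonpos h2,
    expNegInvGlue.zero_of_nonpos h3, add_zero, add_zero, bump_zero]

lemma tt_neg_of_le {h y : ℝ} (hh : 0 ≤ h) (hy : y ≤ P.R3) (hy0 : 0 ≤ y) : P.tt h (y ^ 2) < 0 := by
  rcases hy0.eq_or_lt with h0 | h0
  · rw [← h0]; norm_num; exact tt_zero _
  · have hs := P.sig_pos
    rw [tt_eq (by positivity), Real.log_pow]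
    have h1 := div_le_div_of_nonneg_right (Real.log_le_log h0 hy) hs.le
    have h2 : ((2 : ℕ) : ℝ) * Real.log y / (2 * P.sig) = Real.log y / P.sig := by
      push_cast; field_simp
    rw [h2]
    unfold k; linarith

lemma R_le_R3 : P.R ≤ P.R3 := by have := P.R_ge; unfold R3 R2; linarith

/-- The first integral at the entrance of the block. -/
lemma Iq_top {h y mu : ℝ} (hh : 2 ≤ h) (hy : y ≤ P.R) (hy0 : 0 < y) :
    P.Iq mu h (y ^ 2) = P.cs * y ^ (mu / P.sig) := by
  have hR := P.R_ge
  have hx : y ^ 2 ≤ P.R1 ^ 2 := pow_le_pow_left₀ hy0.le (by unfold R1; linarith) 2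
  have hcs := P.cs_pos
  rw [Iq, ps_of_nonpos (tt_neg_of_le (by linarith) (hy.trans R_le_R3) hy0.le).le, add_zero,
    eFun_of_ge hh, m, powStp_of_le P.sq12 _ hx, ← Real.exp_add, Real.rpow_def_of_pos hy0]
  have e : P.C mu + mu / (2 * P.sig) * (Real.log (y ^ 2) - 2 * Real.log (4 / P.cs))
      = Real.log P.cs + Real.log y * (mu / P.sig) := by
    have := P.sig_pos.ne'
    rw [C, Real.log_pow]; push_cast; field_simp; ring
  rw [e, Real.exp_add, Real.exp_log hcs]

/-- High up Iq = cs |z| ≤ cs R, the height is positive and F = 1, so each barrier is inactive with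
enough room for |K| < 1. -/
lemma ThB_top {p : Mod n} (hh : 2 ≤ p.1) (hz : ‖p.2.1‖ ≤ P.R) (hw : ww p ≤ 2) : P.ThB p = 1 := by
  have hx0 := xx_nonneg p
  have k1 := P.K_lt (h := p.1) hx0
  have k2 := P.K_gt (h := p.1) hx0
  have hR := P.R_ge
  have hcs := P.cs_pos
  have hnu := P.nu_pos
  have hnu' := P.nu_le_dS
  have hdS := P.dS_le
  have hx : xx p ≤ P.R1 ^ 2 := by
    unfold xx R1
    exact pow_le_pow_left₀ (norm_nonneg _) (by linarith) 2
  have ht : P.tt p.1 (xx p) < 0 :=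
    tt_neg_of_le (by linarith) (hz.trans R_le_R3) (norm_nonneg _)
  refine ThB_eq_one ?_ ?_ ?_
  · rcases (norm_nonneg p.2.1).eq_or_lt with h0 | h0
    · refine A1_nonpos_of_small hx0 ?_ ht.le
      rw [xx, ← h0]; norm_num
    · have h1 : P.Iq P.sig p.1 (xx p) = P.cs * ‖p.2.1‖ := by
        rw [xx, Iq_top hh hz h0, div_self P.sig_pos.ne', Real.rpow_one]
      have h2 : (P.Iq P.sig p.1 (xx p) - P.cs * (P.R + 5 / 8)) / P.nu ≤ -1 := by
        rw [div_le_iff₀ hnu, h1]; nlinarith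
      unfold A1; linarith
  · have h2 : (-P.I0 p.1 (xx p) - 3 / 2 * P.dS) / P.nu ≤ -1 := by
      rw [div_le_iff₀ hnu, I0, ps_of_nonpos ht.le]
      have := P.cs_le_one; have := P.dS_pos
      linarith
    unfold A2; linarith
  · unfold A3
    rw [F_one hx]; linarith

/-- The image of the folding map lies deep inside the block. -/
lemma fold_bounds {q : Sec n} (hq : q ∈ P.Cpt n) :
    ‖(iso P.cs P.lam P.sig P.k 1 q).1‖ ≤ P.R ∧ ‖(iso P.cs P.lam P.sig P.k 1 q).2.1‖ ≤ 1 ∧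
      ‖(iso P.cs P.lam P.sig P.k 1 q).2.2‖ ≤ 1 := by
  obtain ⟨h1, h2, h3, h4⟩ := hq
  have he := P.eps_lt
  have hz := Ann_ne_zero (Cpt_subset ⟨h1, h2, h3, h4⟩)
  rw [iso_one]
  refine ⟨?_, ?_, ?_⟩
  · refine (norm_add_le _ _).trans ?_
    simp only [norm_mul, norm_pow, norm_uu hz, Complex.norm_real, norm_norm, norm_one]
    linarith
  · refine (norm_add_le _ _).trans ?_
    simp only [norm_mul, norm_div, Complex.norm_conj, norm_uu hz]
    norm_num; linarith
  · simp only; linarith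

/-- The folded tube arrives inside the zone of `ThB_top`, so the two Lyapunov functions can be glued
without a loss. -/
lemma ThB_of_ThT {p : Mod n} (h2 : 2 ≤ p.1) (h8 : p.1 ≤ 8) (H : 0 < Q.ThT p) : P.ThB p = 1 := by
  have hq := gq_mem_Cpt H
  have hb := fold_bounds hq
  have e := emb_gq (ThT_pos H).1
  rw [emb_high h8] at e
  have e2 : iso P.cs P.lam P.sig P.k 1 (Q.gq p) = p.2 := congrArg Prod.snd e
  rw [e2] at hb
  refine ThB_top h2 hb.1 ?_
  have a := pow_le_one₀ (n := 2) (norm_nonneg _) hb.2.1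
  have b := pow_le_one₀ (n := 2) (norm_nonneg _) hb.2.2
  unfold ww; linarith

/-! ### The glued objects -/

variable (Q) in
-- Along descending orbits the weight passes from `ThT` to `ThB`, which equals 1 on the tube, so the
-- change of weight only helps.
def Th (p : Mod n) : ℝ := stp 6 7 p.1 * P.ThB p + (1 - stp 6 7 p.1) * Q.ThT p

open Classical in
variable (Q) in
-- The switch at height 5 is invisible: where `Th` > 0 both fields equal (-1, 0) at heights in [3,
-- 8].
def X (mu : ℝ) (p : Mod n) : Mod n := if p.1 < 5 then P.XB mu p else Q.XT p

/-- The field is meaningful only where `Th` > 0; the cutoff is 1 where `Th` ≥ 1/4, the level that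
bounds V. -/
def kap (s : ℝ) : ℝ := Real.smoothTransition (8 * s - 1)

lemma kap_one {s : ℝ} (hs : 1 / 4 ≤ s) : kap s = 1 :=
  Real.smoothTransition.one_of_one_le (by linarith)
lemma kap_zero {s : ℝ} (hs : s ≤ 1 / 8) : kap s = 0 :=
  Real.smoothTransition.zero_of_nonpos (by linarith)
lemma contDiff_kap : ContDiff ℝ ∞ kap :=
  contDiff_smoothTransition.comp ((contDiff_const.mul contDiff_id).sub contDiff_const)

variable (Q) in
/-- The field multiplied by a cutoff function. -/
def Y (mu : ℝ) (p : Mod n) : Mod n := kap (Q.Th p) • Q.X mu p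

lemma Th_of_le {p : Mod n} (h : p.1 ≤ 6) : Q.Th p = P.ThB p := by
  simp [Th, stp_of_le (by norm_num : (6 : ℝ) < 7) h]
lemma Th_of_ge {p : Mod n} (h : 7 ≤ p.1) : Q.Th p = Q.ThT p := by
  simp [Th, stp_of_ge (by norm_num : (6 : ℝ) < 7) h]

lemma contDiff_Th : ContDiff ℝ ∞ Q.Th :=
  (((contDiff_stp 6 7).comp contDiff_fst).mul contDiff_ThB).add
    ((contDiff_const.sub ((contDiff_stp 6 7).comp contDiff_fst)).mul contDiff_ThT)

lemma Th_seam {h : ℝ} (s : Sec n) (h9 : 9 ≤ h) (h11 : h ≤ 11) : Q.Th (h, s) = Q.Th (h - 13, s) := by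
  rw [Th_of_ge (by simp only; linarith), Th_of_le (by simp only; linarith), ThT_seam s h9 h11]

/-- In the block, positivity of `Th` is positivity of `ThB`. -/
lemma ThB_pos {p : Mod n} (h2 : 2 ≤ p.1) (h8 : p.1 ≤ 8) (H : 0 < Q.Th p) : 0 < P.ThB p := by
  by_contra h0
  have h1 : P.ThB p = 0 := le_antisymm (not_lt.1 h0) (ThB_nonneg p)
  have h3 : Q.ThT p = 0 := by
    by_contra h4
    have := ThB_of_ThT h2 h8 (lt_of_le_of_ne (ThT_nonneg p) (Ne.symm h4))
    linarith
  rw [Th, h1, h3] at H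
  linarith

lemma ThB_pos' {p : Mod n} (h8 : p.1 ≤ 8) (H : 0 < Q.Th p) : 0 < P.ThB p := by
  rcases le_or_gt p.1 6 with h | h
  · rwa [← Th_of_le h]
  · exact ThB_pos (by linarith) h8 H

/-- The field in the block. -/
lemma X_block {mu : ℝ} {p : Mod n} (h8 : p.1 ≤ 8) (H : 0 < Q.Th p) : Q.X mu p = P.XB mu p := by
  unfold X
  split_ifs with h
  · rfl
  · rw [XT_vert (Or.inl h8), XB_of_three_le (ThB_pos' h8 H) (by linarith)]

lemma X_tube {mu : ℝ} {p : Mod n} (h3 : 3 ≤ p.1) (H : 0 < Q.Th p) : Q.X mu p = Q.XT p := by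
  unfold X
  split_ifs with h
  · rw [XT_vert (Or.inl (by linarith)), XB_of_three_le (ThB_pos' (by linarith) H) h3]
  · rfl

lemma X_vert {mu : ℝ} {p : Mod n} (h3 : 3 ≤ p.1) (h8 : p.1 ≤ 8) (H : 0 < Q.Th p) :
    Q.X mu p = (-1, 0) := by
  rw [X_tube h3 H, XT_vert (Or.inl h8)]

lemma Y_seam {mu h : ℝ} (s : Sec n) (h9 : 9 ≤ h) (h11 : h ≤ 11) :
    Q.Y mu (h, s) = Q.Y mu (h - 13, s) := by
  have e := Q.Th_seam s h9 h11
  have h0 : 0 ≤ Q.Th (h - 13, s) := by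
    rw [Th_of_le (by simp only; linarith)]; exact ThB_nonneg _
  rcases h0.eq_or_lt with h0 | h0
  · rw [Y, Y, e, ← h0, kap_zero (by norm_num), zero_smul, zero_smul]
  · rw [Y, Y, e, X_tube (by simp only; linarith) (by rwa [e]), XT_vert (Or.inr h9),
      X_block (by simp only; linarith) h0,
      XB_of_low (ThB_pos' (by simp only; linarith) h0) (by simp only; linarith)]

lemma contDiff_Y : ContDiff ℝ ∞ (fun y : ℝ × Mod n => Q.Y y.1 y.2) := by
  rw [contDiff_iff_contDiffAt]
  rintro ⟨mu, p⟩
  have hTh : ContDiff ℝ ∞ (fun y : ℝ × Mod n => Q.Th y.2) := contDiff_Th.comp contDiff_snd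
  rcases lt_or_ge (Q.Th p) (1 / 8) with hp | hp
  · refine (contDiffAt_const (c := (0 : Mod n))).congr_of_eventuallyEq ?_
    filter_upwards [hTh.continuous.continuousAt.eventually_lt_const
      (show Q.Th (mu, p).2 < 1 / 8 from hp)] with y hy
    rw [Y, kap_zero hy.le, zero_smul]
  · have hk : ContDiffAt ℝ ∞ (fun y : ℝ × Mod n => kap (Q.Th y.2)) (mu, p) :=
      contDiff_kap.contDiffAt.comp (mu, p) hTh.contDiffAt
    have hpos : ∀ᶠ y : ℝ × Mod n in 𝓝 (mu, p), 0 < Q.Th y.2 :=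
      hTh.continuous.continuousAt.eventually_const_lt
        (show 0 < Q.Th (mu, p).2 from lt_of_lt_of_le (by norm_num) hp)
    have hc : Continuous (fun y : ℝ × Mod n => y.2.1) := continuous_snd.fst
    refine ContDiffAt.smul hk ?_
    rcases lt_or_ge p.1 5 with h5 | h5
    · refine (contDiff_XB (P := P) (n := n)).contDiffAt.congr_of_eventuallyEq ?_
      filter_upwards [hc.continuousAt.eventually_lt_const
        (show (mu, p).2.1 < 5 from h5)] with y hy
      exact if_pos hy
    · have h1 : ∀ᶠ y : ℝ × Mod n in 𝓝 (mu, p), Q.X y.1 y.2 = Q.XT y.2 := by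
        filter_upwards [hpos, hc.continuousAt.eventually_const_lt
          (show 4 < (mu, p).2.1 by simp only; linarith)] with y h2 h3
        exact X_tube (by linarith) h2
      rcases lt_or_ge p.1 8 with h8 | h8
      · refine (contDiffAt_const (c := ((-1, 0) : Mod n))).congr_of_eventuallyEq ?_
        filter_upwards [h1, hc.continuousAt.eventually_lt_const
          (show (mu, p).2.1 < 8 from h8)] with y h2 h3
        rw [h2, XT_vert (Or.inl h3.le)]
      · have hd : p ∈ Q.Dom := by
          rw [Th_of_ge (by linarith)] at hp
          exact (ThT_pos (by linarith)).1
        refine ContDiffAt.congr_of_eventuallyEq ?_ h1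
        exact ContDiffAt.comp (g := Q.XT) (f := fun y : ℝ × Mod n => y.2) (mu, p)
          (contDiffAt_XT hd) contDiffAt_snd

lemma hasDerivAt_line {F : Type*} [NormedAddCommGroup F] [NormedSpace ℝ F] {f : Mod n → F}
    {p v : Mod n} (hf : DifferentiableAt ℝ f p) :
    HasDerivAt (fun s : ℝ => f (p + s • v)) (fderiv ℝ f p v) 0 := by
  have hγ : HasDerivAt (fun s : ℝ => p + s • v) v 0 := by
    simpa using ((hasDerivAt_id (0 : ℝ)).smul_const v).const_add p
  exact HasFDerivAt.comp_hasDerivAt (0 : ℝ) (f := fun s : ℝ => p + s • v)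
    (l := f) (by simpa using hf.hasFDerivAt) hγ

lemma fderiv_Th_apply (p v : Mod n) : fderiv ℝ Q.Th p v =
    deriv (stp 6 7) p.1 * v.1 * (P.ThB p - Q.ThT p) + stp 6 7 p.1 * fderiv ℝ P.ThB p v
      + (1 - stp 6 7 p.1) * fderiv ℝ Q.ThT p v := by
  have dB := hasDerivAt_line (v := v) ((contDiff_ThB (P := P) (n := n)).differentiable (by simp) p)
  have dT := hasDerivAt_line (v := v) ((contDiff_ThT (Q := Q)).differentiable (by simp) p)
  have dTh := hasDerivAt_line (v := v) ((contDiff_Th (Q := Q)).differentiable (by simp) p)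
  have h1 : HasDerivAt (fun s : ℝ => p.1 + s * v.1) v.1 0 := by
    simpa using ((hasDerivAt_id (0 : ℝ)).mul_const v.1).const_add p.1
  have hs : HasDerivAt (fun s : ℝ => stp 6 7 (p.1 + s * v.1)) (deriv (stp 6 7) p.1 * v.1) 0 :=
    HasDerivAt.comp (0 : ℝ) (h₂ := stp 6 7) (by simpa using hasDerivAt_stp 6 7 p.1) h1
  have h2 : HasDerivAt (fun s : ℝ => Q.Th (p + s • v)) _ 0 :=
    (hs.mul dB).add ((hs.const_sub 1).mul dT)
  rw [dTh.unique h2]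
  simp
  ring

/-- The field points inward on the level sets of `Th`. -/
lemma fderiv_Th {mu : ℝ} (hg : P.Good mu) {p : Mod n} (h0 : 0 < Q.Th p) (h1 : Q.Th p < 1) :
    0 < fderiv ℝ Q.Th p (Q.X mu p) := by
  have hB : p.1 ≤ 8 → 0 ≤ fderiv ℝ P.ThB p (Q.X mu p) ∧
      (P.ThB p < 1 → 0 < fderiv ℝ P.ThB p (Q.X mu p)) := by
    intro h8
    have hp := ThB_pos' h8 h0
    rw [X_block h8 h0]
    have hγ : HasDerivAt (fun s : ℝ => p + s • P.XB mu p) (P.XB mu p) 0 := by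
      simpa using ((hasDerivAt_id (0 : ℝ)).smul_const (P.XB mu p)).const_add p
    have e0 : p + (0 : ℝ) • P.XB mu p = p := by simp
    obtain ⟨D, hD, hD0, hD1⟩ := hasDerivAt_ThB (γ := fun s : ℝ => p + s • P.XB mu p) (t := 0) hg
      (by rw [e0]; exact hγ) (by rw [e0]; exact hp) (by rw [e0]; linarith)
    have h2 := hasDerivAt_line (v := P.XB mu p)
      ((contDiff_ThB (P := P) (n := n)).differentiable (by simp) p)
    rw [e0] at hD1
    rw [h2.unique hD]
    exact ⟨hD0, hD1⟩
  have hT : 3 ≤ p.1 → 0 ≤ fderiv ℝ Q.ThT p (Q.X mu p) ∧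
      (0 < Q.ThT p → Q.ThT p < 1 → 0 < fderiv ℝ Q.ThT p (Q.X mu p)) := by
    intro h3
    rw [X_tube h3 h0]
    rcases (ThT_nonneg (Q := Q) p).eq_or_lt with hz | hz
    · have hm : IsLocalMin Q.ThT p := Eventually.of_forall fun y => by
        rw [← hz]; exact ThT_nonneg y
      rw [hm.fderiv_eq_zero, ← hz]
      exact ⟨le_rfl, fun h => absurd h (lt_irrefl _)⟩
    · exact ⟨(fderiv_ThT hz).1, fun _ => (fderiv_ThT hz).2⟩
  rw [fderiv_Th_apply]
  rcases le_or_gt p.1 6 with h6 | h6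
  · rw [stp_of_le (by norm_num : (6 : ℝ) < 7) h6, deriv_stp_of_le (by norm_num : (6 : ℝ) < 7) h6]
    rw [Th_of_le h6] at h1
    have := (hB (by linarith)).2 h1
    linarith
  rcases le_or_gt 7 p.1 with h7 | h7
  · rw [stp_of_ge (by norm_num : (6 : ℝ) < 7) h7, deriv_stp_of_ge (by norm_num : (6 : ℝ) < 7) h7]
    rw [Th_of_ge h7] at h0 h1
    have := (hT (by linarith)).2 h0 h1
    linarith
  have hv : (Q.X mu p).1 = -1 := by rw [X_vert (by linarith) (by linarith) h0]
  have hd := deriv_stp_neg h6 h7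
  have s0 := stp_pos (by norm_num : (6 : ℝ) < 7) h7
  have s1 := stp_lt_one (by norm_num : (6 : ℝ) < 7) h6
  have b0 := (hB (by linarith)).1
  have t0 := (hT (by linarith)).1
  have b1 := mul_nonneg s0.le b0
  have t1 := mul_nonneg (by linarith : 0 ≤ 1 - stp 6 7 p.1) t0
  rw [hv]
  -- Off the tube the change of weight, -stp'·ThB, is positive. On the tube ThB = 1, and ThT < 1
  -- makes the tube term strict.
  rcases (ThT_nonneg (Q := Q) p).eq_or_lt with hz | hz
  · have hp := ThB_pos' (by linarith) h0
    rw [← hz]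
    have := mul_pos (neg_pos.2 hd) hp
    linarith
  · have e := ThB_of_ThT (by linarith) (by linarith) hz
    have hlt : Q.ThT p < 1 := by
      by_contra hc
      have := le_antisymm (ThT_le_one p) (not_lt.1 hc)
      rw [Th, e, this] at h1
      linarith
    have t2 := mul_pos (by linarith : 0 < 1 - stp 6 7 p.1) ((hT (by linarith)).2 hz hlt)
    rw [e]
    have := mul_nonneg (neg_nonneg.2 hd.le) (by linarith : 0 ≤ 1 - Q.ThT p)
    linarith

/-- The region is bounded. -/
lemma exists_bound (Q : Tube n P) : ∃ B : ℝ, ∀ p : Mod n, p.1 ≤ 11 → 0 < Q.Th p → ‖p.2‖ ≤ B := by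
  have hc : IsCompact ((fun y : ℝ × Sec n => iso P.cs P.lam P.sig P.k y.1 y.2) ''
      (Icc (0 : ℝ) 1 ×ˢ P.Cpt n)) := by
    refine (isCompact_Icc.prod isCompact_Cpt).image_of_continuousOn ?_
    intro y hy
    exact (contDiffAt_iso (Ann_ne_zero (Cpt_subset hy.2))).continuousAt.continuousWithinAt
  obtain ⟨B1, hB1⟩ := hc.isBounded.exists_norm_le
  set B2 := Real.exp (P.sig * (12 + P.k)) with hB2
  refine ⟨max B1 (max B2 3), fun p h11 h0 => ?_⟩
  rcases le_or_gt p.1 8 with h8 | h8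
  · refine le_max_of_le_right ?_
    have HV := inV_iff.2 (ThB_pos' h8 h0)
    have hs := P.sig_pos
    have hW := HV.W_lt
    have hw : ‖p.2.2.1‖ ≤ 3 := by
      apply le_of_sq_le_sq _ (by norm_num)
      unfold ww at hW; nlinarith [sq_nonneg ‖p.2.2.2‖]
    have hv : ‖p.2.2.2‖ ≤ 3 := by
      apply le_of_sq_le_sq _ (by norm_num)
      unfold ww at hW; nlinarith [sq_nonneg ‖p.2.2.1‖]
    have hz : ‖p.2.1‖ ≤ B2 := by
      rcases (norm_nonneg p.2.1).eq_or_lt with hz | hz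
      · rw [← hz]; exact (Real.exp_pos _).le
      have hx : 0 < xx p := pow_pos hz 2
      have hlog : Real.log (xx p) = 2 * Real.log ‖p.2.1‖ := by
        rw [xx, Real.log_pow]; push_cast; ring
      have ht : P.tt p.1 (xx p) = Real.log ‖p.2.1‖ / P.sig - p.1 - P.k := by
        rw [tt_eq hx, hlog]; field_simp
      -- If the bending is complete, the upper barrier bounds log |z| / σ - k; otherwise `tt` < 1
      -- and h ≤ 8 bound log |z|.
      have : Real.log ‖p.2.1‖ / P.sig ≤ 12 + P.k := by
        rcases le_or_gt 1 (P.tt p.1 (xx p)) with h1 | h1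
        · have h2 := HV.Iq_lt
          rw [HV.Iq_eq (by linarith), I0, ps_of_one_le h1] at h2
          have := P.cs_R; have := P.cs_pos
          nlinarith
        · linarith
      rw [div_le_iff₀ hs] at this
      rw [hB2, ← Real.exp_log hz]
      exact Real.exp_le_exp.2 (by linarith)
    simp only [Prod.norm_def]
    exact max_le (le_max_of_le_left hz) (max_le (le_max_of_le_right hw) (le_max_of_le_right hv))
  · rw [Th_of_ge (by linarith)] at h0
    refine le_max_of_le_left (hB1 _ ⟨(stp 8 9 p.1, Q.gq p), ⟨stp_mem _, gq_mem_Cpt h0⟩, ?_⟩)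
    exact congrArg Prod.snd (emb_gq (ThT_pos h0).1)

end Tube

/-! ### Global solutions of bounded Lipschitz fields -/

/-- Boundedness allows Picard–Lindelöf on every [-N, N]; uniqueness glues these solutions. -/
lemma exists_global_solution {X : Type*} [NormedAddCommGroup X] [NormedSpace ℝ X] [CompleteSpace X]
    {v : X → X} {K L : NNReal} (hv : LipschitzWith K v) (hL : ∀ x, ‖v x‖ ≤ L) (x : X) :
    ∃ γ : ℝ → X, γ 0 = x ∧ ∀ t, HasDerivAt γ (v (γ t)) t := by
  have hex : ∀ N : ℕ, ∃ α : ℝ → X, α 0 = x ∧ ∀ t ∈ Icc (-(N : ℝ)) N,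
      HasDerivWithinAt α (v (α t)) (Icc (-(N : ℝ)) N) t := by
    intro N
    have h0 : (0 : ℝ) ∈ Icc (-(N : ℝ)) N := by constructor <;> simp
    have hP : IsPicardLindelof (fun _ => v) (⟨0, h0⟩ : Icc (-(N : ℝ)) N) x (L * N) 0 L K :=
      IsPicardLindelof.of_time_independent (fun y _ => hL y) hv.lipschitzOnWith (by simp)
    exact hP.exists_eq_forall_mem_Icc_hasDerivWithinAt₀
  choose α hα0 hα using hex
  have hd : ∀ N : ℕ, ∀ t ∈ Ioo (-(N : ℝ)) N, HasDerivAt (α N) (v (α N t)) t := fun N t ht =>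
    (hα N t (Ioo_subset_Icc_self ht)).hasDerivAt (Icc_mem_nhds ht.1 ht.2)
  have hle : ∀ N M : ℕ, N ≤ M → EqOn (α N) (α M) (Ioo (-(N : ℝ)) N) := by
    intro N M hNM t ht
    have hNM' : (N : ℝ) ≤ M := by exact_mod_cast hNM
    have hN : (0 : ℝ) < N := by linarith [ht.1, ht.2]
    refine ODE_solution_unique_of_mem_Ioo (v := fun _ => v) (s := fun _ => univ) (K := K)
      (fun _ _ => hv.lipschitzOnWith) (⟨by linarith, hN⟩ : (0 : ℝ) ∈ Ioo (-(N : ℝ)) N)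
      (fun s hs => ⟨hd N s hs, trivial⟩)
      (fun s hs => ⟨hd M s ⟨by linarith [hs.1], by linarith [hs.2]⟩, trivial⟩)
      ((hα0 N).trans (hα0 M).symm) ht
  have heq : ∀ N M : ℕ, ∀ t : ℝ, |t| < N → |t| < M → α N t = α M t := by
    intro N M t hN hM
    rcases le_total N M with h | h
    · exact hle N M h (abs_lt.1 hN)
    · exact (hle M N h (abs_lt.1 hM)).symm
  set γ : ℝ → X := fun t => α (⌈|t|⌉₊ + 1) t with hγ
  have hlt : ∀ t : ℝ, |t| < ((⌈|t|⌉₊ + 1 : ℕ) : ℝ) := fun t => by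
    push_cast; linarith [Nat.le_ceil |t|]
  have hγN : ∀ N : ℕ, ∀ t : ℝ, |t| < N → γ t = α N t := fun N t ht => heq _ _ t (hlt t) ht
  refine ⟨γ, ?_, fun t => ?_⟩
  · rw [hγN 1 0 (by simp), hα0]
  · have h1 := hd _ t (abs_lt.1 (hlt t))
    have h2 : γ =ᶠ[𝓝 t] α (⌈|t|⌉₊ + 1) := by
      filter_upwards [continuous_abs.continuousAt.eventually_lt_const (hlt t)] with s hs
      exact hγN _ s hs
    rw [hγN _ t (hlt t)]
    exact h1.congr_of_eventuallyEq h2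

/-! ### Periodization -/

/-- The representative of `h` modulo `13` in `[-3, 10)`. -/
def wrap (h : ℝ) : ℝ := h - 13 * ⌊(h + 3) / 13⌋

lemma wrap_mem (h : ℝ) : -3 ≤ wrap h ∧ wrap h < 10 := by
  have h1 := Int.floor_le ((h + 3) / 13)
  have h2 := Int.lt_floor_add_one ((h + 3) / 13)
  unfold wrap
  constructor <;> linarith

lemma wrap_eq {h : ℝ} {m : ℤ} (h1 : -3 ≤ h - 13 * m) (h2 : h - 13 * m < 10) :
    wrap h = h - 13 * m := by
  have : ⌊(h + 3) / 13⌋ = m := by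
    rw [Int.floor_eq_iff]
    constructor <;> linarith
  rw [wrap, this]

lemma wrap_sub (h : ℝ) (m : ℤ) : wrap (h - 13 * m) = wrap h := by
  obtain ⟨h1, h2⟩ := wrap_mem h
  unfold wrap at h1 h2
  rw [wrap_eq (h := h - 13 * m) (m := ⌊(h + 3) / 13⌋ - m) (by push_cast; linarith)
    (by push_cast; linarith), wrap]
  push_cast; ring

/-- The translation by `-13 m`. -/
def sh {n : ℕ} (m : ℤ) (p : Mod n) : Mod n := (p.1 - 13 * m, p.2)

lemma sh_eq {n : ℕ} (m : ℤ) (p : Mod n) : sh m p = p + (-(13 * (m : ℝ)), 0) := by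
  simp [sh, Prod.ext_iff, sub_eq_add_neg]

lemma contDiff_sh {n : ℕ} (m : ℤ) : ContDiff ℝ ∞ (sh (n := n) m) :=
  (contDiff_fst.sub contDiff_const).prodMk contDiff_snd

def per {n : ℕ} {F : Type*} (f : Mod n → F) (p : Mod n) : F := f (wrap p.1, p.2)

lemma per_sh {n : ℕ} {F : Type*} (f : Mod n → F) (m : ℤ) (p : Mod n) : per f (sh m p) = per f p := by
  rw [per, per, sh, wrap_sub]

/-- Matching on the overlap extends the agreement to [-4, 11], a neighbourhood of the fundamental
interval, so smoothness passes to the periodic extension. -/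
lemma per_eq {n : ℕ} {F : Type*} {f : Mod n → F}
    (hf : ∀ h s, 9 ≤ h → h ≤ 11 → f (h, s) = f (h - 13, s)) {p : Mod n}
    (h1 : -4 ≤ p.1) (h2 : p.1 ≤ 11) : per f p = f p := by
  rcases lt_or_ge p.1 (-3) with h3 | h3
  · have e : wrap p.1 = p.1 + 13 := by
      rw [wrap_eq (m := -1)] <;> push_cast <;> linarith
    rw [per, e, hf _ _ (by linarith) (by linarith), add_sub_cancel_right]
  rcases lt_or_ge p.1 10 with h4 | h4
  · have e : wrap p.1 = p.1 := by
      rw [wrap_eq (m := 0)] <;> push_cast <;> linarith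
    rw [per, e]
  · have e : wrap p.1 = p.1 - 13 := by
      rw [wrap_eq (m := 1)] <;> push_cast <;> linarith
    rw [per, e, ← hf _ _ (by linarith) (by linarith)]

lemma exists_sh {n : ℕ} (p : Mod n) : ∃ m : ℤ, -3 ≤ (sh m p).1 ∧ (sh m p).1 < 10 :=
  ⟨⌊(p.1 + 3) / 13⌋, wrap_mem p.1⟩

namespace Tube
open Par
variable {n : ℕ} {P : Par} (Q : Tube n P)

/-- The periodic extension of `Th`. -/
def Thp (p : Mod n) : ℝ := per Q.Th p
/-- The periodic extension of the field. -/
def Yp (mu : ℝ) (p : Mod n) : Mod n := per (Q.Y mu) p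

variable {Q}

lemma Thp_sh (m : ℤ) (p : Mod n) : Q.Thp (sh m p) = Q.Thp p := per_sh _ _ _
lemma Yp_sh (mu : ℝ) (m : ℤ) (p : Mod n) : Q.Yp mu (sh m p) = Q.Yp mu p := per_sh _ _ _

lemma Thp_eq {p : Mod n} (h1 : -4 ≤ p.1) (h2 : p.1 ≤ 11) : Q.Thp p = Q.Th p :=
  per_eq (fun _ s => Th_seam s) h1 h2
lemma Yp_eq {mu : ℝ} {p : Mod n} (h1 : -4 ≤ p.1) (h2 : p.1 ≤ 11) : Q.Yp mu p = Q.Y mu p :=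
  per_eq (fun _ s => Y_seam s) h1 h2

lemma eventually_window {p : Mod n} {m : ℤ} (h1 : -3 ≤ (sh m p).1) (h2 : (sh m p).1 < 10) :
    ∀ᶠ q in 𝓝 p, -4 ≤ (sh m q).1 ∧ (sh m q).1 ≤ 11 := by
  have hc : Continuous (fun q : Mod n => (sh m q).1) := (contDiff_sh m).continuous.fst
  filter_upwards [hc.continuousAt.eventually_const_lt (show -4 < (sh m p).1 by linarith),
    hc.continuousAt.eventually_lt_const (show (sh m p).1 < 11 by linarith)] with q a b
  exact ⟨a.le, b.le⟩

lemma contDiff_Thp : ContDiff ℝ ∞ Q.Thp := by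
  rw [contDiff_iff_contDiffAt]
  intro p
  obtain ⟨m, h1, h2⟩ := exists_sh p
  refine ((contDiff_Th (Q := Q)).comp (contDiff_sh m)).contDiffAt.congr_of_eventuallyEq ?_
  filter_upwards [eventually_window h1 h2] with q hq
  rw [← Thp_sh m q, Thp_eq hq.1 hq.2]; rfl

lemma contDiff_Yp : ContDiff ℝ ∞ (fun y : ℝ × Mod n => Q.Yp y.1 y.2) := by
  rw [contDiff_iff_contDiffAt]
  rintro ⟨mu, p⟩
  obtain ⟨m, h1, h2⟩ := exists_sh p
  have hs : ContDiff ℝ ∞ (fun y : ℝ × Mod n => (y.1, sh m y.2)) :=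
    contDiff_fst.prodMk ((contDiff_sh m).comp contDiff_snd)
  refine ((contDiff_Y (Q := Q)).comp hs).contDiffAt.congr_of_eventuallyEq ?_
  have hc : Tendsto (fun y : ℝ × Mod n => y.2) (𝓝 (mu, p)) (𝓝 p) := continuous_snd.tendsto _
  filter_upwards [hc.eventually (eventually_window h1 h2)] with y hy
  rw [← Yp_sh y.1 m y.2, Yp_eq hy.1 hy.2]; rfl

lemma contDiff_Yp' (mu : ℝ) : ContDiff ℝ ∞ (Q.Yp mu) :=
  ContDiff.comp (g := fun y : ℝ × Mod n => Q.Yp y.1 y.2) (f := fun p : Mod n => (mu, p))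
    contDiff_Yp (contDiff_const.prodMk contDiff_id)

lemma Yp_zero_of_norm : ∃ B : ℝ, (∀ p : Mod n, 0 < Q.Thp p → ‖p.2‖ ≤ B) ∧
    ∀ (mu : ℝ) (p : Mod n), B < ‖p.2‖ → Q.Yp mu p = 0 := by
  obtain ⟨B, hB⟩ := exists_bound Q
  refine ⟨B, fun p hp => ?_, fun mu p hp => ?_⟩
  · exact hB (wrap p.1, p.2) (by have := wrap_mem p.1; simp only; linarith) hp
  · have h0 : Q.Th (wrap p.1, p.2) ≤ 0 := by
      by_contra hc
      have := hB (wrap p.1, p.2) (by have := wrap_mem p.1; simp only; linarith) (not_le.1 hc)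
      simp only at this
      linarith
    show Q.Y mu (wrap p.1, p.2) = 0
    rw [Y, kap_zero (by linarith), zero_smul]

lemma fderiv_Yp_sh (mu : ℝ) (m : ℤ) (p : Mod n) :
    fderiv ℝ (Q.Yp mu) (sh m p) = fderiv ℝ (Q.Yp mu) p := by
  have e : Q.Yp mu = fun q => Q.Yp mu (q + (-(13 * (m : ℝ)), 0)) := by
    funext q; rw [← sh_eq, Yp_sh]
  conv_rhs => rw [e, fderiv_comp_add_right, ← sh_eq]

/-- A continuous periodic function that vanishes for large `‖p.2‖` is bounded. -/
lemma exists_bound_of_per {F : Type*} [NormedAddCommGroup F] {f : Mod n → F} (hf : Continuous f)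
    (hp : ∀ m p, f (sh m p) = f p) {B : ℝ} (h0 : ∀ p, B < ‖p.2‖ → f p = 0) :
    ∃ L : NNReal, ∀ p, ‖f p‖ ≤ L := by
  have hc : IsCompact (Icc (-3 : ℝ) 10 ×ˢ Metric.closedBall (0 : Sec n) B) :=
    isCompact_Icc.prod (isCompact_closedBall _ _)
  obtain ⟨L, hL⟩ := hc.exists_bound_of_continuousOn hf.continuousOn
  refine ⟨L.toNNReal, fun p => ?_⟩
  rcases le_or_gt ‖p.2‖ B with h | h
  · obtain ⟨m, h1, h2⟩ := exists_sh p
    rw [← hp m p]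
    exact (hL _ ⟨⟨h1, h2.le⟩, by simpa [sh] using h⟩).trans (Real.le_coe_toNNReal L)
  · rw [h0 p h, norm_zero]; positivity

/-- Periodicity and vanishing for large fibre coordinates bound the field and its derivative. -/
lemma exists_orbit (mu : ℝ) : ∃ K : NNReal, LipschitzWith K (Q.Yp mu) ∧
    ∀ p : Mod n, ∃ γ : ℝ → Mod n, γ 0 = p ∧ ∀ t, HasDerivAt γ (Q.Yp mu (γ t)) t := by
  obtain ⟨B, -, hB⟩ := Yp_zero_of_norm (Q := Q)
  obtain ⟨L, hL⟩ := exists_bound_of_per (contDiff_Yp' (Q := Q) mu).continuous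
    (fun m p => Yp_sh mu m p) (hB mu)
  obtain ⟨K, hK⟩ := exists_bound_of_per ((contDiff_Yp' (Q := Q) mu).continuous_fderiv (by simp))
    (fun m p => fderiv_Yp_sh mu m p) (B := B) (fun p hp => by
      have : Q.Yp mu =ᶠ[𝓝 p] fun _ => 0 := by
        have hc : Continuous fun q : Mod n => ‖q.2‖ := continuous_snd.norm
        filter_upwards [hc.continuousAt.eventually_const_lt hp] with q hq
        exact hB mu q hq
      rw [this.fderiv_eq, fderiv_fun_const]; rfl)
  have hlip : LipschitzWith K (Q.Yp mu) :=
    lipschitzWith_of_nnnorm_fderiv_le ((contDiff_Yp' mu).differentiable (by simp))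
      (fun p => by exact_mod_cast hK p)
  exact ⟨K, hlip, exists_global_solution hlip hL⟩

/-! ### Trapping -/

lemma Thp_le_one (p : Mod n) : Q.Thp p ≤ 1 := by
  show Q.Th (wrap p.1, p.2) ≤ 1
  have h1 := ThB_le_one (P := P) (wrap p.1, p.2)
  have h2 := ThT_le_one (Q := Q) (wrap p.1, p.2)
  have s0 := stp_nonneg 6 7 (wrap p.1)
  have s1 := stp_le_one 6 7 (wrap p.1)
  unfold Th
  nlinarith

/-- The field in the region, in the window. -/
lemma Yp_eq_X {mu : ℝ} {p : Mod n} (h1 : -4 ≤ p.1) (h2 : p.1 ≤ 11) (H : 1 / 4 ≤ Q.Thp p) :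
    Q.Yp mu p = Q.X mu p := by
  rw [Yp_eq h1 h2, Y, kap_one (by rwa [← Thp_eq h1 h2]), one_smul]

lemma fderiv_Thp {mu : ℝ} (hg : P.Good mu) {p : Mod n} (h0 : 1 / 4 ≤ Q.Thp p)
    (h1 : Q.Thp p < 1) : 0 < fderiv ℝ Q.Thp p (Q.Yp mu p) := by
  obtain ⟨m, a, b⟩ := exists_sh p
  have e1 : Q.Thp = fun q => Q.Thp (q + (-(13 * (m : ℝ)), 0)) := by
    funext q; rw [← sh_eq, Thp_sh]
  have e2 : fderiv ℝ Q.Thp p = fderiv ℝ Q.Th (sh m p) := by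
    conv_lhs => rw [e1, fderiv_comp_add_right, ← sh_eq]
    refine EventuallyEq.fderiv_eq ?_
    have := eventually_window (p := sh m p) (m := 0) (by simpa [sh] using a) (by simpa [sh] using b)
    filter_upwards [this] with q hq
    have e0 : sh 0 q = q := by simp [sh]
    rw [e0] at hq
    exact Thp_eq hq.1 hq.2
  rw [← Thp_sh m p] at h0 h1
  rw [e2, ← Yp_sh mu m p, Yp_eq_X (by linarith) (by linarith) h0]
  rw [Thp_eq (by linarith) (by linarith)] at h0 h1
  exact fderiv_Th hg (by linarith) h1

/-- The region `1/2 < Thp` is forward invariant. -/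
lemma trapping {mu : ℝ} (hg : P.Good mu) {γ : ℝ → Mod n} {a : ℝ}
    (hγ : ∀ t, a ≤ t → HasDerivAt γ (Q.Yp mu (γ t)) t) (h0 : 1 / 2 < Q.Thp (γ a)) :
    ∀ t, a ≤ t → 1 / 2 < Q.Thp (γ t) := by
  have hd : ∀ t, a ≤ t → HasDerivAt (fun t => Q.Thp (γ t)) (fderiv ℝ Q.Thp (γ t) (Q.Yp mu (γ t))) t :=
    fun t ht => HasFDerivAt.comp_hasDerivAt t
      (((contDiff_Thp (Q := Q)).differentiable (by simp) _).hasFDerivAt) (hγ t ht)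
  -- A level strictly between 1/2 and the initial value, hence below 1, where the derivative along
  -- the flow is strictly positive.
  set c : ℝ := (1 / 2 + Q.Thp (γ a)) / 2 with hc
  have hc1 : 1 / 2 < c := by linarith
  have hcle : c < Q.Thp (γ a) := by linarith
  have := Thp_le_one (Q := Q) (γ a)
  intro t ht
  have key : ∀ s ∈ Icc a t, c ≤ Q.Thp (γ s) := by
    have h := image_le_of_deriv_right_lt_deriv_boundary' (f := fun s => -Q.Thp (γ s))
      (f' := fun s => -fderiv ℝ Q.Thp (γ s) (Q.Yp mu (γ s))) (a := a) (b := t)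
      (fun s hs => (hd s hs.1).continuousAt.neg.continuousWithinAt)
      (fun s hs => (hd s hs.1).neg.hasDerivWithinAt) (B := fun _ => -c) (B' := fun _ => 0)
      (by linarith) continuousOn_const (fun s _ => hasDerivWithinAt_const _ _ _) (by
        intro s hs he
        have he' : Q.Thp (γ s) = c := by linarith
        have := fderiv_Thp (Q := Q) hg (p := γ s) (by linarith) (by linarith)
        linarith)
    intro s hs
    have h' : -Q.Thp (γ s) ≤ -c := h hs
    linarith
  have := key t ⟨ht, le_rfl⟩
  linarith

end Tube

/-! ### Orbits in the block -/

/-- The first time at which a continuous function reaches a lower level. -/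
lemma exists_first_hit {f : ℝ → ℝ} {b c : ℝ} (hf : ContinuousOn f (Icc 0 b)) (hb : 0 ≤ b)
    (h0 : c < f 0) (h1 : f b ≤ c) : ∃ t ∈ Ioc 0 b, f t = c ∧ ∀ s ∈ Ico 0 t, c < f s := by
  have hcl : IsClosed {t ∈ Icc 0 b | f t ≤ c} := by
    have h := hf.preimage_isClosed_of_isClosed isClosed_Icc (isClosed_Iic (a := c))
    have e : {t ∈ Icc 0 b | f t ≤ c} = Icc 0 b ∩ f ⁻¹' Iic c := by ext; rfl
    rwa [e]
  have hcp : IsCompact {t ∈ Icc 0 b | f t ≤ c} :=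
    isCompact_Icc.of_isClosed_subset hcl (fun t ht => ht.1)
  obtain ⟨t, ht, hmin⟩ := hcp.exists_isMinOn ⟨b, ⟨hb, le_rfl⟩, h1⟩ continuousOn_id
  have hlt : ∀ s ∈ Ico 0 t, c < f s := by
    intro s hs
    by_contra hc
    have : t ≤ s := hmin (show s ∈ {t ∈ Icc 0 b | f t ≤ c} from
      ⟨⟨hs.1, hs.2.le.trans ht.1.2⟩, not_lt.1 hc⟩)
    linarith [hs.2]
  have ht0 : 0 < t := by
    rcases ht.1.1.eq_or_lt with h | h
    · rw [← h] at ht; linarith [ht.2]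
    · exact h
  refine ⟨t, ⟨ht0, ht.1.2⟩, le_antisymm ht.2 ?_, hlt⟩
  by_contra hc
  push Not at hc
  obtain ⟨s, hs, hsc⟩ := intermediate_value_Ioo' ht0.le (hf.mono (Icc_subset_Icc_right ht.1.2))
    (show (f t + c) / 2 ∈ Ioo (f t) (f 0) by constructor <;> linarith)
  have := hlt s ⟨hs.1.le, hs.2⟩
  linarith

lemma eq_of_hasDerivAt_zero {X : Type*} [NormedAddCommGroup X] [NormedSpace ℝ X] {f : ℝ → X} {b : ℝ}
    (hf : ∀ t ∈ Icc 0 b, HasDerivAt f 0 t) : ∀ t ∈ Icc 0 b, f t = f 0 :=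
  constant_of_has_deriv_right_zero (fun t ht => (hf t ht).continuousAt.continuousWithinAt)
    (fun t ht => (hf t (Ico_subset_Icc_self ht)).hasDerivWithinAt)

/-! ### Growth and conserved quantities along orbits in the block -/

namespace Par
variable {P : Par} {n : ℕ} {mu b : ℝ} {γ : ℝ → Mod n}

/-- The exponential rate at which `T` grows. -/
def rate (P : Par) (mu : ℝ) : ℝ := P.sig * min mu 1

lemma rate_pos (hmu : P.Adm mu) : 0 < P.rate mu := mul_pos P.sig_pos (lt_min hmu.1 one_pos)

/-- Derivatives are needed on the open interval only, so the bound also covers forward orbits that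
have just a one-sided derivative at time 0. -/
lemma T_growth (hmu : P.Adm mu) (hc : ContinuousOn γ (Icc 0 b))
    (hγ : ∀ t ∈ Ioo 0 b, HasDerivAt γ (P.XB mu (γ t)) t) (hV : ∀ t ∈ Ioo 0 b, 0 < P.ThB (γ t)) :
    ∀ t ∈ Icc 0 b, P.T (γ 0).1 (xx (γ 0)) * Real.exp (P.rate mu * t)
      ≤ P.T (γ t).1 (xx (γ t)) := by
  set f : ℝ → ℝ := fun t => P.T (γ t).1 (xx (γ t)) * Real.exp (-(P.rate mu * t)) with hf
  have hd : ∀ t ∈ Ioo 0 b, HasDerivAt f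
      (P.T (γ t).1 (xx (γ t)) * Real.exp (-(P.rate mu * t)) *
        (2 * P.sig * P.gr mu (γ t).1 (xx (γ t)) - P.rate mu)) t := by
    intro t ht
    have h1 := hasDerivAt_T (h := fun s => (γ s).1) (x := fun s => xx (γ s)) (curve_h (hγ t ht)) (curve_x (hγ t ht))
    have h2 : HasDerivAt (fun t : ℝ => Real.exp (-(P.rate mu * t)))
        (Real.exp (-(P.rate mu * t)) * -(P.rate mu)) t := by
      have := ((hasDerivAt_id t).const_mul (P.rate mu)).neg.exp
      simpa using this
    refine (h1.mul h2).congr_deriv ?_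
    ring
  have hmono : MonotoneOn f (Icc 0 b) := by
    refine monotoneOn_of_deriv_nonneg (convex_Icc 0 b) ?_ ?_ ?_
    · exact ((contDiff_T (P := P) (n := n)).continuous.comp_continuousOn hc).mul
        (by fun_prop)
    · rw [interior_Icc]
      exact fun t ht => (hd t ht).differentiableAt.differentiableWithinAt
    · rw [interior_Icc]
      intro t ht
      rw [(hd t ht).deriv]
      have h1 := (inV_iff.2 (hV t ht)).gr_ge hmu
      have h2 := mul_le_mul_of_nonneg_left h1 P.sig_pos.le
      refine mul_nonneg (mul_nonneg (P.T_nonneg (xx_nonneg _)) (Real.exp_pos _).le) ?_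
      unfold rate; linarith
  intro t ht
  have h := hmono ⟨le_rfl, ht.1.trans ht.2⟩ ht ht.1
  simp only [hf, mul_zero, neg_zero, Real.exp_zero, mul_one] at h
  rwa [Real.exp_neg, ← div_eq_mul_inv, le_div_iff₀ (Real.exp_pos _)] at h

/-- The weight with which the stable coordinates are conserved. -/
def pw (P : Par) (x : ℝ) : ℝ :=
  powStp (P.R1 ^ 2) (P.R2 ^ 2) (-(2 * P.sig / P.eta * Real.log P.bet)) (P.eta / (2 * P.sig)) x

lemma pw_one {x : ℝ} (hx : P.R2 ^ 2 ≤ x) : P.pw x = 1 := powStp_of_ge sq12 _ hx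

lemma hasDerivAt_pw {x : ℝ} (hx : x ≠ 0) :
    HasDerivAt P.pw (P.eta / (2 * P.sig) * P.d x / x * P.pw x) x :=
  hasDerivAt_powStp _ _ _ _ hx

lemma pw_top {y : ℝ} (hy0 : 0 < y) (hy : y ≤ P.R) : P.pw (y ^ 2) = P.bet * y ^ (P.eta / P.sig) := by
  have hx : y ^ 2 ≤ P.R1 ^ 2 := pow_le_pow_left₀ hy0.le (by have := P.R_ge; unfold R1; linarith) 2
  rw [pw, powStp_of_le P.sq12 _ hx, Real.rpow_def_of_pos hy0]
  have e : P.eta / (2 * P.sig) * (Real.log (y ^ 2) - -(2 * P.sig / P.eta * Real.log P.bet))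
      = Real.log P.bet + Real.log y * (P.eta / P.sig) := by
    have := P.sig_pos.ne'
    have := P.eta_pos.ne'
    rw [Real.log_pow]; push_cast; field_simp; ring
  rw [e, Real.exp_add, Real.exp_log P.bet_pos]

/-- The quantities that are conserved along an orbit in the block with `z ≠ 0`. -/
lemma conserved (hmu : P.Adm mu) (hγ : ∀ t ∈ Icc 0 b, HasDerivAt γ (P.XB mu (γ t)) t)
    (hV : ∀ t ∈ Icc 0 b, 0 < P.ThB (γ t)) (hz : (γ 0).2.1 ≠ 0) : ∀ t ∈ Icc 0 b,
    (γ t).2.1 ≠ 0 ∧ uu (γ t).2.1 = uu (γ 0).2.1 ∧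
    P.pw (xx (γ t)) • (γ t).2.2 = P.pw (xx (γ 0)) • (γ 0).2.2 ∧
    P.Iq mu (γ t).1 (xx (γ t)) = P.Iq mu (γ 0).1 (xx (γ 0)) := by
  have hT := T_growth hmu (fun t ht => (hγ t ht).continuousAt.continuousWithinAt)
    (fun t ht => hγ t (Ioo_subset_Icc_self ht)) (fun t ht => hV t (Ioo_subset_Icc_self ht))
  have hx : ∀ t ∈ Icc 0 b, 0 < xx (γ t) := by
    intro t ht
    have h1 := hT t ht
    have h2 : 0 < P.T (γ 0).1 (xx (γ 0)) * Real.exp (P.rate mu * t) :=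
      mul_pos (T_pos (xx_pos hz)) (Real.exp_pos _)
    rcases (xx_nonneg (γ t)).eq_or_lt with h | h
    · rw [← h, T_zero] at h1; linarith
    · exact h
  have hne : ∀ t ∈ Icc 0 b, (γ t).2.1 ≠ 0 := by
    intro t ht h0
    have := hx t ht
    simp [xx, h0] at this
  have d2 : ∀ t ∈ Icc 0 b, HasDerivAt (fun s => (γ s).2) (P.XB mu (γ t)).2 t :=
    fun t ht => (hγ t ht).snd
  have dz : ∀ t ∈ Icc 0 b, HasDerivAt (fun s => (γ s).2.1)
      (P.fz mu (γ t).1 (xx (γ t)) • (γ t).2.1) t := fun t ht => (d2 t ht).fst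
  have dw : ∀ t ∈ Icc 0 b, HasDerivAt (fun s => (γ s).2.2)
      (P.fw mu (γ t).1 (xx (γ t)) • (γ t).2.2) t := fun t ht => (d2 t ht).snd
  -- z' is a real multiple of z, so z/|z| is constant; |z|⁻¹ is written as exp(-(log x)/2) for
  -- differentiation.
  have c1 := eq_of_hasDerivAt_zero (b := b)
    (f := fun t => Real.exp (-(1 / 2 * Real.log (xx (γ t)))) • (γ t).2.1) (by
      intro t ht
      have h1 := (((curve_x (hγ t ht)).log (hx t ht).ne').const_mul (1 / 2)).neg.exp
      refine (h1.smul (dz t ht)).congr_deriv ?_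
      rw [smul_smul, ← add_smul]
      have := (hx t ht).ne'
      convert zero_smul ℝ _ using 2
      field_simp
      ring)
  have c2 := eq_of_hasDerivAt_zero (b := b) (f := fun t => P.pw (xx (γ t)) • (γ t).2.2) (by
      intro t ht
      have hx0 := (hx t ht).ne'
      have h1 := HasDerivAt.comp (h := fun s => xx (γ s)) t (hasDerivAt_pw (P := P) hx0)
        (curve_x (hγ t ht))
      refine (h1.smul (dw t ht)).congr_deriv ?_
      rw [smul_smul, ← add_smul]
      convert zero_smul ℝ _ using 2
      -- The fibre contraction is over before the bending begins.
      have hdc : P.d (xx (γ t)) * P.ch (γ t).1 (xx (γ t)) = 0 := by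
        rcases le_or_gt 0 (P.tt (γ t).1 (xx (γ t))) with h | h
        · rw [(inV_iff.2 (hV t ht)).d_eq_zero h, zero_mul]
        · rw [ch_of_nonpos h.le, mul_zero]
      have hs := P.sig_pos.ne'
      rw [fz, fw]
      generalize P.ch (γ t).1 (xx (γ t)) = a at *
      generalize P.d (xx (γ t)) = a' at *
      simp only [Function.comp_apply]
      field_simp
      linear_combination (-(P.pw (xx (γ t)) * P.eta)) * hdc)
  have c3 := eq_of_hasDerivAt_zero (b := b) (f := fun t => P.Iq mu (γ t).1 (xx (γ t))) (by
      intro t ht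
      have h1 := hasDerivAt_Iq (h := fun s => (γ s).1) (x := fun s => xx (γ s))
        (W := fun s => ww (γ s)) mu (curve_h (hγ t ht)) (curve_x (hγ t ht))
        (inV_iff.2 (hV t ht)) (hx t ht)
      exact h1.congr_deriv (by ring))
  intro t ht
  refine ⟨hne t ht, ?_, c2 t ht, c3 t ht⟩
  have e : ∀ {z : ℂ}, z ≠ 0 → Real.exp (-(1 / 2 * Real.log (‖z‖ ^ 2))) • z = uu z := by
    intro z hz
    have h1 : Real.exp (-(1 / 2 * Real.log (‖z‖ ^ 2))) = ‖z‖⁻¹ := by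
      rw [Real.exp_neg, Real.log_pow]
      push_cast
      rw [← mul_assoc, one_div_mul_cancel (by norm_num : (2 : ℝ) ≠ 0), one_mul,
        Real.exp_log (norm_pos_iff.2 hz)]
    rw [h1, uu, Complex.real_smul]
  have := c1 t ht
  simp only [xx] at this
  rwa [e (hne t ht), e hz] at this

end Par

/-! ### Forward orbits in the region -/

namespace Tube
open Par
variable {n : ℕ} {P : Par} {Q : Tube n P} {mu : ℝ} {γ : ℝ → Mod n}

variable (Q) in
/-- A solution whose forward part stays in the region. -/
structure Orb (mu : ℝ) (γ : ℝ → Mod n) : Prop where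
  deriv : ∀ t, HasDerivAt γ (Q.Yp mu (γ t)) t
  inU : ∀ t, 0 ≤ t → 1 / 2 < Q.Thp (γ t)

lemma exists_orb (hg : P.Good mu) {p : Mod n} (hp : 1 / 2 < Q.Thp p) :
    ∃ γ, γ 0 = p ∧ Q.Orb mu γ := by
  obtain ⟨K, -, h⟩ := Q.exists_orbit mu
  obtain ⟨γ, h0, hd⟩ := h p
  exact ⟨γ, h0, hd, trapping hg (fun t _ => hd t) (by rwa [h0])⟩

namespace Orb

lemma shift (H : Q.Orb mu γ) {a : ℝ} (ha : 0 ≤ a) : Q.Orb mu (fun t => γ (t + a)) :=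
  ⟨fun t => HasDerivAt.comp_add_const t a (H.deriv (t + a)), fun t ht => H.inU _ (by linarith)⟩

lemma sh (H : Q.Orb mu γ) (m : ℤ) : Q.Orb mu (fun t => sh m (γ t)) := by
  refine ⟨fun t => ?_, fun t ht => ?_⟩
  · simp only [Yp_sh]
    have h := (H.deriv t).add_const ((-(13 * (m : ℝ)), 0) : Mod n)
    simpa only [sh_eq] using h
  · rw [Thp_sh]; exact H.inU t ht

lemma continuous (H : Q.Orb mu γ) : Continuous γ :=
  continuous_iff_continuousAt.2 fun t => (H.deriv t).continuousAt

lemma block (H : Q.Orb mu γ) {t : ℝ} (ht : 0 ≤ t) (h1 : -4 ≤ (γ t).1) (h2 : (γ t).1 ≤ 8) :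
    HasDerivAt γ (P.XB mu (γ t)) t ∧ 0 < P.ThB (γ t) := by
  have hU := H.inU t ht
  have hd := H.deriv t
  rw [Yp_eq_X h1 (by linarith) (by linarith)] at hd
  rw [Thp_eq h1 (by linarith)] at hU
  rw [X_block h2 (by linarith)] at hd
  exact ⟨hd, ThB_pos' h2 (by linarith)⟩

/-- The height does not increase above `0`. -/
lemma h_le (hg : P.Good mu) (H : Q.Orb mu γ) (h7 : (γ 0).1 ≤ 7) {t : ℝ} (ht : 0 ≤ t) :
    (γ t).1 ≤ max (γ 0).1 0 := by
  have hd : ∀ s, HasDerivAt (fun s => (γ s).1) (Q.Yp mu (γ s)).1 s := fun s => (H.deriv s).fst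
  have hM : max (γ 0).1 0 ≤ 7 := max_le h7 (by norm_num)
  refine le_of_forall_pos_le_add fun e he => ?_
  -- A barrier line of positive slope that stays below height 8 up to time t; at a contact point the
  -- height is nonnegative, hence not increasing.
  set ε := min e 1 / (t + 1) with hε
  have he1 : 0 < min e 1 := lt_min he one_pos
  have hεp : 0 < ε := div_pos he1 (by linarith)
  have hεt : ε * (t + 1) = min e 1 := div_mul_cancel₀ _ (by linarith)
  have key := image_le_of_deriv_right_lt_deriv_boundary' (f := fun s => (γ s).1)
    (f' := fun s => (Q.Yp mu (γ s)).1) (a := 0) (b := t)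
    (fun s _ => (hd s).continuousAt.continuousWithinAt) (fun s _ => (hd s).hasDerivWithinAt)
    (B := fun s => max (γ 0).1 0 + ε * (s + 1)) (B' := fun _ => ε)
    (by have := le_max_left (γ 0).1 0; linarith)
    (by fun_prop) (fun s _ => by
      have : HasDerivAt (fun s : ℝ => max (γ 0).1 0 + ε * (s + 1)) (ε * 1) s :=
        (((hasDerivAt_id s).add_const 1).const_mul ε).const_add _
      rw [mul_one] at this
      exact this.hasDerivWithinAt) (by
      intro s hs he'
      have h0 : ε * (s + 1) ≤ ε * (t + 1) := mul_le_mul_of_nonneg_left (by linarith [hs.2]) hεp.le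
      have h1 := min_le_right e 1
      have h2 : 0 ≤ ε * (s + 1) := mul_nonneg hεp.le (by linarith [hs.1])
      have h3 := le_max_right (γ 0).1 0
      have h4 : 0 ≤ (γ s).1 := by linarith
      have h5 : (γ s).1 ≤ 8 := by linarith
      have h6 := (curve_h (H.block hs.1 (by linarith) h5).1).unique (hd s)
      have h7 := fh_nonpos hg.1 (xx (γ s)) h4
      linarith)
  have h := key (show t ∈ Icc 0 t from ⟨ht, le_rfl⟩)
  have := min_le_left e 1
  linarith

/-- Strict version of `h_le` for orbits that start below a high level. -/
lemma h_lt_four (hg : P.Good mu) (H : Q.Orb mu γ) (h4 : (γ 0).1 ≤ 4) {t : ℝ} (ht : 0 < t) :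
    (γ t).1 < 4 := by
  rcases h4.eq_or_lt with h0 | h0
  -- From height exactly 4 the orbit drops at once with speed 1, and `h_le` controls it afterwards.
  · have hb := H.block le_rfl (by linarith) (by linarith)
    have hd : HasDerivAt (fun s => (γ s).1) (-1) 0 := by
      have := hb.1
      rw [XB_of_three_le hb.2 (by linarith)] at this
      exact this.fst
    have hev : ∀ᶠ s in 𝓝[>] (0 : ℝ), (γ s).1 < 4 := by
      have h1 := hd.tendsto_slope.mono_left (nhdsWithin_mono (0 : ℝ) (fun s (hs : 0 < s) => hs.ne'))
      filter_upwards [h1.eventually_lt_const (show (-1 : ℝ) < 0 by norm_num),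
        self_mem_nhdsWithin] with s hs hs0
      rw [slope_def_field, div_lt_iff₀ (by simpa using hs0)] at hs
      linarith
    obtain ⟨s, hs4, hs0, hst⟩ := (hev.and (Ioo_mem_nhdsGT ht)).exists
    have h1 := (H.shift hs0.le).h_le hg (by simp only [zero_add]; linarith)
      (show 0 ≤ t - s by linarith)
    simp only [zero_add, sub_add_cancel] at h1
    exact h1.trans_lt (max_lt hs4 (by norm_num))
  · exact (H.h_le hg (by linarith) ht.le).trans_lt (max_lt h0 (by norm_num))

/-- In the region, `T` is bounded over the block. -/
lemma _root_.WildLorenz.Tube.exists_T_bound (Q : Tube n P) : ∃ M : ℝ, ∀ p : Mod n, 0 < Q.Thp p →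
    -4 ≤ p.1 → P.T p.1 (xx p) ≤ M := by
  obtain ⟨B, hB, -⟩ := Yp_zero_of_norm (Q := Q)
  refine ⟨B ^ 2 * Real.exp (8 * P.sig), fun p hp h4 => ?_⟩
  have h1 : ‖p.2.1‖ ≤ B := (norm_fst_le p.2).trans (hB p hp)
  have h2 : xx p ≤ B ^ 2 := pow_le_pow_left₀ (norm_nonneg _) h1 2
  have h3 : Real.exp (-(2 * P.sig * p.1)) ≤ Real.exp (8 * P.sig) :=
    Real.exp_le_exp.2 (by have := P.sig_pos; nlinarith)
  exact mul_le_mul h2 h3 (Real.exp_pos _).le (sq_nonneg B)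

/-- An orbit with `z ≠ 0` leaves the block. -/
lemma reach (hg : P.Good mu) (H : Q.Orb mu γ) (h3 : -3 ≤ (γ 0).1) (h7 : (γ 0).1 ≤ 7)
    (hz : (γ 0).2.1 ≠ 0) : ∃ t, 0 < t ∧ (γ t).1 = -4 ∧ ∀ s ∈ Ico 0 t, -4 < (γ s).1 := by
  have h8 : ∀ t, 0 ≤ t → (γ t).1 ≤ 8 := fun t ht =>
    (H.h_le hg h7 ht).trans (max_le (by linarith) (by norm_num))
  -- Otherwise the orbit stays over the block for ever, where T grows exponentially although
  -- `exists_T_bound` bounds it.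
  have hex : ∃ b, 0 ≤ b ∧ (γ b).1 ≤ -4 := by
    by_contra hc
    push Not at hc
    obtain ⟨M, hM⟩ := Q.exists_T_bound
    have hT0 : 0 < P.T (γ 0).1 (xx (γ 0)) := T_pos (xx_pos hz)
    have hr := rate_pos hg.1
    have hgrow : ∀ t, 0 ≤ t → P.T (γ 0).1 (xx (γ 0)) * Real.exp (P.rate mu * t) ≤ M := by
      intro t ht
      refine (T_growth hg.1 H.continuous.continuousOn
        (fun s hs => (H.block hs.1.le (hc s hs.1.le).le (h8 s hs.1.le)).1)
        (fun s hs => (H.block hs.1.le (hc s hs.1.le).le (h8 s hs.1.le)).2) t ⟨ht, le_rfl⟩).trans ?_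
      exact hM _ (by linarith [H.inU t ht]) (hc t ht).le
    have hlim : Tendsto (fun t : ℝ => P.T (γ 0).1 (xx (γ 0)) * Real.exp (P.rate mu * t)) atTop
        atTop :=
      (Real.tendsto_exp_atTop.comp (tendsto_id.const_mul_atTop hr)).const_mul_atTop hT0
    obtain ⟨t, ht0, ht⟩ := ((eventually_ge_atTop 0).and (hlim.eventually_gt_atTop M)).exists
    linarith [hgrow t ht0]
  obtain ⟨b, hb, hb4⟩ := hex
  obtain ⟨t, ht, h4, hlt⟩ := exists_first_hit (f := fun s => (γ s).1) (b := b) (c := -4)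
    H.continuous.fst.continuousOn hb (by linarith) hb4
  exact ⟨t, ht.1, h4, hlt⟩

/-- The orbits in the tube are explicit. -/
lemma tube (H : Q.Orb mu γ) (h7 : 7 ≤ (γ 0).1) (h11 : (γ 0).1 ≤ 11) :
    γ 0 ∈ Q.Dom ∧ Q.gq (γ 0) ∈ P.Cpt n ∧
      ∀ t ∈ Icc 0 ((γ 0).1 - 4), γ t = emb P ((γ 0).1 - t) (Q.gq (γ 0)) := by
  have hU0 := H.inU 0 le_rfl
  rw [Thp_eq (by linarith) h11, Th_of_ge h7] at hU0
  obtain ⟨hD, -⟩ := ThT_pos (show 0 < Q.ThT (γ 0) by linarith)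
  refine ⟨hD, gq_mem_Cpt (by linarith), ?_⟩
  set a := (γ 0).1 with ha
  set q := Q.gq (γ 0) with hq
  have hqA : q ∈ P.Ann n := hD.2
  -- `tauT` decreases as the height falls, so the curve given by the isotopy stays where the cutoff
  -- is 1; uniqueness of solutions then identifies it with the orbit.
  have hTh : ∀ h ∈ Icc 3 a, 1 / 4 ≤ Q.Thp (emb P h q) := by
    intro h hh
    rw [Thp_eq (by simp only [emb]; linarith [hh.1]) (by simp only [emb]; linarith [hh.2])]
    have h1 : 1 / 2 < Q.ThT (emb P h q) := by
      rw [← emb_gq hD, ThT_emb hqA] at hU0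
      rw [ThT_emb hqA]
      refine hU0.trans_le (div_le_div_of_nonneg_right (expNegInvGlue.monotone
        (sub_le_sub_left ?_ _)) bump_denom.le)
      refine monotone_of_deriv_nonneg (f := fun h => P.tauT h _ _) (fun x => ?_) (fun x => ?_) hh.2
      · obtain ⟨D, hD, -⟩ := P.hasDerivAt_tauT x ‖q.1‖ (‖q.2.1‖ ^ 2 + ‖q.2.2‖ ^ 2)
        exact hD.differentiableAt
      · obtain ⟨D, hD, h0, -⟩ := P.hasDerivAt_tauT x ‖q.1‖ (‖q.2.1‖ ^ 2 + ‖q.2.2‖ ^ 2)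
        rw [hD.deriv]; exact h0
    rcases le_or_gt 7 h with h7 | h7
    · rw [Th_of_ge (by exact h7)]; linarith
    · have := ThB_of_ThT (Q := Q) (p := emb P h q) (by simp only [emb]; linarith [hh.1])
        (by simp only [emb]; linarith) (by linarith)
      rw [Th, this]
      have s0 := stp_nonneg 6 7 (emb P h q).1
      have s1 := stp_le_one 6 7 (emb P h q).1
      nlinarith
  obtain ⟨K, hK, -⟩ := Q.exists_orbit mu
  have hcd : ∀ t ∈ Icc 0 (a - 3), HasDerivAt (fun t => emb P (a - t) q)
      (Q.Yp mu (emb P (a - t) q)) t := by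
    intro t ht
    have h1 : HasDerivAt (fun t : ℝ => a - t) (-1) t := by
      simpa using (hasDerivAt_id t).const_sub a
    have h2 := HasDerivAt.scomp t (hasDerivAt_emb (Q := Q) hqA (a - t)) h1
    have h3 := hTh (a - t) ⟨by linarith [ht.2], by linarith [ht.1]⟩
    rw [Yp_eq_X (by simp only [emb]; linarith [ht.2]) (by simp only [emb]; linarith [ht.1]) h3,
      X_tube (by simp only [emb]; linarith [ht.2])]
    · refine HasDerivAt.congr_deriv (f := fun t => emb P (a - t) q) h2 ?_
      simp
    · rw [Thp_eq (by simp only [emb]; linarith [ht.2]) (by simp only [emb]; linarith [ht.1])] at h3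
      linarith
  refine ODE_solution_unique (v := fun _ => Q.Yp mu) (K := K) (fun _ => hK)
    H.continuous.continuousOn (fun t _ => (H.deriv t).hasDerivWithinAt)
    (fun t ht => (hcd t ⟨ht.1, by linarith [ht.2]⟩).continuousAt.continuousWithinAt)
    (fun t ht => (hcd t ⟨ht.1, by linarith [ht.2]⟩).hasDerivWithinAt) ?_
  rw [sub_zero, ha, hq, emb_gq hD]

end Orb
end Tube

/-! ### Return to the top of the block -/

/-- f(t) exp(κt) is nonincreasing. -/
lemma tendsto_zero_of_deriv_le {f f' : ℝ → ℝ} {a κ : ℝ} (hκ : 0 < κ)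
    (hd : ∀ t, a ≤ t → HasDerivAt f (f' t) t) (hle : ∀ t, a ≤ t → f' t ≤ -(κ * f t))
    (h0 : ∀ t, a ≤ t → 0 ≤ f t) : Tendsto f atTop (𝓝 0) := by
  set g : ℝ → ℝ := fun t => f t * Real.exp (κ * t) with hg
  have hgd : ∀ t, a ≤ t → HasDerivAt g ((f' t + κ * f t) * Real.exp (κ * t)) t := by
    intro t ht
    have h2 : HasDerivAt (fun t : ℝ => Real.exp (κ * t)) (Real.exp (κ * t) * (κ * 1)) t :=
      ((hasDerivAt_id t).const_mul κ).exp
    exact ((hd t ht).mul h2).congr_deriv (by ring)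
  have hanti : AntitoneOn g (Ici a) := by
    refine antitoneOn_of_deriv_nonpos (convex_Ici a)
      (fun t ht => (hgd t ht).continuousAt.continuousWithinAt)
      (fun t ht => ?_) (fun t ht => ?_) <;> rw [interior_Ici] at ht
    · exact (hgd t (le_of_lt ht)).differentiableAt.differentiableWithinAt
    · rw [(hgd t (le_of_lt ht)).deriv]
      exact mul_nonpos_of_nonpos_of_nonneg (by linarith [hle t (le_of_lt ht)]) (Real.exp_pos _).le
  have hlim : Tendsto (fun t : ℝ => g a * Real.exp (-(κ * t))) atTop (𝓝 0) := by
    have h1 : Tendsto (fun t : ℝ => κ * t) atTop atTop := tendsto_id.const_mul_atTop hκ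
    simpa using (Real.tendsto_exp_neg_atTop_nhds_zero.comp h1).const_mul (g a)
  refine squeeze_zero' ?_ ?_ hlim
  · filter_upwards [eventually_ge_atTop a] with t ht using h0 t ht
  · filter_upwards [eventually_ge_atTop a] with t ht
    have h1 : f t * Real.exp (κ * t) ≤ g a := hanti self_mem_Ici ht ht
    rwa [Real.exp_neg, ← div_eq_mul_inv, le_div_iff₀ (Real.exp_pos _)]

namespace Tube
open Par
variable {n : ℕ} {P : Par} {Q : Tube n P} {mu : ℝ} {γ : ℝ → Mod n}

/-- The section coordinate with which an orbit through `p` leaves the block. -/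
def exitq (P : Par) (mu : ℝ) (p : Mod n) : Sec n :=
  (((1 - P.lam + P.lam / P.cs * P.Iq mu p.1 (xx p) : ℝ) : ℂ) * uu p.2.1, P.pw (xx p) • p.2.2)

namespace Orb

lemma h_le_eight (hg : P.Good mu) (H : Q.Orb mu γ) (h7 : (γ 0).1 ≤ 7) {t : ℝ} (ht : 0 ≤ t) :
    (γ t).1 ≤ 8 :=
  (H.h_le hg h7 ht).trans (max_le (by linarith) (by norm_num))

/-- At height -4 the weights are 1, so the conserved quantities give the section coordinate `exitq`.
One period up this is height 9; the tube brings it to height 4, which is -9 in the original lift. -/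
lemma loop (hg : P.Good mu) (H : Q.Orb mu γ) (h3 : -3 ≤ (γ 0).1) (h7 : (γ 0).1 ≤ 7)
    (hz : (γ 0).2.1 ≠ 0) : exitq P mu (γ 0) ∈ P.Cpt n ∧
    ∃ t, 0 < t ∧ γ t = (-9, iso P.cs P.lam P.sig P.k 1 (exitq P mu (γ 0))) ∧
      ∀ s ∈ Ico 0 t, -9 < (γ s).1 := by
  obtain ⟨t1, ht1, hm4, hgt⟩ := H.reach hg h3 h7 hz
  have hlow : ∀ s ∈ Icc 0 t1, -4 ≤ (γ s).1 := by
    intro s hs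
    rcases hs.2.eq_or_lt with h | h
    · rw [h, hm4]
    · exact (hgt s ⟨hs.1, h⟩).le
  have hb := fun s (hs : s ∈ Icc 0 t1) => H.block hs.1 (hlow s hs) (H.h_le_eight hg h7 hs.1)
  have ht1' : t1 ∈ Icc 0 t1 := ⟨ht1.le, le_rfl⟩
  obtain ⟨c1, c2, c3, c4⟩ := conserved hg.1 (fun s hs => (hb s hs).1) (fun s hs => (hb s hs).2) hz
    t1 ht1'
  have hV := inV_iff.2 (hb t1 ht1').2
  have htt := tt_of_low hV (by linarith)
  have hx : P.R2 ^ 2 ≤ xx (γ t1) := P.sq23.le.trans (hV.sq_le (by linarith))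
  rw [pw_one hx, one_smul] at c3
  rw [hV.Iq_eq (by linarith)] at c4
  have hp : γ t1 = (-4, (γ t1).2) := Prod.ext hm4 rfl
  have hlq : lowq P (-4) (γ t1).2 = exitq P mu (γ 0) := by
    rw [lowq, exitq, ← hp, c2, c3, ← c4, hm4]
  have hTh : 0 < P.ThB (-4, (γ t1).2) := by rw [← hp]; exact (hb t1 ht1').2
  obtain ⟨-, hA, hiso⟩ := lowq_mem (by norm_num) hTh
  rw [hlq] at hA hiso
  set q := exitq P mu (γ 0)
  have H' := (H.shift ht1.le).sh (-1)
  have hst : WildLorenz.sh (-1) (γ (0 + t1)) = emb P 9 q := by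
    rw [zero_add, emb_low le_rfl, hiso, hp, WildLorenz.sh]
    norm_num
  have h9 : (WildLorenz.sh (-1) (γ (0 + t1))).1 = 9 := by rw [hst]; rfl
  obtain ⟨-, hC, htube⟩ := H'.tube (by rw [h9]; norm_num) (by rw [h9]; norm_num)
  rw [hst, (emb_mem hA 9).2] at hC htube
  have hval : ∀ s ∈ Icc (0 : ℝ) 5, γ (s + t1) = ((9 - s) - 13, (emb P (9 - s) q).2) := by
    intro s hs
    have h := htube s (by simp only [emb]; norm_num; exact hs)
    have e1 := congrArg Prod.fst h
    have e2 := congrArg Prod.snd h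
    simp only [WildLorenz.sh, emb] at e1 e2
    refine Prod.ext ?_ ?_
    · simp only; push_cast at e1; linarith
    · exact e2
  refine ⟨hC, 5 + t1, by linarith, ?_, fun s hs => ?_⟩
  · rw [hval 5 ⟨by norm_num, le_rfl⟩, show (9 : ℝ) - 5 = 4 by norm_num, emb_high (by norm_num)]
    norm_num
  · rcases le_or_gt s t1 with h | h
    · linarith [hlow s ⟨hs.1, h⟩]
    · have h2 := hval (s - t1) ⟨by linarith, by linarith [hs.2]⟩
      rw [sub_add_cancel] at h2
      rw [h2]
      have := hs.2
      simp only; linarith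

/-- The first time at which `|z|` reaches the radius `R3`. -/
lemma hit (hg : P.Good mu) (H : Q.Orb mu γ) (h4 : (γ 0).1 = 4)
    (hz : (γ 0).2.1 ≠ 0) (hzR : ‖(γ 0).2.1‖ ≤ P.R) : ∃ t, 0 < t ∧
    γ t = (P.Iq mu (γ 0).1 (xx (γ 0)), (P.R3 : ℂ) * uu (γ 0).2.1, P.pw (xx (γ 0)) • (γ 0).2.2) ∧
      ∀ s ∈ Ico 0 t, ‖(γ s).2.1‖ < P.R3 := by
  obtain ⟨t1, ht1, hm4, hgt⟩ := H.reach hg (by linarith) (by linarith) hz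
  have h7 : (γ 0).1 ≤ 7 := by linarith
  have hlow : ∀ s ∈ Icc 0 t1, -4 ≤ (γ s).1 := by
    intro s hs
    rcases hs.2.eq_or_lt with h | h
    · rw [h, hm4]
    · exact (hgt s ⟨hs.1, h⟩).le
  have hb := fun s (hs : s ∈ Icc 0 t1) => H.block hs.1 (hlow s hs) (H.h_le_eight hg h7 hs.1)
  have ht1' : t1 ∈ Icc 0 t1 := ⟨ht1.le, le_rfl⟩
  have hV1 := inV_iff.2 (hb t1 ht1').2
  have hx1 := hV1.sq_le (by linarith [tt_of_low hV1 (by linarith)])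
  have hR3 := P.R3_pos
  obtain ⟨t, ht, hft, hlt⟩ := exists_first_hit (f := fun s => -xx (γ s)) (b := t1)
    (c := -(P.R3 ^ 2)) ((contDiff_xx.continuous.comp H.continuous).neg.continuousOn) ht1.le (by
      have h1 : P.R < P.R3 := by have := P.R_ge; unfold R3 R2; linarith
      have h2 : xx (γ 0) < P.R3 ^ 2 := pow_lt_pow_left₀ (hzR.trans_lt h1) (norm_nonneg _) (by norm_num)
      linarith) (by linarith)
  have htI : t ∈ Icc 0 t1 := ⟨ht.1.le, ht.2⟩
  have hx : xx (γ t) = P.R3 ^ 2 := by linarith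
  have hn : ‖(γ t).2.1‖ = P.R3 := by
    have : ‖(γ t).2.1‖ ^ 2 = P.R3 ^ 2 := hx
    exact (pow_left_inj₀ (norm_nonneg _) hR3.le (by norm_num)).1 this
  have hV := inV_iff.2 (hb t htI).2
  obtain ⟨c1, c2, c3, c4⟩ := conserved hg.1
    (fun s hs => (hb s ⟨hs.1, hs.2.trans ht.2⟩).1)
    (fun s hs => (hb s ⟨hs.1, hs.2.trans ht.2⟩).2) hz t (show t ∈ Icc 0 t from ⟨ht.1.le, le_rfl⟩)
  have hx2 : P.R2 ^ 2 ≤ xx (γ t) := by rw [hx]; exact P.sq23.le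
  rw [pw_one hx2, one_smul] at c3
  -- On the cylinder `tt` = -1 - h, so active bending would give I0 ≤ -1, below the lower barrier.
  have htt : P.tt (γ t).1 (xx (γ t)) < 0 := by
    by_contra hc
    push Not at hc
    have h1 := ps_le hc
    have h2 := hV.I0_gt'
    have hs := P.sig_pos
    have h3 : P.tt (γ t).1 (xx (γ t)) = -1 - (γ t).1 := by
      rw [tt_eq (by rw [hx]; positivity), hx, Real.log_pow, k]
      push_cast
      field_simp
      ring
    have := P.cs_le_one
    unfold I0 at h2
    linarith
  have hh1 : (γ t).1 < 1 := by
    by_contra hc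
    have := hV.x_lt (not_lt.1 hc)
    have := P.sq12
    linarith
  rw [Iq, ps_of_nonpos htt.le, m_one hx2, eFun_of_le hh1.le, mul_one, add_zero] at c4
  refine ⟨t, ht.1, ?_, fun s hs => ?_⟩
  · refine Prod.ext c4 (Prod.ext ?_ c3)
    show (γ t).2.1 = (P.R3 : ℂ) * uu (γ 0).2.1
    rw [← c2, ← hn, norm_mul_uu c1]
  · have h := hlt s hs
    have h2 : ‖(γ s).2.1‖ ^ 2 < P.R3 ^ 2 := by
      have : xx (γ s) < P.R3 ^ 2 := by linarith
      exact this
    exact lt_of_pow_lt_pow_left₀ 2 hR3.le h2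

/-! ### The local stable manifold -/

/-- z satisfies a linear equation with a coefficient bounded on the compact interval, so Grönwall
applies. -/
lemma z_zero_on (H : Q.Orb mu γ) {b : ℝ} (hb : 0 ≤ b)
    (hB : ∀ s ∈ Icc 0 b, HasDerivAt γ (P.XB mu (γ s)) s) (hz : (γ 0).2.1 = 0) : (γ b).2.1 = 0 := by
  have hc : Continuous (fun s => P.fz mu (γ s).1 (xx (γ s))) := by
    have h1 : Continuous (fun p : Mod n => P.ch p.1 (xx p)) :=
      (contDiff_chi P.k_pos P.sig_pos).continuous.comp contDiff_T.continuous
    have h2 : Continuous (fun p : Mod n => P.b mu p.1) :=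
      (contDiff_gg (by norm_num) (by norm_num) _).continuous.comp continuous_fst
    exact (continuous_const.mul (h2.sub h1)).comp H.continuous
  obtain ⟨K, hK⟩ := isCompact_Icc.exists_bound_of_continuousOn (s := Icc 0 b) hc.continuousOn
  refine eq_zero_of_abs_deriv_le_mul_abs_self_of_eq_zero_right (f := fun s => (γ s).2.1)
    (f' := fun s => P.fz mu (γ s).1 (xx (γ s)) • (γ s).2.1) (K := K) (a := 0) (b := b)
    H.continuous.snd.fst.continuousOn (fun s hs => ?_) hz (fun s hs => ?_) b ⟨hb, le_rfl⟩
  · have h2 : HasDerivAt (fun s => (γ s).2) (P.XB mu (γ s)).2 s := (hB s (Ico_subset_Icc_self hs)).snd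
    have h3 : HasDerivAt (fun s => (γ s).2.1) (P.XB mu (γ s)).2.1 s := h2.fst
    exact h3.hasDerivWithinAt
  · rw [norm_smul]
    exact mul_le_mul_of_nonneg_right (hK s (Ico_subset_Icc_self hs)) (norm_nonneg _)

/-- By `lowq_mem` a point at height -4 has z ≠ 0, so the axis cannot descend that far; with no
bending on the axis, the lower barrier then keeps h above -1. -/
lemma stable_mem (hg : P.Good mu) (H : Q.Orb mu γ) (h1 : -1 < (γ 0).1) (h7 : (γ 0).1 < 7)
    (hz : (γ 0).2.1 = 0) {t : ℝ} (ht : 0 ≤ t) :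
    (γ t).2.1 = 0 ∧ -1 < (γ t).1 ∧ (γ t).1 < 7 := by
  have hup := fun s (hs : 0 ≤ s) => H.h_le_eight hg h7.le hs
  have hlow : ∀ s, 0 ≤ s → -4 < (γ s).1 := by
    by_contra hc
    push Not at hc
    obtain ⟨b, hb, hb4⟩ := hc
    obtain ⟨s, hs, h4, hlt⟩ := exists_first_hit (f := fun s => (γ s).1) (b := b) (c := -4)
      H.continuous.fst.continuousOn hb (by linarith) hb4
    have hB : ∀ r ∈ Icc 0 s, HasDerivAt γ (P.XB mu (γ r)) r ∧ 0 < P.ThB (γ r) := by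
      intro r hr
      refine H.block hr.1 ?_ (hup r hr.1)
      rcases hr.2.eq_or_lt with h | h
      · rw [h]; exact h4.ge
      · exact (hlt r ⟨hr.1, h⟩).le
    have hz0 := H.z_zero_on hs.1.le (fun r hr => (hB r hr).1) hz
    have hp : γ s = (-4, (γ s).2) := Prod.ext h4 rfl
    have := (hB s ⟨hs.1.le, le_rfl⟩).2
    rw [hp] at this
    exact (lowq_mem (by norm_num) this).1 hz0
  have hz0 := H.z_zero_on ht (fun r hr => (H.block hr.1 (hlow r hr.1).le (hup r hr.1)).1) hz
  refine ⟨hz0, ?_, (H.h_le hg h7.le ht).trans_lt (max_lt h7 (by norm_num))⟩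
  have hV := inV_iff.2 (H.block ht (hlow t ht).le (hup t ht)).2
  have h2 := hV.I0_gt'
  have hx : xx (γ t) = 0 := by simp [xx, hz0]
  rw [I0, hx, ps_of_nonpos (tt_zero _).le] at h2
  have := P.cs_le_one
  linarith

lemma stable_tendsto (hg : P.Good mu) (H : Q.Orb mu γ) (h1 : -1 < (γ 0).1) (h7 : (γ 0).1 < 7)
    (hz : (γ 0).2.1 = 0) : Tendsto γ atTop (𝓝 0) := by
  have hm := fun t (ht : 0 ≤ t) => H.stable_mem hg h1 h7 hz ht
  have hx : ∀ t, 0 ≤ t → xx (γ t) = 0 := fun t ht => by simp [xx, (hm t ht).1]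
  have hB := fun t (ht : 0 ≤ t) => (H.block ht (by linarith [(hm t ht).2.1])
    (by linarith [(hm t ht).2.2])).1
  have hmu := hg.1.1
  -- Below height 7 the constant descent speed 1 is also at least h/7.
  set κ := min mu (1 / 7) with hκ
  have hκ0 : 0 < κ := lt_min hmu (by norm_num)
  have hκ1 : κ ≤ mu := min_le_left _ _
  have hκ2 : κ ≤ 1 / 7 := min_le_right _ _
  have hh : Tendsto (fun t => (γ t).1 ^ 2) atTop (𝓝 0) := by
    refine tendsto_zero_of_deriv_le (a := 0) (κ := 2 * κ) (by linarith)
      (fun t ht => (curve_h (hB t ht)).pow 2) (fun t ht => ?_) (fun t _ => sq_nonneg _)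
    rw [hx t ht, fh, c_one P.sq1_pos.le, ch_of_nonpos (tt_zero _).le]
    obtain ⟨-, a1, a2⟩ := hm t ht
    set h := (γ t).1
    have s0 := stp_nonneg 2 3 h
    have s1 := stp_le_one 2 3 h
    have key : κ * h ^ 2 ≤ h * (mu * h * stp 2 3 h + (1 - stp 2 3 h)) := by
      rcases le_or_gt h 0 with h0 | h0
      · rw [stp_of_le (by norm_num : (2 : ℝ) < 3) (by linarith)]
        nlinarith [sq_nonneg h]
      · have e1 : κ * h ≤ mu * h := mul_le_mul_of_nonneg_right hκ1 h0.le
        have e2 : κ * h ≤ 1 := by nlinarith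
        have e3 := mul_le_mul_of_nonneg_left e1 s0
        have e4 := mul_le_mul_of_nonneg_left e2 (sub_nonneg.2 s1)
        have e5 : κ * h ≤ mu * h * stp 2 3 h + (1 - stp 2 3 h) := by linarith
        have := mul_le_mul_of_nonneg_left e5 h0.le
        nlinarith
    unfold jj
    push_cast
    norm_num
    linarith
  have hh' : Tendsto (fun t => (γ t).1) atTop (𝓝 0) := by
    have h2 := hh.sqrt
    simp only [Real.sqrt_sq_eq_abs, Real.sqrt_zero] at h2
    exact (tendsto_zero_iff_abs_tendsto_zero _).2 h2
  obtain ⟨a, ha⟩ := eventually_atTop.1 (hh'.eventually_lt_const (show (0 : ℝ) < 1 by norm_num))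
  have hW : Tendsto (fun t => ww (γ t)) atTop (𝓝 0) := by
    refine tendsto_zero_of_deriv_le (a := max a 0) (κ := 2 * P.eta)
      (by have := P.eta_pos; linarith)
      (fun t ht => curve_W (hB t ((le_max_right _ _).trans ht))) (fun t ht => ?_)
      (fun t _ => ww_nonneg _)
    rw [hx t ((le_max_right _ _).trans ht), fw, b_one (ha t ((le_max_left _ _).trans ht)).le,
      d_one P.sq1_pos.le]
    exact le_of_eq (by ring)
  have hw : Tendsto (fun t => (γ t).2.2.1) atTop (𝓝 0) := by
    rw [tendsto_zero_iff_norm_tendsto_zero]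
    have h2 := hW.sqrt
    rw [Real.sqrt_zero] at h2
    refine squeeze_zero (fun t => norm_nonneg _) (fun t => Real.le_sqrt_of_sq_le ?_) h2
    exact le_add_of_nonneg_right (sq_nonneg _)
  have hv : Tendsto (fun t => (γ t).2.2.2) atTop (𝓝 0) := by
    rw [tendsto_zero_iff_norm_tendsto_zero]
    have h2 := hW.sqrt
    rw [Real.sqrt_zero] at h2
    refine squeeze_zero (fun t => norm_nonneg _) (fun t => Real.le_sqrt_of_sq_le ?_) h2
    exact le_add_of_nonneg_left (sq_nonneg _)
  have hzt : Tendsto (fun t => (γ t).2.1) atTop (𝓝 0) := by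
    refine tendsto_const_nhds.congr' ?_
    filter_upwards [eventually_ge_atTop 0] with t ht
    exact (hm t ht).1.symm
  exact hh'.prodMk_nhds (hzt.prodMk_nhds (hw.prodMk_nhds hv))

end Orb

/-- A forward orbit that stays over the block lies in `{z = 0}`. -/
lemma z_zero_of_stay (hg : P.Good mu) (hc : ContinuousOn γ (Ici 0))
    (hγ : ∀ t, 0 < t → HasDerivAt γ (Q.Yp mu (γ t)) t) (hU : ∀ t, 0 ≤ t → 1 / 2 < Q.Thp (γ t))
    (hh : ∀ t, 0 ≤ t → -1 < (γ t).1 ∧ (γ t).1 < 7) : (γ 0).2.1 = 0 := by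
  by_contra hz
  have hB : ∀ t, 0 < t → HasDerivAt γ (P.XB mu (γ t)) t ∧ 0 < P.ThB (γ t) := by
    intro t ht
    obtain ⟨h1, h2⟩ := hh t ht.le
    have hU' := hU t ht.le
    have hd := hγ t ht
    rw [Yp_eq_X (by linarith) (by linarith) (by linarith)] at hd
    rw [Thp_eq (by linarith) (by linarith)] at hU'
    rw [X_block (by linarith) (by linarith)] at hd
    exact ⟨hd, ThB_pos' (by linarith) (by linarith)⟩
  obtain ⟨M, hM⟩ := Q.exists_T_bound
  have hT0 : 0 < P.T (γ 0).1 (xx (γ 0)) := T_pos (xx_pos hz)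
  have hgrow : ∀ t, 0 ≤ t → P.T (γ 0).1 (xx (γ 0)) * Real.exp (P.rate mu * t) ≤ M := by
    intro t ht
    refine (T_growth hg.1 (hc.mono fun s hs => hs.1) (fun s hs => (hB s hs.1).1)
      (fun s hs => (hB s hs.1).2) t ⟨ht, le_rfl⟩).trans ?_
    exact hM _ (by linarith [hU t ht]) (by linarith [(hh t ht).1])
  have hlim : Tendsto (fun t : ℝ => P.T (γ 0).1 (xx (γ 0)) * Real.exp (P.rate mu * t)) atTop
      atTop :=
    (Real.tendsto_exp_atTop.comp (tendsto_id.const_mul_atTop (rate_pos hg.1))).const_mul_atTop hT0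
  obtain ⟨t, ht0, ht⟩ := ((eventually_ge_atTop 0).and (hlim.eventually_gt_atTop M)).exists
  linarith [hgrow t ht0]

end Tube

namespace Tube
open Par
variable {n : ℕ} {P : Par} {Q : Tube n P} {mu : ℝ}

/-! ### The singularity -/

lemma Thp_zero : Q.Thp 0 = 1 := by
  have hK := P.K_gt (h := 0) (x := 0) le_rfl
  have hx : xx (0 : Mod n) = 0 := by simp [xx]
  have hw : ww (0 : Mod n) = 0 := by simp [ww]
  have hnu := P.nu_pos
  have hd := P.nu_le_dS
  have hd2 := P.dS_le
  have hcs := P.cs_pos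
  have hps : P.ps 0 0 = 0 := ps_of_nonpos (P.tt_zero 0).le
  have hR := P.R_ge
  rw [Thp_eq (by simp) (by simp), Th_of_le (by simp)]
  refine ThB_eq_one ?_ ?_ ?_
  · rw [hx]
    show P.A1 0 0 ≤ 0
    have : (P.Iq P.sig 0 0 - P.cs * (P.R + 5 / 8)) / P.nu ≤ -1 := by
      rw [div_le_iff₀ hnu, Iq, hps, eFun_of_le (by norm_num)]
      nlinarith
    unfold A1; linarith
  · rw [hx]
    show P.A2 0 0 ≤ 0
    have : (-P.I0 0 0 - 3 / 2 * P.dS) / P.nu ≤ -1 := by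
      rw [div_le_iff₀ hnu, I0, hps]
      linarith
    unfold A2; linarith
  · rw [hx, hw]
    show P.A3 0 0 0 ≤ 0
    unfold A3; linarith

/-- The linear part of the field at the singularity. -/
def linB (n : ℕ) (P : Par) (mu : ℝ) : Mod n →L[ℝ] Mod n :=
  ((-mu) • ContinuousLinearMap.id ℝ ℝ).prodMap ((P.sig • ContinuousLinearMap.id ℝ ℂ).prodMap
    ((-P.eta) • ContinuousLinearMap.id ℝ (ℂ × EuclideanSpace ℝ (Fin (n - 5)))))

lemma _root_.WildLorenz.Par.tt_le_of_small {h x : ℝ} (hh : -1 / 2 ≤ h) (hx : 0 ≤ x) (hx1 : x ≤ 1) : P.tt h x ≤ 0 := by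
  rcases hx.eq_or_lt with h0 | h0
  · rw [← h0]; exact (P.tt_zero h).le
  · have hs := P.sig_pos
    rw [tt_eq h0]
    have h1 : Real.log x / (2 * P.sig) ≤ 0 :=
      div_nonpos_of_nonpos_of_nonneg (Real.log_nonpos hx hx1) (by linarith)
    have h2 : 0 ≤ Real.log P.R3 / P.sig := div_nonneg (Real.log_nonneg P.R3_gt.le) hs.le
    have : 1 ≤ P.k := by unfold k; linarith
    linarith

/-- Near the origin all switching functions are constant, so the field is exactly linear. -/
lemma eventually_Yp : ∀ᶠ p in 𝓝 (0 : Mod n), Q.Yp mu p = linB n P mu p := by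
  have hT : ∀ᶠ p in 𝓝 (0 : Mod n), 1 / 4 < Q.Thp p :=
    contDiff_Thp.continuous.continuousAt.eventually_const_lt (by rw [Thp_zero]; norm_num)
  filter_upwards [hT, Metric.ball_mem_nhds (0 : Mod n) (show (0 : ℝ) < 1 / 2 by norm_num)] with p hp hb
  rw [Metric.mem_ball, dist_zero_right] at hb
  have h1 : |p.1| < 1 / 2 := (norm_fst_le p).trans_lt hb
  have h2 : ‖p.2.1‖ < 1 / 2 := (norm_fst_le p.2).trans_lt ((norm_snd_le p).trans_lt hb)
  obtain ⟨h3, h4⟩ := abs_lt.1 h1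
  have hx0 := xx_nonneg p
  have hx : xx p ≤ 1 := by unfold xx; nlinarith [norm_nonneg p.2.1]
  have hR := P.R_ge
  have hx1 : xx p ≤ P.R1 ^ 2 := hx.trans (by unfold R1; nlinarith)
  rw [Yp_eq_X (by linarith) (by linarith) hp.le, X_block (by linarith)
    (by rw [← Thp_eq (by linarith) (by linarith)]; linarith)]
  have htt := P.tt_le_of_small (h := p.1) (by linarith) hx0 hx
  rw [XB, fh, fz, fw, c_one hx1, jj_zero (by linarith), ch_of_nonpos htt, b_one (by linarith),
    d_one hx1, stp_of_le (by norm_num) (show p.1 ≤ 2 by linarith)]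
  simp only [linB, ContinuousLinearMap.coe_prodMap']
  refine Prod.ext ?_ (Prod.ext ?_ (Prod.ext ?_ ?_)) <;> simp

lemma Yp_eq_zero_iff (hg : P.Good mu) {p : Mod n} (hp : 1 / 4 < Q.Thp p) :
    Q.Yp mu p = 0 ↔ ∃ m, sh m p = 0 := by
  constructor
  · intro h0
    obtain ⟨m, h1, h2⟩ := exists_sh p
    refine ⟨m, ?_⟩
    rw [← Yp_sh mu m] at h0
    rw [← Thp_sh m] at hp
    rw [Yp_eq_X (by linarith) (by linarith) hp.le] at h0
    rw [Thp_eq (by linarith) (by linarith)] at hp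
    rcases le_or_gt (sh m p).1 8 with h8 | h8
    · rw [X_block h8 (by linarith)] at h0
      exact (XB_eq_zero_iff hg.1 (ThB_pos' h8 (by linarith))).1 h0
    · rw [X_tube (by linarith) (by linarith)] at h0
      have : (-1 : ℝ) = 0 := congrArg Prod.fst h0
      norm_num at this
  · rintro ⟨m, hm⟩
    rw [← Yp_sh mu m, hm, eventually_Yp.self_of_nhds, map_zero]

/-! ### The cross-sections -/

/-- The section on the entrance side of the block. -/
def secU (n : ℕ) (q : Sec n) : Mod n := (4, q)

/-- A cutoff function that is equal to one on the annulus. -/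
def cut (P : Par) (z : ℂ) : ℝ := 1 - stp (((1 - P.lam) / 4) ^ 2) (((1 - P.lam) / 3) ^ 2) (‖z‖ ^ 2)

/-- The section on the exit side of the block. -/
def secS (P : Par) (q : Sec n) : Mod n :=
  (cut P q.1 * P.II ‖q.1‖, ((cut P q.1 * P.R3 : ℝ) : ℂ) * uu q.1, P.eps • q.2.1, P.eps • q.2.2)

lemma _root_.WildLorenz.Par.cut_lt (P : Par) : ((1 - P.lam) / 4) ^ 2 < ((1 - P.lam) / 3) ^ 2 := by
  have := P.lam_lt
  exact pow_lt_pow_left₀ (by linarith) (by linarith) (by norm_num)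

lemma cut_one {z : ℂ} (hz : (1 - P.lam) / 3 ≤ ‖z‖) : cut P z = 1 := by
  have := P.lam_lt
  rw [cut, stp_of_ge P.cut_lt (pow_le_pow_left₀ (by linarith) hz 2), sub_zero]

lemma contDiff_secU : ContDiff ℝ ∞ (secU n) := contDiff_const.prodMk contDiff_id

lemma contDiff_secS : ContDiff ℝ ∞ (secS (n := n) P) := by
  have hl := P.lam_lt
  rw [contDiff_iff_contDiffAt]
  intro q
  have hw : ContDiffAt ℝ ∞ (fun q : Sec n => (P.eps • q.2.1, P.eps • q.2.2)) q :=
    ((contDiff_snd.fst.const_smul P.eps).prodMk (contDiff_snd.snd.const_smul P.eps)).contDiffAt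
  rcases eq_or_ne q.1 0 with hz | hz
  · have h0 : ContDiffAt ℝ ∞ (fun q : Sec n => ((0 : ℝ), (0 : ℂ), P.eps • q.2.1, P.eps • q.2.2)) q :=
      contDiffAt_const.prodMk (contDiffAt_const.prodMk hw)
    refine h0.congr_of_eventuallyEq ?_
    have hc : Continuous (fun q : Sec n => ‖q.1‖) := continuous_fst.norm
    filter_upwards [hc.continuousAt.eventually_lt_const
      (show ‖q.1‖ < (1 - P.lam) / 4 by rw [hz, norm_zero]; linarith)] with y hy
    have : cut P y.1 = 0 := by
      rw [cut, stp_of_le P.cut_lt (pow_le_pow_left₀ (norm_nonneg _) hy.le 2), sub_self]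
    simp [secS, this]
  · have hn : ContDiffAt ℝ ∞ (fun q : Sec n => ‖q.1‖) q :=
      ContDiffAt.comp (g := fun z : ℂ => ‖z‖) (f := fun q : Sec n => q.1) q
        (contDiffAt_norm ℝ hz) contDiff_fst.contDiffAt
    have hI : ContDiffAt ℝ ∞ (fun q : Sec n => P.II ‖q.1‖) q :=
      contDiffAt_const.mul (hn.sub contDiffAt_const)
    have hcut : ContDiffAt ℝ ∞ (fun q : Sec n => cut P q.1) q :=
      contDiffAt_const.sub ((contDiff_stp _ _).contDiffAt.comp q (hn.pow 2))
    have hu : ContDiffAt ℝ ∞ (fun q : Sec n => uu q.1) q :=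
      (contDiffAt_uu hz).comp q contDiff_fst.contDiffAt
    have h2 : ContDiffAt ℝ ∞ (fun q : Sec n => ((cut P q.1 * P.R3 : ℝ) : ℂ)) q :=
      Complex.ofRealCLM.contDiff.contDiffAt.comp q (hcut.mul contDiffAt_const)
    exact (hcut.mul hI).prodMk ((h2.mul hu).prodMk hw)

lemma secS_eq {q : Sec n} (hz : (1 - P.lam) / 3 ≤ ‖q.1‖) :
    secS P q = (P.II ‖q.1‖, (P.R3 : ℂ) * uu q.1, P.eps • q.2.1, P.eps • q.2.2) := by
  rw [secS, cut_one hz, one_mul, one_mul]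

/-- A left inverse of the exit section. -/
def retS (P : Par) (p : Mod n) : Sec n :=
  (((P.R3⁻¹ * (P.lam / P.cs * p.1 + (1 - P.lam)) : ℝ) : ℂ) * p.2.1, P.eps⁻¹ • p.2.2.1,
    P.eps⁻¹ • p.2.2.2)

lemma contDiff_retS : ContDiff ℝ ∞ (retS (n := n) P) := by
  have h1 : ContDiff ℝ ∞ (fun p : Mod n => ((P.R3⁻¹ * (P.lam / P.cs * p.1 + (1 - P.lam)) : ℝ) : ℂ)) :=
    Complex.ofRealCLM.contDiff.comp (contDiff_const.mul
      ((contDiff_const.mul contDiff_fst).add contDiff_const))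
  exact (h1.mul contDiff_snd.fst).prodMk ((contDiff_snd.snd.fst.const_smul _).prodMk
    (contDiff_snd.snd.snd.const_smul _))

lemma lam_div_cs (y : ℝ) : P.lam / P.cs * P.II y + (1 - P.lam) = y := by
  have h1 := P.cs_pos
  have h2 := P.half_le_lam
  have h3 : P.lam ≠ 0 := by linarith
  rw [II, hI]; field_simp; ring

lemma _root_.WildLorenz.Par.ne_zero_of_third {z : ℂ} (hz : (1 - P.lam) / 3 ≤ ‖z‖) : z ≠ 0 := by
  have := P.lam_lt
  rintro rfl
  rw [norm_zero] at hz; linarith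

lemma retS_secS {q : Sec n} (hz : (1 - P.lam) / 3 ≤ ‖q.1‖) : retS P (secS P q) = q := by
  have h0 := P.ne_zero_of_third hz
  have hR := P.R3_pos.ne'
  have he := P.eps_pos.ne'
  rw [secS_eq hz, retS]
  refine Prod.ext ?_ (Prod.ext ?_ ?_)
  · have hRc : (P.R3 : ℂ) ≠ 0 := by exact_mod_cast hR
    simp only [lam_div_cs]
    push_cast
    rw [mul_comm (P.R3 : ℂ)⁻¹, mul_assoc, inv_mul_cancel_left₀ hRc, norm_mul_uu h0]
  · exact inv_smul_smul₀ he _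
  · exact inv_smul_smul₀ he _

/-- A local section with a left inverse on which `G` is constant is an immersion, transversal to
the directions in which `G` varies. -/
lemma immersion_transversal {E F : Type*} [NormedAddCommGroup E] [NormedSpace ℝ E]
    [NormedAddCommGroup F] [NormedSpace ℝ F] {s : E → F} {r : F → E} {G : F → ℝ} {q : E} {c : ℝ}
    {v : F} (hs : DifferentiableAt ℝ s q) (hr : DifferentiableAt ℝ r (s q))
    (hG : DifferentiableAt ℝ G (s q)) (hrs : ∀ᶠ y in 𝓝 q, r (s y) = y)
    (hGs : ∀ᶠ y in 𝓝 q, G (s y) = c) (hv : fderiv ℝ G (s q) v ≠ 0) :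
    Function.Injective (fderiv ℝ s q) ∧ v ∉ range (fderiv ℝ s q) := by
  constructor
  · have h1 : HasFDerivAt (fun y => r (s y)) ((fderiv ℝ r (s q)).comp (fderiv ℝ s q)) q :=
      hr.hasFDerivAt.comp q hs.hasFDerivAt
    have h2 : HasFDerivAt (fun y => r (s y)) (ContinuousLinearMap.id ℝ E) q :=
      (hasFDerivAt_id q).congr_of_eventuallyEq hrs
    have h3 := h1.unique h2
    intro a b hab
    have ha := congrArg (fun L => L a) h3
    have hb := congrArg (fun L => L b) h3
    simp only [ContinuousLinearMap.comp_apply, ContinuousLinearMap.id_apply] at ha hb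
    rw [← ha, ← hb, hab]
  · rintro ⟨a, rfl⟩
    have h1 : HasFDerivAt (fun y => G (s y)) ((fderiv ℝ G (s q)).comp (fderiv ℝ s q)) q :=
      hG.hasFDerivAt.comp q hs.hasFDerivAt
    have h2 : HasFDerivAt (fun y => G (s y)) (0 : E →L[ℝ] ℝ) q :=
      (hasFDerivAt_const c q).congr_of_eventuallyEq hGs
    exact hv (congrArg (fun L => L a) (h1.unique h2))

lemma Thp_secU {q : Sec n} (hq : q ∈ secOver n (ballB P.lam)) : Q.Thp (secU n q) = 1 := by
  obtain ⟨h1, h2, h3⟩ := hq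
  rw [mem_closedBall_zero_iff] at h2 h3
  show Q.Thp (4, q) = 1
  rw [Thp_eq (by norm_num) (by norm_num), Th_of_le (by norm_num)]
  refine ThB_top (by norm_num) h1 ?_
  have := pow_le_one₀ (n := 2) (norm_nonneg _) h2
  have := pow_le_one₀ (n := 2) (norm_nonneg _) h3
  unfold ww
  simp only
  linarith

lemma _root_.WildLorenz.Par.third_of_annulus {z : ℂ} (hz : z ∈ annulusB P.lam) : (1 - P.lam) / 3 ≤ ‖z‖ := by
  have := hz.1; have := P.lam_lt; linarith

/-- The identity λR = R - 2 turns the outer radius R - 1 - λ/2 into the height cs (R + 1/2); the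
inner radius gives -dS. -/
lemma _root_.WildLorenz.Par.II_of_annulus {z : ℂ} (hz : z ∈ annulusB P.lam) :
    -P.dS ≤ P.II ‖z‖ ∧ P.II ‖z‖ ≤ P.cs * (P.R + 1 / 2) := by
  obtain ⟨h1, h2⟩ := hz
  have hl : 0 < P.lam := by have := P.half_le_lam; linarith
  have hcs := P.cs_pos
  have e := P.II_eq ‖z‖
  constructor
  · refine le_of_mul_le_mul_left ?_ hl
    rw [e, mul_neg, lam_dS]
    nlinarith
  · refine le_of_mul_le_mul_left ?_ hl
    have h3 : P.lam * (P.cs * (P.R + 1 / 2)) = P.cs * (P.R - 2 + P.lam / 2) := by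
      rw [← lam_mul_R]; ring
    rw [e, h3]
    refine mul_le_mul_of_nonneg_left ?_ hcs.le
    have : ‖z‖ ≤ P.R - 1 - P.lam / 2 := h2
    linarith

lemma _root_.WildLorenz.Par.II_abs_of_annulus {z : ℂ} (hz : z ∈ annulusB P.lam) : -1 / 2 < P.II ‖z‖ ∧ P.II ‖z‖ < 1 / 2 := by
  obtain ⟨h1, h2⟩ := P.II_of_annulus hz
  have := P.dS_le; have := P.cs_le_one; have := P.cs_R; have := P.cs_pos
  constructor <;> nlinarith

lemma xx_secS {q : Sec n} (hq : (1 - P.lam) / 3 ≤ ‖q.1‖) : xx (secS P q) = P.R3 ^ 2 := by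
  rw [secS_eq hq, xx]
  simp [norm_uu (P.ne_zero_of_third hq), abs_of_pos P.R3_pos]

lemma _root_.WildLorenz.Par.tt_secS {h : ℝ} (hh : -1 < h) : P.tt h (P.R3 ^ 2) < 0 := by
  have hR := P.R3_pos
  have hs := P.sig_pos
  have e : ((2 : ℕ) : ℝ) * Real.log P.R3 / (2 * P.sig) = Real.log P.R3 / P.sig := by
    field_simp; norm_num; ring
  rw [tt_eq (by positivity), Real.log_pow, e, k]
  linarith

lemma _root_.WildLorenz.Par.Iq_secS {h : ℝ} (h1 : -1 < h) (h2 : h ≤ 1) (mu : ℝ) : P.Iq mu h (P.R3 ^ 2) = h := by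
  rw [Iq, ps_of_nonpos (P.tt_secS h1).le, m_one P.sq23.le, eFun_of_le h2]; ring

lemma Thp_secS {q : Sec n} (hq : q ∈ secOver n (annulusB P.lam)) : Q.Thp (secS P q) = 1 := by
  obtain ⟨h1, h2, h3⟩ := hq
  rw [mem_closedBall_zero_iff] at h2 h3
  have ht := P.third_of_annulus h1
  obtain ⟨a, b⟩ := P.II_of_annulus h1
  obtain ⟨a', b'⟩ := P.II_abs_of_annulus h1
  have hx := xx_secS ht
  have hf : (secS P q).1 = P.II ‖q.1‖ := by rw [secS_eq ht]
  have hK := P.K_gt (h := P.II ‖q.1‖) (sq_nonneg P.R3)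
  have hnu := P.nu_pos
  have hd := P.nu_le_dS
  have hd2 := P.dS_le
  have he := P.eps_pos
  rw [Thp_eq (by rw [hf]; linarith) (by rw [hf]; linarith), Th_of_le (by rw [hf]; linarith)]
  refine ThB_eq_one ?_ ?_ ?_ <;> rw [hx, hf]
  · have : (P.Iq P.sig (P.II ‖q.1‖) (P.R3 ^ 2) - P.cs * (P.R + 5 / 8)) / P.nu ≤ -1 := by
      rw [div_le_iff₀ hnu, P.Iq_secS (by linarith) (by linarith)]
      linarith
    unfold A1; linarith
  · have : (-P.I0 (P.II ‖q.1‖) (P.R3 ^ 2) - 3 / 2 * P.dS) / P.nu ≤ -1 := by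
      rw [div_le_iff₀ hnu, I0, ps_of_nonpos (P.tt_secS (by linarith)).le]
      linarith
    unfold A2; linarith
  · have hw : ww (secS P q) = P.eps ^ 2 * (‖q.2.1‖ ^ 2 + ‖q.2.2‖ ^ 2) := by
      rw [secS_eq ht, ww]
      simp only [norm_smul, Real.norm_eq_abs, abs_of_pos he]
      ring
    have := pow_le_one₀ (n := 2) (norm_nonneg _) h2
    have := pow_le_one₀ (n := 2) (norm_nonneg _) h3
    rw [A3, F_eps P.sq23.le, hw, mul_right_comm, mul_inv_cancel₀ (by positivity), one_mul]
    linarith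

lemma Yp_secU {q : Sec n} (hq : q ∈ secOver n (ballB P.lam)) : Q.Yp mu (secU n q) = (-1, 0) := by
  have h := Thp_secU (Q := Q) hq
  have h' : Q.Th (secU n q) = 1 := by rwa [Thp_eq (by norm_num [secU]) (by norm_num [secU])] at h
  rw [Yp_eq_X (by norm_num [secU]) (by norm_num [secU]) (by rw [h]; norm_num),
    X_vert (by norm_num [secU]) (by norm_num [secU]) (by rw [h']; norm_num)]

lemma Yp_secS {q : Sec n} (hq : q ∈ secOver n (annulusB P.lam)) :
    (Q.Yp mu (secS P q)).2.1 = P.sig • (secS P q).2.1 := by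
  have h := Thp_secS (Q := Q) hq
  have ht := P.third_of_annulus hq.1
  have hf : (secS P q).1 = P.II ‖q.1‖ := by rw [secS_eq ht]
  obtain ⟨a, b⟩ := P.II_abs_of_annulus hq.1
  have h' : Q.Th (secS P q) = 1 := by
    rwa [Thp_eq (by rw [hf]; linarith) (by rw [hf]; linarith)] at h
  rw [Yp_eq_X (by rw [hf]; linarith) (by rw [hf]; linarith) (by rw [h]; norm_num),
    X_block (by rw [hf]; linarith) (by rw [h']; norm_num), XB, xx_secS ht, hf, fz,
    b_one (by linarith), ch_of_nonpos (P.tt_secS (by linarith)).le]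
  simp

lemma secU_transversal {q : Sec n} (hq : q ∈ secOver n (ballB P.lam)) :
    Function.Injective (fderiv ℝ (secU n) q) ∧
      Q.Yp mu (secU n q) ∉ range (fderiv ℝ (secU n) q) := by
  refine immersion_transversal (r := Prod.snd) (G := Prod.fst) (c := 4)
    (contDiff_secU.differentiable (by simp) q) differentiableAt_snd differentiableAt_fst
    (Eventually.of_forall fun _ => rfl) (Eventually.of_forall fun _ => rfl) ?_
  rw [Yp_secU hq, fderiv_fst]
  simp

lemma secS_transversal {q : Sec n} (hq : q ∈ secOver n (annulusB P.lam)) :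
    Function.Injective (fderiv ℝ (secS P) q) ∧
      Q.Yp mu (secS P q) ∉ range (fderiv ℝ (secS P) q) := by
  have hev : ∀ᶠ y : Sec n in 𝓝 q, (1 - P.lam) / 3 ≤ ‖y.1‖ := by
    have hc : Continuous (fun q : Sec n => ‖q.1‖) := continuous_fst.norm
    have h1 : (1 - P.lam) / 2 ≤ ‖q.1‖ := hq.1.1
    filter_upwards [hc.continuousAt.eventually_const_lt
      (show (1 - P.lam) / 3 < ‖q.1‖ by have := P.lam_lt; linarith)] with y hy using hy.le
  refine immersion_transversal (r := retS P) (G := xx) (c := P.R3 ^ 2)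
    (contDiff_secS.differentiable (by simp) q) (contDiff_retS.differentiable (by simp) _)
    (contDiff_xx.differentiable (by simp) _) (hev.mono fun _ => retS_secS)
    (hev.mono fun _ => xx_secS) ?_
  have h2 : HasFDerivAt (xx (n := n)) _ (secS P q) :=
    (hasFDerivAt_fst.comp (secS P q) (hasFDerivAt_snd)).norm_sq
  rw [h2.fderiv]
  have e : (secS P q).2.1 ≠ 0 := by
    have := xx_secS (n := n) (P.third_of_annulus hq.1)
    intro h0
    rw [xx, h0, norm_zero] at this
    have := P.R3_pos
    nlinarith
  have hs := P.sig_pos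
  have h3 : 0 < ‖(secS P q).2.1‖ ^ 2 := by positivity
  simp only [_root_.smul_apply, ContinuousLinearMap.comp_apply, Function.comp,
    ContinuousLinearMap.coe_fst', ContinuousLinearMap.coe_snd', innerSL_apply_apply, Yp_secS hq,
    real_inner_smul_right, real_inner_self_eq_norm_sq]
  positivity

end Tube

namespace Tube
open Par
variable {n : ℕ} {P : Par} {Q : Tube n P} {mu : ℝ} {γ : ℝ → Mod n}

/-! ### The Poincaré maps -/

lemma rpow_le_R {y : ℝ} (hmu : P.Adm mu) (hy0 : 0 ≤ y) (hy : y ≤ P.R) : y ^ (mu / P.sig) ≤ P.R := by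
  have hR := P.R_ge
  have h0 : 0 ≤ mu / P.sig := div_nonneg hmu.1.le P.sig_pos.le
  have h1 : mu / P.sig ≤ 1 := (div_le_one P.sig_pos).2 hmu.2.1
  refine (Real.rpow_le_rpow hy0 hy h0).trans ?_
  calc P.R ^ (mu / P.sig) ≤ P.R ^ (1 : ℝ) :=
        Real.rpow_le_rpow_of_exponent_le (by linarith) h1
    _ = P.R := Real.rpow_one _

/-- From β R2^(η/σ) ≤ ε and |z| ≤ R < R2: T̂ keeps the fibre coordinates in the unit balls. -/
lemma _root_.WildLorenz.Par.bet_rpow_le {y : ℝ} (hy0 : 0 < y) (hy : y ≤ P.R) :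
    P.bet / P.eps * y ^ (P.eta / P.sig) ≤ 1 := by
  have hR := P.R_ge
  have h0 : 0 ≤ P.eta / P.sig := div_nonneg P.eta_pos.le P.sig_pos.le
  have hyR : y ≤ P.R2 := by unfold R2; linarith
  have hp : 0 < P.bet / P.eps * y ^ (P.eta / P.sig) :=
    mul_pos (div_pos P.bet_pos P.eps_pos) (Real.rpow_pos_of_pos hy0 _)
  rw [← Real.log_nonpos_iff hp.le, Real.log_mul (div_pos P.bet_pos P.eps_pos).ne'
    (Real.rpow_pos_of_pos hy0 _).ne', Real.log_div P.bet_pos.ne' P.eps_pos.ne', Real.log_rpow hy0]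
  have h1 := P.bet_log
  have h2 := mul_le_mul_of_nonneg_left (Real.log_le_log hy0 hyR) h0
  linarith

lemma conj_uu {z : ℂ} (hz : z ≠ 0) : starRingEnd ℂ (uu z) = (‖z‖ : ℂ) / z := by
  rw [eq_inv_of_mul_eq_one_right (uu_mul_conj hz), uu_eq_div, inv_div]

lemma mapT_eq {z : ℂ} : mapT P.sig P.lam mu z =
    ((1 - P.lam + P.lam * ‖z‖ ^ (mu / P.sig) : ℝ) : ℂ) * uu z := by
  rw [mapT, uu_eq_div]

lemma _root_.WildLorenz.Par.radius_pos (P : Par) (y : ℝ) (hy : 0 ≤ y) : 0 < 1 - P.lam + P.lam * y ^ (mu / P.sig) := by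
  have h1 := P.lam_lt
  have h2 := P.half_le_lam
  have := mul_nonneg (show 0 ≤ P.lam by linarith) (Real.rpow_nonneg hy (mu / P.sig))
  linarith

lemma norm_mapT {z : ℂ} (hz : z ≠ 0) :
    ‖mapT P.sig P.lam mu z‖ = 1 - P.lam + P.lam * ‖z‖ ^ (mu / P.sig) := by
  rw [mapT_eq, norm_mul, norm_uu hz, mul_one, Complex.norm_real, Real.norm_eq_abs,
    abs_of_pos (P.radius_pos _ (norm_nonneg z))]

lemma uu_mapT {z : ℂ} (hz : z ≠ 0) : uu (mapT P.sig P.lam mu z) = uu z := by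
  rw [mapT_eq, uu_smul (P.radius_pos _ (norm_nonneg z)), uu_of_norm_one (norm_uu hz)]

lemma II_mapT {z : ℂ} (hz : z ≠ 0) :
    P.II ‖mapT P.sig P.lam mu z‖ = P.cs * ‖z‖ ^ (mu / P.sig) := by
  have h2 : P.lam ≠ 0 := by have := P.half_le_lam; linarith
  rw [norm_mapT hz, II, hI]; field_simp; ring

lemma mapThat_mem (hmu : P.Adm mu) {q : Sec n} (hq : q ∈ secOver n (ballB P.lam \ {0})) :
    mapThat n P.eta P.sig (P.bet / P.eps) P.lam mu q ∈ secOver n (annulusB P.lam) := by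
  obtain ⟨⟨h1, hz⟩, h2, h3⟩ := hq
  have h1 : ‖q.1‖ ≤ P.R := h1
  have hz : q.1 ≠ 0 := hz
  rw [mem_closedBall_zero_iff] at h2 h3
  have hb := P.bet_rpow_le (norm_pos_iff.2 hz) h1
  have hb0 : 0 ≤ P.bet / P.eps * ‖q.1‖ ^ (P.eta / P.sig) :=
    mul_nonneg (div_pos P.bet_pos P.eps_pos).le (Real.rpow_nonneg (norm_nonneg _) _)
  have hl := P.lam_lt
  have hl2 := P.half_le_lam
  refine ⟨⟨?_, ?_⟩, ?_, ?_⟩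
  · show _ ≤ ‖mapT P.sig P.lam mu q.1‖
    rw [norm_mapT hz]
    have := mul_nonneg (show 0 ≤ P.lam by linarith) (Real.rpow_nonneg (norm_nonneg q.1) (mu / P.sig))
    linarith
  · show ‖mapT P.sig P.lam mu q.1‖ ≤ P.R - 1 - P.lam / 2
    rw [norm_mapT hz]
    have h4 := mul_le_mul_of_nonneg_left (rpow_le_R hmu (norm_nonneg q.1) h1)
      (show 0 ≤ P.lam by linarith)
    rw [lam_mul_R] at h4
    linarith
  · rw [mem_closedBall_zero_iff]
    show ‖((P.bet / P.eps * ‖q.1‖ ^ (P.eta / P.sig) : ℝ) : ℂ) * q.2.1‖ ≤ 1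
    rw [norm_mul, Complex.norm_real, Real.norm_eq_abs, abs_of_nonneg hb0]
    exact mul_le_one₀ hb (norm_nonneg _) h2
  · rw [mem_closedBall_zero_iff]
    show ‖(P.bet / P.eps * ‖q.1‖ ^ (P.eta / P.sig)) • q.2.2‖ ≤ 1
    rw [norm_smul, Real.norm_eq_abs, abs_of_nonneg hb0]
    exact mul_le_one₀ hb (norm_nonneg _) h3

/-- The right-hand side is the point of the cylinder found by `hit`, with the first integrals
evaluated at height 4. -/
lemma secS_mapThat {q : Sec n} (hmu : P.Adm mu) (hq : q ∈ secOver n (ballB P.lam \ {0})) :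
    secS P (mapThat n P.eta P.sig (P.bet / P.eps) P.lam mu q) =
      (P.Iq mu 4 (‖q.1‖ ^ 2), (P.R3 : ℂ) * uu q.1, P.pw (‖q.1‖ ^ 2) • q.2) := by
  have h1 : ‖q.1‖ ≤ P.R := hq.1.1
  have hz : q.1 ≠ 0 := hq.1.2
  have hp := norm_pos_iff.2 hz
  have he := P.eps_pos.ne'
  have hm := mapThat_mem hmu hq
  rw [secS_eq (P.third_of_annulus hm.1), Iq_top (by norm_num) h1 hp, pw_top hp h1]
  refine Prod.ext ?_ (Prod.ext ?_ (Prod.ext ?_ ?_))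
  · exact II_mapT hz
  · show (P.R3 : ℂ) * uu (mapT P.sig P.lam mu q.1) = _
    rw [uu_mapT hz]
  · show P.eps • (((P.bet / P.eps * ‖q.1‖ ^ (P.eta / P.sig) : ℝ) : ℂ) * q.2.1) =
      (P.bet * ‖q.1‖ ^ (P.eta / P.sig)) • q.2.1
    rw [← Complex.real_smul, smul_smul]
    congr 1; field_simp
  · show P.eps • ((P.bet / P.eps * ‖q.1‖ ^ (P.eta / P.sig)) • q.2.2) =
      (P.bet * ‖q.1‖ ^ (P.eta / P.sig)) • q.2.2
    rw [smul_smul]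
    congr 1; field_simp

/-- The exit radius is 1 - λ + λ|z|^(μ/σ) and the fibre factor is β|z|^(η/σ); the isotopy at f = 1
then gives F̂ in closed form. -/
lemma exitq_secU {q : Sec n} (hq : q ∈ secOver n (ballB P.lam \ {0})) :
    iso P.cs P.lam P.sig P.k 1 (exitq P mu (secU n q)) = mapFhat n P.eta P.sig P.bet P.lam mu q := by
  have h1 : ‖q.1‖ ≤ P.R := hq.1.1
  have hz : q.1 ≠ 0 := hq.1.2
  have hp := norm_pos_iff.2 hz
  have hcs := P.cs_pos.ne'
  have hr := P.radius_pos (mu := mu) ‖q.1‖ (norm_nonneg _)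
  have e1 : exitq P mu (secU n q) =
      (((1 - P.lam + P.lam * ‖q.1‖ ^ (mu / P.sig) : ℝ) : ℂ) * uu q.1,
        (P.bet * ‖q.1‖ ^ (P.eta / P.sig)) • q.2) := by
    show ((((1 - P.lam + P.lam / P.cs * P.Iq mu 4 (‖q.1‖ ^ 2)) : ℝ) : ℂ) * uu q.1,
      P.pw (‖q.1‖ ^ 2) • q.2) = _
    rw [Iq_top (by norm_num) h1 hp, pw_top hp h1]
    congr 4
    field_simp
  rw [e1, iso_one]
  have hu := norm_uu hz
  simp only [norm_mul, hu, mul_one, uu_smul hr, uu_of_norm_one hu, Complex.norm_real,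
    Real.norm_eq_abs, abs_of_pos hr]
  have hzc : (‖q.1‖ : ℂ) ≠ 0 := by exact_mod_cast hp.ne'
  have hconj : starRingEnd ℂ (uu q.1) = (‖q.1‖ : ℂ) / q.1 := conj_uu hz
  refine Prod.ext ?_ (Prod.ext ?_ ?_)
  · show _ = mapF P.sig P.lam mu q.1
    rw [mapF, uu_eq_div]
  · show uu q.1 / 2 + starRingEnd ℂ (uu q.1) * ((P.bet * ‖q.1‖ ^ (P.eta / P.sig)) • q.2.1) =
      q.1 / (2 * (‖q.1‖ : ℂ)) + ((P.bet * ‖q.1‖ ^ (P.eta / P.sig) : ℝ) : ℂ) *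
        ((‖q.1‖ : ℂ) / q.1) * q.2.1
    rw [hconj, uu_eq_div, Complex.real_smul]
    field_simp
  · rfl

lemma exitq_secS {q : Sec n} (hq : q ∈ secOver n (annulusB P.lam)) :
    iso P.cs P.lam P.sig P.k 1 (exitq P mu (secS P q)) = mapGhat n P.eps q := by
  have ht := P.third_of_annulus hq.1
  have hz := P.ne_zero_of_third ht
  have hp := norm_pos_iff.2 hz
  obtain ⟨a, b⟩ := P.II_abs_of_annulus hq.1
  have e1 : exitq P mu (secS P q) = (q.1, P.eps • q.2) := by
    rw [exitq, xx_secS ht, secS_eq ht, P.Iq_secS (by simp only; linarith) (by simp only; linarith),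
      pw_one P.sq23.le]
    have h1 : 1 - P.lam + P.lam / P.cs * P.II ‖q.1‖ = ‖q.1‖ := by
      rw [add_comm]; exact lam_div_cs _
    simp only [h1, uu_smul P.R3_pos, uu_of_norm_one (norm_uu hz), norm_mul_uu hz, one_smul]
    rfl
  rw [e1, iso_one]
  have hzc : (‖q.1‖ : ℂ) ≠ 0 := by exact_mod_cast hp.ne'
  have hconj : starRingEnd ℂ (uu q.1) = (‖q.1‖ : ℂ) / q.1 := conj_uu hz
  refine Prod.ext ?_ (Prod.ext ?_ ?_)
  · show (‖q.1‖ : ℂ) * uu q.1 ^ 2 + 1 = q.1 ^ 2 / (‖q.1‖ : ℂ) + 1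
    rw [uu_eq_div]
    field_simp
  · show uu q.1 / 2 + starRingEnd ℂ (uu q.1) * (P.eps • q.2.1) =
      q.1 / (2 * (‖q.1‖ : ℂ)) + (P.eps : ℂ) * ((‖q.1‖ : ℂ) / q.1) * q.2.1
    rw [hconj, uu_eq_div, Complex.real_smul]
    field_simp
  · rfl

lemma fold_mem {q : Sec n} (hq : q ∈ P.Cpt n) :
    iso P.cs P.lam P.sig P.k 1 q ∈ secOver n (ballB P.lam) := by
  obtain ⟨h1, h2, h3⟩ := fold_bounds hq
  exact ⟨h1, mem_closedBall_zero_iff.2 h2, mem_closedBall_zero_iff.2 h3⟩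

namespace Orb

/-- The passage from the exit of the block to the entrance section. -/
lemma loop_secU (hg : P.Good mu) (H : Q.Orb mu γ) (h3 : -3 ≤ (γ 0).1) (h4 : (γ 0).1 ≤ 4)
    (hz : (γ 0).2.1 ≠ 0) :
    iso P.cs P.lam P.sig P.k 1 (exitq P mu (γ 0)) ∈ secOver n (ballB P.lam) ∧ ∃ t, 0 < t ∧
      WildLorenz.sh (-1) (γ t) = secU n (iso P.cs P.lam P.sig P.k 1 (exitq P mu (γ 0))) ∧
        ∀ s, 0 < s → s < t → ∀ m q, WildLorenz.sh m (γ s) ≠ secU n q := by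
  obtain ⟨hC, t, ht, he, hlt⟩ := H.loop hg h3 (by linarith) hz
  refine ⟨fold_mem hC, t, ht, ?_, fun s hs hst m q hm => ?_⟩
  · rw [he]
    refine Prod.ext ?_ rfl
    show (-9 : ℝ) - 13 * ((-1 : ℤ) : ℝ) = 4
    norm_num
  -- Until the return the heights lie in (-9, 4), which contains no number congruent to 4 modulo 13.
  · have h1 := hlt s ⟨hs.le, hst⟩
    have h2 := H.h_lt_four hg h4 hs
    have h5 : (γ s).1 - 13 * (m : ℝ) = 4 := congrArg Prod.fst hm
    have h6 : (-1 : ℝ) < m := by linarith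
    have h7 : (m : ℝ) < 0 := by linarith
    have h6' : (-1 : ℤ) < m := by exact_mod_cast h6
    have h7' : m < 0 := by exact_mod_cast h7
    omega

lemma hit_secS (hg : P.Good mu) (H : Q.Orb mu γ) {q : Sec n}
    (hq : q ∈ secOver n (ballB P.lam \ {0})) (h0 : γ 0 = secU n q) : ∃ t, 0 < t ∧
      γ t = secS P (mapThat n P.eta P.sig (P.bet / P.eps) P.lam mu q) ∧
        ∀ s, 0 < s → s < t → ∀ m, ∀ q' ∈ secOver n (annulusB P.lam),
          WildLorenz.sh m (γ s) ≠ secS P q' := by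
  have h1 : ‖q.1‖ ≤ P.R := hq.1.1
  have hz : q.1 ≠ 0 := hq.1.2
  obtain ⟨t, ht, he, hlt⟩ := H.hit hg (by rw [h0]; rfl) (by rw [h0]; exact hz) (by rw [h0]; exact h1)
  refine ⟨t, ht, ?_, fun s hs hst m q' hq' hm => ?_⟩
  · rw [he, h0, secS_mapThat hg.1 hq]
    rfl
  · have h2 := hlt s ⟨hs.le, hst⟩
    have h3 : (γ s).2.1 = (secS P q').2.1 := congrArg (fun p => p.2.1) hm
    have h4 := xx_secS (P.third_of_annulus hq'.1)
    rw [xx, ← h3] at h4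
    have := P.R3_pos
    nlinarith [norm_nonneg (γ s).2.1]

/-- Orbits on the local stable manifold meet the sections at most at the initial time. -/
lemma stable_no_hit (hg : P.Good mu) (H : Q.Orb mu γ) {q : Sec n} (h0 : γ 0 = secU n q)
    (hz : q.1 = 0) {s : ℝ} (hs : 0 < s) (m : ℤ) :
    (∀ q', WildLorenz.sh m (γ s) ≠ secU n q') ∧
      ∀ q' ∈ secOver n (annulusB P.lam), WildLorenz.sh m (γ s) ≠ secS P q' := by
  have e : (γ 0).1 = 4 := by rw [h0]; rfl
  obtain ⟨h1, h2, h3⟩ := H.stable_mem hg (by rw [e]; norm_num) (by rw [e]; norm_num)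
    (by rw [h0]; exact hz) hs.le
  constructor
  · intro q' hm
    have h4 := H.h_lt_four hg e.le hs
    have h5 : (γ s).1 - 13 * (m : ℝ) = 4 := congrArg Prod.fst hm
    have h6 : (-1 : ℝ) < m := by linarith
    have h7 : (m : ℝ) < 0 := by linarith
    have h6' : (-1 : ℤ) < m := by exact_mod_cast h6
    have h7' : m < 0 := by exact_mod_cast h7
    omega
  · intro q' hq' hm
    have h3 : (γ s).2.1 = (secS P q').2.1 := congrArg (fun p => p.2.1) hm
    have h4 := xx_secS (P.third_of_annulus hq'.1)
    rw [xx, ← h3, h1, norm_zero] at h4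
    have := P.R3_pos
    nlinarith

/-- Every orbit meets the entrance section or lies on the local stable manifold. -/
lemma secU_or_stable (hg : P.Good mu) (H : Q.Orb mu γ) (h3 : -3 ≤ (γ 0).1) (h10 : (γ 0).1 < 10) :
    (∃ t, 0 ≤ t ∧ ∃ m, ∃ q ∈ secOver n (ballB P.lam), WildLorenz.sh m (γ t) = secU n q) ∨
      ((γ 0).2.1 = 0 ∧ -1 < (γ 0).1 ∧ (γ 0).1 < 7) := by
  rcases lt_or_ge (γ 0).1 7 with h7 | h7
  · rcases eq_or_ne (γ 0).2.1 0 with hz | hz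
    · right
      refine ⟨hz, ?_, h7⟩
      have hx : xx (γ 0) = 0 := by simp [xx, hz]
      have hV := inV_iff.2 (H.block le_rfl (by linarith) (by linarith)).2
      have h1 := hV.I0_gt'
      rw [hx, I0, ps_of_nonpos (P.tt_zero _).le] at h1
      have := P.cs_le_one
      linarith
    · left
      obtain ⟨hC, t, ht, he, -⟩ := H.loop hg h3 h7.le hz
      refine ⟨t, ht.le, -1, _, fold_mem hC, ?_⟩
      rw [he]
      refine Prod.ext ?_ rfl
      show (-9 : ℝ) - 13 * ((-1 : ℤ) : ℝ) = 4
      norm_num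
  · left
    obtain ⟨-, hC, he⟩ := H.tube h7 (by linarith)
    refine ⟨(γ 0).1 - 4, by linarith, 0, _, fold_mem hC, ?_⟩
    rw [he _ ⟨by linarith, le_rfl⟩, sub_sub_cancel, emb_high (by norm_num)]
    refine Prod.ext ?_ rfl
    show (4 : ℝ) - 13 * ((0 : ℤ) : ℝ) = 4
    norm_num

end Orb

end Tube

/-! ### Transport to the solid torus -/

lemma sh_sh {n : ℕ} (k m : ℤ) (p : Mod n) : sh k (sh m p) = sh (k + m) p := by
  refine Prod.ext ?_ rfl
  simp only [sh]; push_cast; ring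

lemma sh_zero {n : ℕ} (p : Mod n) : sh 0 p = p := by simp [sh]

section transport
variable {n : ℕ} (L : Sec n ≃L[ℝ] EuclideanSpace ℝ (Fin (n - 1)))

/-- The linear isomorphism of the model with the universal cover of the solid torus. -/
def toCover : Mod n ≃L[ℝ] Cover n :=
  (ContinuousLinearEquiv.smulLeft (Units.mk0 (13⁻¹ : ℝ) (by norm_num))).prodCongr L

lemma toCover_apply (p : Mod n) : toCover L p = (13⁻¹ * p.1, L p.2) := rfl

def toAmb (p : Mod n) : Ambient n := proj (toCover L p)

variable {L}

lemma proj_eq (x : Cover n) : proj x = toAmb L ((toCover L).symm x) := by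
  rw [toAmb, ContinuousLinearEquiv.apply_symm_apply]

lemma isOpenQuotientMap_toAmb : IsOpenQuotientMap (toAmb L) := by
  have h1 : IsOpenQuotientMap (proj (n := n)) := by
    have h := (QuotientAddGroup.isOpenQuotientMap_mk (N := AddSubgroup.zmultiples (1 : ℝ))).prodMap
      (IsOpenQuotientMap.id (X := EuclideanSpace ℝ (Fin (n - 1))))
    exact h
  exact h1.comp (toCover L).toHomeomorph.isOpenQuotientMap

lemma toAmb_eq_iff {p q : Mod n} : toAmb L p = toAmb L q ↔ ∃ m, sh m p = q := by
  rw [toAmb, toAmb, proj, proj, Prod.ext_iff]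
  simp only [toCover_apply, EmbeddingLike.apply_eq_iff_eq]
  rw [← sub_eq_zero, ← AddCircle.coe_sub, AddCircle.coe_eq_zero_iff]
  constructor
  · rintro ⟨⟨m, hm⟩, h2⟩
    refine ⟨m, Prod.ext ?_ h2⟩
    simp only [zsmul_eq_mul, mul_one] at hm
    simp only [sh]; rw [hm]; ring
  · rintro ⟨m, rfl⟩
    refine ⟨⟨m, ?_⟩, rfl⟩
    simp only [sh, zsmul_eq_mul]; ring

variable (L) in
/-- A point of the model over a point of the solid torus. -/
def rep (y : Ambient n) : Mod n := Function.surjInv (isOpenQuotientMap_toAmb (L := L)).surjective y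

lemma toAmb_rep (y : Ambient n) : toAmb L (rep L y) = y :=
  Function.surjInv_eq isOpenQuotientMap_toAmb.surjective y

lemma rep_toAmb (p : Mod n) : ∃ m, rep L (toAmb L p) = sh m p := by
  obtain ⟨m, hm⟩ := toAmb_eq_iff.1 (toAmb_rep (toAmb L p)).symm
  exact ⟨m, hm.symm⟩

namespace Tube
open Par
variable {P : Par} (Q : Tube n P)

variable (L) in
/-- The field on the solid torus. -/
def field (mu : ℝ) (y : Ambient n) : Cover n := toCover L (Q.Yp mu (rep L y))

variable (L) in
/-- The region `c < Thp` of the solid torus. -/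
def region (c : ℝ) : Set (Ambient n) := {y | c < Q.Thp (rep L y)}

variable (L) in
/-- The region near the singularity used to define the local stable manifold. -/
def nearSet : Set (Ambient n) :=
  {y | y ∈ Q.region L (1 / 2) ∧ ∃ m, -1 < (sh m (rep L y)).1 ∧ (sh m (rep L y)).1 < 7}

variable (L) in
/-- The local stable manifold. -/
def stableSet : Set (Ambient n) := {y | y ∈ Q.nearSet L ∧ (rep L y).2.1 = 0}

variable {Q} {mu c : ℝ}

lemma field_toAmb (p : Mod n) : Q.field L mu (toAmb L p) = toCover L (Q.Yp mu p) := by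
  obtain ⟨m, hm⟩ := rep_toAmb (L := L) p
  rw [field, hm, Yp_sh]

lemma liftField_field (x : Cover n) :
    liftField (Q.field L mu) x = toCover L (Q.Yp mu ((toCover L).symm x)) := by
  rw [liftField, proj_eq (L := L), field_toAmb]

lemma mem_region {p : Mod n} : toAmb L p ∈ Q.region L c ↔ c < Q.Thp p := by
  obtain ⟨m, hm⟩ := rep_toAmb (L := L) p
  show c < Q.Thp _ ↔ _
  rw [hm, Thp_sh]

lemma mem_nearSet {p : Mod n} : toAmb L p ∈ Q.nearSet L ↔
    1 / 2 < Q.Thp p ∧ ∃ m, -1 < (sh m p).1 ∧ (sh m p).1 < 7 := by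
  obtain ⟨m, hm⟩ := rep_toAmb (L := L) p
  show (toAmb L p ∈ Q.region L (1 / 2) ∧ _) ↔ _
  rw [mem_region, hm]
  refine and_congr_right fun _ => ⟨?_, ?_⟩
  · rintro ⟨k, hk⟩
    rw [sh_sh] at hk
    exact ⟨_, hk⟩
  · rintro ⟨k, hk⟩
    refine ⟨k - m, ?_⟩
    rwa [sh_sh, sub_add_cancel]

lemma mem_stableSet {p : Mod n} : toAmb L p ∈ Q.stableSet L ↔
    (1 / 2 < Q.Thp p ∧ ∃ m, -1 < (sh m p).1 ∧ (sh m p).1 < 7) ∧ p.2.1 = 0 := by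
  obtain ⟨m, hm⟩ := rep_toAmb (L := L) p
  show (toAmb L p ∈ Q.nearSet L ∧ _) ↔ _
  rw [mem_nearSet, hm]
  rfl

lemma continuous_Thp_rep : Continuous (fun y => Q.Thp (rep L y)) := by
  refine (isOpenQuotientMap_toAmb (L := L)).continuous_comp_iff.1 ?_
  refine (contDiff_Thp (Q := Q)).continuous.congr fun p => ?_
  obtain ⟨m, hm⟩ := rep_toAmb (L := L) p
  simp only [Function.comp, hm, Thp_sh]

lemma isOpen_region : IsOpen (Q.region L c) := isOpen_lt continuous_const continuous_Thp_rep

lemma closure_region_subset {d : ℝ} (h : d < c) : closure (Q.region L c) ⊆ Q.region L d := by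
  intro y hy
  exact h.trans_le (closure_lt_subset_le continuous_const continuous_Thp_rep hy)

lemma Thp_of_mem_frontier {x : Cover n} (hx : proj x ∈ frontier (Q.region L c)) :
    Q.Thp ((toCover L).symm x) = c := by
  have h := frontier_lt_subset_eq continuous_const (continuous_Thp_rep (L := L) (Q := Q)) hx
  rw [proj_eq (L := L)] at h
  obtain ⟨m, hm⟩ := rep_toAmb (L := L) ((toCover L).symm x)
  have h' : c = Q.Thp (rep L (toAmb L ((toCover L).symm x))) := h
  rw [hm, Thp_sh] at h'
  exact h'.symm

lemma isOpen_nearSet : IsOpen (Q.nearSet L) := by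
  rw [← isOpenQuotientMap_toAmb.isQuotientMap.isOpen_preimage (f := toAmb L)]
  have : toAmb L ⁻¹' Q.nearSet L = {p | 1 / 2 < Q.Thp p} ∩
      ⋃ m : ℤ, (fun p => (sh m p).1) ⁻¹' Ioo (-1) 7 := by
    ext p
    rw [mem_preimage, mem_nearSet]
    simp
  rw [this]
  refine (isOpen_lt continuous_const contDiff_Thp.continuous).inter (isOpen_iUnion fun m => ?_)
  exact isOpen_Ioo.preimage (contDiff_sh m).continuous.fst

lemma hasFDerivAt_Thp_symm (x : Cover n) : HasFDerivAt (fun y => 1 / 2 - Q.Thp ((toCover L).symm y))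
    (-((fderiv ℝ Q.Thp ((toCover L).symm x)).comp
      ((toCover L).symm : Cover n →L[ℝ] Mod n))) x :=
  (((contDiff_Thp (Q := Q)).differentiable (by simp) _).hasFDerivAt.comp x
    ((toCover L).symm : Cover n →L[ℝ] Mod n).hasFDerivAt).const_sub _

lemma boundary (hg : P.Good mu) {x : Cover n} (hx : proj x ∈ frontier (Q.region L (1 / 2))) :
    IsBoundaryFunctionAt (Q.region L (1 / 2)) x (fun y => 1 / 2 - Q.Thp ((toCover L).symm y)) ∧
      fderiv ℝ (fun y => 1 / 2 - Q.Thp ((toCover L).symm y)) x (liftField (Q.field L mu) x) < 0 := by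
  have hT := Thp_of_mem_frontier hx
  have hneg : fderiv ℝ (fun y => 1 / 2 - Q.Thp ((toCover L).symm y)) x
      (liftField (Q.field L mu) x) < 0 := by
    rw [(hasFDerivAt_Thp_symm x).fderiv, liftField_field]
    have := fderiv_Thp (Q := Q) hg (p := (toCover L).symm x) (by rw [hT]; norm_num)
      (by rw [hT]; norm_num)
    simpa using this
  refine ⟨⟨by simp only [hT, sub_self], ?_, univ, isOpen_univ, mem_univ _, ?_, ?_⟩, hneg⟩
  · intro h0
    rw [h0] at hneg
    exact lt_irrefl _ hneg
  · exact (contDiff_const.sub (contDiff_Thp.comp (toCover L).symm.contDiff)).contDiffOn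
  · intro y _
    rw [proj_eq (L := L), mem_region, sub_neg]

lemma isSmoothFamily_field (I : Set ℝ) (V : Set (Ambient n)) :
    IsSmoothFamily (Q.field L) I V := by
  have h : ContDiff ℝ ∞ (fun p : ℝ × Cover n => toCover L (Q.Yp p.1 ((toCover L).symm p.2))) := by
    have h1 : ContDiff ℝ ∞ (fun p : ℝ × Cover n => (p.1, (toCover L).symm p.2)) :=
      contDiff_fst.prodMk ((toCover L).symm.contDiff.comp contDiff_snd)
    have h2 : ContDiff ℝ ∞ (fun p : ℝ × Cover n => Q.Yp p.1 ((toCover L).symm p.2)) :=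
      ContDiff.comp (g := fun y : ℝ × Mod n => Q.Yp y.1 y.2)
        (f := fun p : ℝ × Cover n => (p.1, (toCover L).symm p.2)) contDiff_Yp h1
    exact (toCover L).contDiff.comp h2
  exact h.contDiffOn.congr fun p _ => liftField_field p.2

/-! ### Orbits -/

lemma isForwardOrbit_of_orb {γ : ℝ → Mod n} (H : Q.Orb mu γ) {N : Set (Ambient n)}
    (hN : ∀ t, 0 ≤ t → toAmb L (γ t) ∈ N) :
    IsForwardOrbit (Q.field L mu) N (fun t => toCover L (γ t)) := by
  refine ⟨fun t _ => ?_, hN⟩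
  show HasDerivWithinAt _ (liftField (Q.field L mu) (toCover L (γ t))) _ _
  rw [liftField_field, ContinuousLinearEquiv.symm_apply_apply]
  exact (((toCover L : Mod n →L[ℝ] Cover n).hasFDerivAt).comp_hasDerivAt t
    (H.deriv t)).hasDerivWithinAt

lemma isForwardOrbit_region {γ : ℝ → Mod n} (H : Q.Orb mu γ) :
    IsForwardOrbit (Q.field L mu) (Q.region L (1 / 2)) (fun t => toCover L (γ t)) :=
  isForwardOrbit_of_orb H fun t ht => mem_region.2 (H.inU t ht)

lemma hasDerivAt_of_isForwardOrbit {δ : ℝ → Cover n} {N : Set (Ambient n)}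
    (h : IsForwardOrbit (Q.field L mu) N δ) {t : ℝ} (ht : 0 < t) :
    HasDerivAt (fun t => (toCover L).symm (δ t)) (Q.Yp mu ((toCover L).symm (δ t))) t := by
  have h1 := (h.1 t ht.le).hasDerivAt (Ici_mem_nhds ht)
  have h2 := ((toCover L).symm : Cover n →L[ℝ] Mod n).hasFDerivAt.comp_hasDerivAt t h1
  have e := congrArg (toCover L).symm (liftField_field (L := L) (Q := Q) (mu := mu) (δ t))
  rw [ContinuousLinearEquiv.symm_apply_apply] at e
  rw [← e]
  exact h2

lemma continuousOn_of_isForwardOrbit {δ : ℝ → Cover n} {N : Set (Ambient n)}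
    (h : IsForwardOrbit (Q.field L mu) N δ) :
    ContinuousOn (fun t => (toCover L).symm (δ t)) (Ici 0) :=
  (toCover L).symm.continuous.comp_continuousOn fun t ht => (h.1 t ht).continuousWithinAt

/-- A continuous path that stays in `⋃ m, (13 m - 1, 13 m + 7)` stays in one of the intervals. -/
lemma stay_of_stay {f : ℝ → ℝ} (hf : ContinuousOn f (Ici 0)) (h0 : -1 < f 0 ∧ f 0 < 7)
    (h : ∀ t, 0 ≤ t → ∃ m : ℤ, -1 < f t - 13 * m ∧ f t - 13 * m < 7) {t : ℝ} (ht : 0 ≤ t) :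
    -1 < f t ∧ f t < 7 := by
  have hc : ContinuousOn f (Icc 0 t) := hf.mono Icc_subset_Ici_self
  by_contra hcon
  have key : ∀ s, 0 ≤ s → f s ≠ 7 ∧ f s ≠ -1 := by
    intro s hs
    obtain ⟨m, h1, h2⟩ := h s hs
    constructor
    · intro h7
      rw [h7] at h1 h2
      have h1' : (m : ℝ) < 1 := by linarith
      have h2' : (0 : ℝ) < m := by linarith
      have h3 : m < 1 := by exact_mod_cast h1'
      have h4 : 0 < m := by exact_mod_cast h2'
      omega
    · intro h7
      rw [h7] at h1 h2
      have h1' : (m : ℝ) < 0 := by linarith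
      have h2' : (-1 : ℝ) < m := by linarith
      have h3 : m < 0 := by exact_mod_cast h1'
      have h4 : -1 < m := by exact_mod_cast h2'
      omega
  rcases le_or_gt (f t) (-1) with h1 | h1
  · obtain ⟨s, hs, he⟩ := intermediate_value_Icc' ht hc ⟨h1, h0.1.le⟩
    exact (key s hs.1).2 he
  · have h7 : 7 ≤ f t := by
      by_contra h7
      exact hcon ⟨h1, not_le.1 h7⟩
    obtain ⟨s, hs, he⟩ := intermediate_value_Icc ht hc ⟨h0.2.le, h7⟩
    exact (key s hs.1).1 he

variable (L) in
/-- The `z`-coordinate as a vector of the Euclidean plane. -/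
def zCoord : Cover n →L[ℝ] EuclideanSpace ℝ (Fin 2) :=
  ((Complex.orthonormalBasisOneI.repr.toContinuousLinearEquiv : ℂ →L[ℝ] EuclideanSpace ℝ (Fin 2)).comp
    ((ContinuousLinearMap.fst ℝ ℂ (ℂ × EuclideanSpace ℝ (Fin (n - 5)))).comp
      (ContinuousLinearMap.snd ℝ ℝ (Sec n)))).comp ((toCover L).symm : Cover n →L[ℝ] Mod n)

lemma zCoord_apply (x : Cover n) :
    zCoord L x = Complex.orthonormalBasisOneI.repr ((toCover L).symm x).2.1 := rfl

lemma zCoord_surjective : Function.Surjective (zCoord L) := by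
  intro y
  refine ⟨toCover L (0, Complex.orthonormalBasisOneI.repr.symm y, 0), ?_⟩
  rw [zCoord_apply, ContinuousLinearEquiv.symm_apply_apply, LinearIsometryEquiv.apply_symm_apply]

lemma isSubmanifold_stableSet : IsSubmanifoldOfCodim 2 (Q.stableSet L) := by
  intro x hx
  refine ⟨proj ⁻¹' Q.nearSet L, zCoord L, ?_, hx.1, (zCoord L).contDiff.contDiffOn, ?_, ?_⟩
  · have : proj ⁻¹' Q.nearSet L = (toCover L).symm ⁻¹' (toAmb L ⁻¹' Q.nearSet L) := by
      ext y; rw [mem_preimage, proj_eq (L := L)]; rfl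
    rw [this]
    exact (isOpen_nearSet.preimage isOpenQuotientMap_toAmb.continuous).preimage
      (toCover L).symm.continuous
  · rw [ContinuousLinearMap.fderiv]; exact zCoord_surjective
  · intro y hy
    rw [mem_preimage, proj_eq (L := L), mem_nearSet] at hy
    rw [proj_eq (L := L), mem_stableSet, zCoord_apply, map_eq_zero_iff _ (LinearIsometryEquiv.injective _)]
    exact and_iff_right hy

lemma stable_stays (hg : P.Good mu) {γ : ℝ → Mod n} (H : Q.Orb mu γ) (h1 : -1 < (γ 0).1)
    (h7 : (γ 0).1 < 7) (hz : (γ 0).2.1 = 0) {t : ℝ} (ht : 0 ≤ t) :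
    toAmb L (γ t) ∈ Q.stableSet L := by
  obtain ⟨a, b, c⟩ := H.stable_mem hg h1 h7 hz ht
  exact mem_stableSet.2 ⟨⟨H.inU t ht, 0, by rwa [sh_zero], by rwa [sh_zero]⟩, a⟩

/-- The neighbourhood is `nearSet`. Points with z = 0 stay there and converge. Conversely, the lift
of an orbit that stays in it remains in a single height window (`stay_of_stay`), where z ≠ 0
contradicts the boundedness of T. -/
lemma isLocalStableManifold (hg : P.Good mu) :
    IsLocalStableManifold (Q.field L mu) (Q.region L (1 / 2)) (proj (toCover L 0)) 2
      (Q.stableSet L) := by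
  refine ⟨isSubmanifold_stableSet, Q.nearSet L, isOpen_nearSet, ?_, fun _ h => h.1, ?_⟩
  · show toAmb L 0 ∈ _
    rw [mem_nearSet, Thp_zero]
    exact ⟨by norm_num, 0, by simp [sh], by simp [sh]⟩
  intro y
  obtain ⟨p, rfl⟩ := (isOpenQuotientMap_toAmb (L := L)).surjective y
  constructor
  · intro hp
    obtain ⟨⟨hU, m, h1, h7⟩, hz⟩ := mem_stableSet.1 hp
    obtain ⟨γ, h0, H⟩ := exists_orb (Q := Q) hg (p := sh m p) (by rwa [Thp_sh])
    have hs : ∀ t, 0 ≤ t → toAmb L (γ t) ∈ Q.stableSet L := fun t ht =>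
      stable_stays hg H (by rwa [h0]) (by rwa [h0]) (by rw [h0]; exact hz) ht
    refine ⟨fun t => toCover L (γ t), ?_, isForwardOrbit_of_orb H fun t ht => (hs t ht).1, ?_⟩
    · show toAmb L (γ 0) = toAmb L p
      rw [h0]
      exact (toAmb_eq_iff.2 ⟨m, rfl⟩).symm
    · have := H.stable_tendsto hg (by rwa [h0]) (by rwa [h0]) (by rw [h0]; exact hz)
      exact ((isOpenQuotientMap_toAmb (L := L)).continuous.tendsto 0).comp this
  · rintro ⟨δ, h0, hδ, -⟩
    set γ : ℝ → Mod n := fun t => (toCover L).symm (δ t) with hγ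
    have hp : ∀ t, proj (δ t) = toAmb L (γ t) := fun t => proj_eq _
    have hN : ∀ t, 0 ≤ t → 1 / 2 < Q.Thp (γ t) ∧ ∃ m, -1 < (sh m (γ t)).1 ∧ (sh m (γ t)).1 < 7 := by
      intro t ht
      have := hδ.2 t ht
      rwa [hp, mem_nearSet] at this
    obtain ⟨m, hm⟩ := (hN 0 le_rfl).2
    have hc := continuousOn_of_isForwardOrbit hδ
    have hstay : ∀ t, 0 ≤ t → -1 < (sh m (γ t)).1 ∧ (sh m (γ t)).1 < 7 := by
      intro t ht
      refine stay_of_stay (f := fun t => (sh m (γ t)).1) ?_ hm (fun s hs => ?_) ht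
      · exact ((contDiff_sh m).continuous.fst).comp_continuousOn hc
      · obtain ⟨k, hk⟩ := (hN s hs).2
        refine ⟨k - m, ?_⟩
        rw [← sub_add_cancel k m, ← sh_sh] at hk
        exact hk
    have hz := z_zero_of_stay (Q := Q) (γ := fun t => sh m (γ t)) hg
      ((contDiff_sh m).continuous.comp_continuousOn hc) (fun t ht => by
        have h1 := hasDerivAt_of_isForwardOrbit hδ ht
        simp only [Yp_sh]
        have h := h1.add_const ((-(13 * (m : ℝ)), 0) : Mod n)
        simpa only [sh_eq] using h) (fun t ht => by rw [Thp_sh]; exact (hN t ht).1) hstay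
    rw [← h0, hp]
    exact mem_stableSet.2 ⟨hN 0 le_rfl, hz⟩

/-! ### The singularity -/

lemma fderiv_field : linearPart (Q.field L mu) (toCover L 0) =
    (toCover L).toLinearEquiv.conj (linB n P mu).toLinearMap := by
  have h : liftField (Q.field L mu) =ᶠ[𝓝 (toCover L 0)]
      ((toCover L : Mod n →L[ℝ] Cover n).comp ((linB n P mu).comp
        ((toCover L).symm : Cover n →L[ℝ] Mod n))) := by
    have ht : Tendsto (toCover L).symm (𝓝 (toCover L 0)) (𝓝 (0 : Mod n)) := by
      have := (toCover L).symm.continuous.tendsto (toCover L 0)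
      rwa [ContinuousLinearEquiv.symm_apply_apply] at this
    filter_upwards [ht.eventually (eventually_Yp (Q := Q) (mu := mu))] with x hx
    rw [liftField_field, hx]
    rfl
  rw [linearPart, h.fderiv_eq, ContinuousLinearMap.fderiv]
  rfl

lemma charpoly_smul_id {M : Type*} [AddCommGroup M] [Module ℝ M] [Module.Finite ℝ M] (a : ℝ) :
    (a • (LinearMap.id : M →ₗ[ℝ] M)).charpoly =
      (Polynomial.X - Polynomial.C a) ^ Module.finrank ℝ M := by
  have h : LinearMap.toMatrix (Module.finBasis ℝ M) (Module.finBasis ℝ M)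
      (a • (LinearMap.id : M →ₗ[ℝ] M)) = Matrix.diagonal fun _ => a := by
    rw [map_smul, LinearMap.toMatrix_id, Matrix.smul_one_eq_diagonal]
  rw [← LinearMap.charpoly_toMatrix _ (Module.finBasis ℝ M), h, Matrix.charpoly_diagonal]
  simp

lemma charpoly_linB (hn : 5 ≤ n) : (linB n P mu).toLinearMap.charpoly =
    (Polynomial.X - Polynomial.C (-mu)) * (Polynomial.X - Polynomial.C P.sig) ^ 2 *
      (Polynomial.X - Polynomial.C (-P.eta)) ^ (n - 3) := by
  have e : (linB n P mu).toLinearMap = ((-mu) • (LinearMap.id : ℝ →ₗ[ℝ] ℝ)).prodMap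
      ((P.sig • (LinearMap.id : ℂ →ₗ[ℝ] ℂ)).prodMap ((-P.eta) •
        (LinearMap.id : (ℂ × EuclideanSpace ℝ (Fin (n - 5))) →ₗ[ℝ] _))) := rfl
  rw [e, LinearMap.charpoly_prodMap, LinearMap.charpoly_prodMap, charpoly_smul_id, charpoly_smul_id,
    charpoly_smul_id, Module.finrank_self, Module.finrank_prod, Complex.finrank_real_complex,
    finrank_euclideanSpace_fin, pow_one, mul_assoc, show 2 + (n - 5) = n - 3 by omega]

lemma charpoly_field (hn : 5 ≤ n) : (linearPart (Q.field L mu) (toCover L 0)).charpoly =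
    (Polynomial.X - Polynomial.C (-mu)) * (Polynomial.X - Polynomial.C P.sig) ^ 2 *
      (Polynomial.X - Polynomial.C (-P.eta)) ^ (n - 3) := by
  rw [fderiv_field, LinearEquiv.charpoly_conj, charpoly_linB hn]

lemma field_zero : liftField (Q.field L mu) (toCover L 0) = 0 := by
  rw [liftField_field, ContinuousLinearEquiv.symm_apply_apply,
    eventually_Yp.self_of_nhds, map_zero, map_zero]

lemma isHyperbolicSingularity (hn : 5 ≤ n) (hmu : 0 < mu) :
    IsHyperbolicSingularity (Q.field L mu) (toCover L 0) := by
  refine ⟨field_zero, fun c hc => ?_⟩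
  rw [charpoly_field hn] at hc
  simp only [Polynomial.map_mul, Polynomial.map_pow, Polynomial.map_sub, Polynomial.map_X,
    Polynomial.map_C, Polynomial.IsRoot, Polynomial.eval_mul, Polynomial.eval_pow,
    Polynomial.eval_sub, Polynomial.eval_X, Polynomial.eval_C, mul_eq_zero] at hc
  have hs := P.sig_pos
  have he := P.eta_pos
  rcases hc with (hc | hc) | hc
  · rw [sub_eq_zero.1 hc]; simp; linarith
  · rw [sub_eq_zero.1 (pow_eq_zero_iff (by norm_num) |>.1 hc)]; simp; linarith
  · rw [sub_eq_zero.1 (eq_zero_of_pow_eq_zero hc)]; simp; linarith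

lemma field_eq_zero_iff (hg : P.Good mu) {y : Ambient n} (hy : y ∈ Q.region L (1 / 4)) :
    Q.field L mu y = 0 ↔ y = proj (toCover L 0) := by
  obtain ⟨p, rfl⟩ := (isOpenQuotientMap_toAmb (L := L)).surjective y
  rw [field_toAmb, map_eq_zero_iff _ (toCover L).injective, Yp_eq_zero_iff hg (mem_region.1 hy)]
  exact toAmb_eq_iff.symm

end Tube
end transport

section transport
variable {n : ℕ} {L : Sec n ≃L[ℝ] EuclideanSpace ℝ (Fin (n - 1))}

namespace Tube
open Par
variable {P : Par} {Q : Tube n P} {mu : ℝ}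

lemma isCrossSection {s : Sec n → Mod n} {A : Set (Sec n)} (hs : ContDiff ℝ ∞ s)
    (hinj : ∀ q ∈ A, ∀ q' ∈ A, ∀ m, sh m (s q) = s q' → q = q') (hT : ∀ q ∈ A, Q.Thp (s q) = 1)
    (ht : ∀ q ∈ A, Function.Injective (fderiv ℝ s q) ∧ Q.Yp mu (s q) ∉ range (fderiv ℝ s q)) :
    IsCrossSection (Q.field L mu) (Q.region L (1 / 2)) (fun q => toCover L (s q)) A := by
  refine ⟨(toCover L).contDiff.comp hs, fun q hq q' hq' h => ?_, ?_, fun q hq => ?_⟩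
  · obtain ⟨m, hm⟩ := toAmb_eq_iff.1 h
    exact hinj q hq q' hq' m hm
  · rintro _ ⟨q, hq, rfl⟩
    exact mem_region.2 (by rw [hT q hq]; norm_num)
  · have hd : HasFDerivAt (fun q => toCover L (s q))
        ((toCover L : Mod n →L[ℝ] Cover n).comp (fderiv ℝ s q)) q :=
      (toCover L : Mod n →L[ℝ] Cover n).hasFDerivAt.comp q
        (hs.differentiable (by simp) q).hasFDerivAt
    rw [hd.fderiv, liftField_field, ContinuousLinearEquiv.symm_apply_apply]
    refine ⟨(toCover L).injective.comp (ht q hq).1, ?_⟩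
    rintro ⟨v, hv⟩
    exact (ht q hq).2 ⟨v, (toCover L).injective hv⟩

lemma isCrossSection_secU : IsCrossSection (Q.field L mu) (Q.region L (1 / 2))
    (fun q => toCover L (secU n q)) (secOver n (ballB P.lam)) :=
  isCrossSection contDiff_secU (fun _ _ _ _ _ h => congrArg Prod.snd h) (fun _ => Thp_secU)
    fun _ => secU_transversal

lemma isCrossSection_secS : IsCrossSection (Q.field L mu) (Q.region L (1 / 2))
    (fun q => toCover L (secS P q)) (secOver n (annulusB P.lam)) := by
  refine isCrossSection contDiff_secS (fun q hq q' hq' m h => ?_) (fun _ => Thp_secS)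
    fun _ => secS_transversal
  have h3 := P.third_of_annulus hq.1
  have h3' := P.third_of_annulus hq'.1
  have h1 : (secS P q).1 - 13 * (m : ℝ) = (secS P q').1 := congrArg Prod.fst h
  rw [secS_eq h3, secS_eq h3'] at h1
  obtain ⟨a, b⟩ := P.II_abs_of_annulus hq.1
  obtain ⟨a', b'⟩ := P.II_abs_of_annulus hq'.1
  simp only at h1
  have hm : m = 0 := by
    have h4 : (m : ℝ) < 1 := by linarith
    have h5 : (-1 : ℝ) < m := by linarith
    have h4' : m < 1 := by exact_mod_cast h4
    have h5' : -1 < m := by exact_mod_cast h5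
    omega
  rw [hm, sh_zero] at h
  rw [← retS_secS h3, h, retS_secS h3']

lemma notMem_sectionSet {s : Sec n → Mod n} {A : Set (Sec n)} {p : Mod n}
    (h : ∀ m, ∀ q ∈ A, sh m p ≠ s q) :
    proj (toCover L p) ∉ sectionSet (fun q => toCover L (s q)) A := by
  rintro ⟨q, hq, he⟩
  obtain ⟨m, hm⟩ := toAmb_eq_iff.1 he.symm
  exact h m q hq hm

lemma secOver_mono {A B : Set ℂ} (h : A ⊆ B) : secOver n A ⊆ secOver n B :=
  prod_mono h Subset.rfl

lemma z_eq_zero {A : Set ℂ} {q : Sec n} (hq : q ∈ secOver n A \ secOver n (A \ {0})) : q.1 = 0 := by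
  by_contra hz
  exact hq.2 ⟨⟨hq.1.1, hz⟩, hq.1.2⟩

lemma exists_orb_secU (hg : P.Good mu) {q : Sec n} (hq : q ∈ secOver n (ballB P.lam)) :
    ∃ γ, γ 0 = secU n q ∧ Q.Orb mu γ :=
  exists_orb hg (by rw [Thp_secU hq]; norm_num)

lemma poincare_US (hg : P.Good mu) : IsPoincareMap (Q.field L mu) (Q.region L (1 / 2))
    (fun q => toCover L (secU n q)) (secOver n (ballB P.lam))
    (fun q => toCover L (secS P q)) (secOver n (annulusB P.lam))
    (secOver n (ballB P.lam \ {0})) (mapThat n P.eta P.sig (P.bet / P.eps) P.lam mu) := by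
  refine ⟨secOver_mono sdiff_subset, fun q hq => mapThat_mem hg.1 hq, fun q hq => ?_, fun q hq => ?_⟩
  · obtain ⟨γ, h0, H⟩ := exists_orb_secU (Q := Q) hg (secOver_mono sdiff_subset hq)
    obtain ⟨t, ht, he, hn⟩ := H.hit_secS hg hq h0
    refine ⟨_, isForwardOrbit_region (L := L) H, by rw [h0], t, ht, by rw [he], fun s hs hst => ?_⟩
    exact notMem_sectionSet (hn s hs hst)
  · obtain ⟨γ, h0, H⟩ := exists_orb_secU (Q := Q) hg hq.1
    refine ⟨_, isForwardOrbit_region (L := L) H, by rw [h0], fun s hs => ?_⟩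
    exact notMem_sectionSet fun m => (H.stable_no_hit hg h0 (z_eq_zero hq) hs m).2

lemma poincare_SU (hg : P.Good mu) : IsPoincareMap (Q.field L mu) (Q.region L (1 / 2))
    (fun q => toCover L (secS P q)) (secOver n (annulusB P.lam))
    (fun q => toCover L (secU n q)) (secOver n (ballB P.lam))
    (secOver n (annulusB P.lam)) (mapGhat n P.eps) := by
  have key : ∀ q ∈ secOver n (annulusB P.lam), mapGhat n P.eps q ∈ secOver n (ballB P.lam) ∧
      ∃ γ : ℝ → Cover n, IsForwardOrbit (Q.field L mu) (Q.region L (1 / 2)) γ ∧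
        proj (γ 0) = proj (toCover L (secS P q)) ∧ ∃ t : ℝ, 0 < t ∧
          proj (γ t) = proj (toCover L (secU n (mapGhat n P.eps q))) ∧ ∀ s : ℝ, 0 < s → s < t →
            proj (γ s) ∉ sectionSet (fun q => toCover L (secU n q)) (secOver n (ballB P.lam)) := by
    intro q hq
    obtain ⟨γ, h0, H⟩ := exists_orb (Q := Q) hg (p := secS P q) (by rw [Thp_secS hq]; norm_num)
    have h3 := P.third_of_annulus hq.1
    obtain ⟨a, b⟩ := P.II_abs_of_annulus hq.1
    have hf : (secS P q).1 = P.II ‖q.1‖ := by rw [secS_eq h3]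
    have hz : (secS P q).2.1 ≠ 0 := by
      intro hz
      have := xx_secS h3
      rw [xx, hz, norm_zero] at this
      have := P.R3_pos
      nlinarith
    obtain ⟨hm, t, ht, he, hn⟩ := H.loop_secU hg (by rw [h0, hf]; linarith)
      (by rw [h0, hf]; linarith) (by rwa [h0])
    rw [h0, exitq_secS hq] at hm he
    refine ⟨hm, _, isForwardOrbit_region (L := L) H, by rw [h0], t, ht, toAmb_eq_iff.2 ⟨_, he⟩,
      fun s hs hst => notMem_sectionSet fun m q _ => hn s hs hst m q⟩
  refine ⟨Subset.rfl, fun q hq => (key q hq).1, fun q hq => (key q hq).2, fun q hq => ?_⟩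
  exact absurd hq.1 hq.2

lemma poincare_UU (hg : P.Good mu) : IsPoincareMap (Q.field L mu) (Q.region L (1 / 2))
    (fun q => toCover L (secU n q)) (secOver n (ballB P.lam))
    (fun q => toCover L (secU n q)) (secOver n (ballB P.lam))
    (secOver n (ballB P.lam \ {0})) (mapFhat n P.eta P.sig P.bet P.lam mu) := by
  have key : ∀ q ∈ secOver n (ballB P.lam \ {0}),
      mapFhat n P.eta P.sig P.bet P.lam mu q ∈ secOver n (ballB P.lam) ∧
      ∃ γ : ℝ → Cover n, IsForwardOrbit (Q.field L mu) (Q.region L (1 / 2)) γ ∧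
        proj (γ 0) = proj (toCover L (secU n q)) ∧ ∃ t : ℝ, 0 < t ∧
          proj (γ t) = proj (toCover L (secU n (mapFhat n P.eta P.sig P.bet P.lam mu q))) ∧
          ∀ s : ℝ, 0 < s → s < t →
            proj (γ s) ∉ sectionSet (fun q => toCover L (secU n q)) (secOver n (ballB P.lam)) := by
    intro q hq
    obtain ⟨γ, h0, H⟩ := exists_orb_secU (Q := Q) hg (secOver_mono sdiff_subset hq)
    have hf : (secU n q).1 = 4 := rfl
    obtain ⟨hm, t, ht, he, hn⟩ := H.loop_secU hg (by rw [h0, hf]; norm_num)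
      (by rw [h0, hf]) (by rw [h0]; exact hq.1.2)
    rw [h0, exitq_secU hq] at hm he
    refine ⟨hm, _, isForwardOrbit_region (L := L) H, by rw [h0], t, ht, toAmb_eq_iff.2 ⟨_, he⟩,
      fun s hs hst => notMem_sectionSet fun m q _ => hn s hs hst m q⟩
  refine ⟨secOver_mono sdiff_subset, fun q hq => (key q hq).1, fun q hq => (key q hq).2,
    fun q hq => ?_⟩
  obtain ⟨γ, h0, H⟩ := exists_orb_secU (Q := Q) hg hq.1
  refine ⟨_, isForwardOrbit_region (L := L) H, by rw [h0], fun s hs => ?_⟩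
  exact notMem_sectionSet fun m q _ => (H.stable_no_hit hg h0 (z_eq_zero hq) hs m).1 q

lemma orbit_of_region (hg : P.Good mu) {y : Ambient n} (hy : y ∈ Q.region L (1 / 2)) :
    ∃ γ : ℝ → Cover n, IsForwardOrbit (Q.field L mu) (Q.region L (1 / 2)) γ ∧ proj (γ 0) = y ∧
      ((∃ t : ℝ, 0 ≤ t ∧ proj (γ t) ∈
          sectionSet (fun q => toCover L (secU n q)) (secOver n (ballB P.lam))) ∨
        ∀ t : ℝ, 0 ≤ t → proj (γ t) ∈ Q.stableSet L) := by
  obtain ⟨p, rfl⟩ := (isOpenQuotientMap_toAmb (L := L)).surjective y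
  obtain ⟨m, h3, h10⟩ := exists_sh p
  obtain ⟨γ, h0, H⟩ := exists_orb (Q := Q) hg (p := sh m p) (by rw [Thp_sh]; exact mem_region.1 hy)
  refine ⟨_, isForwardOrbit_region (L := L) H, ?_, ?_⟩
  · show toAmb L (γ 0) = _
    rw [h0]
    exact (toAmb_eq_iff.2 ⟨m, rfl⟩).symm
  · rw [← h0] at h3 h10
    rcases H.secU_or_stable hg h3 h10 with ⟨t, ht, k, q, hq, he⟩ | ⟨hz, h1, h7⟩
    · exact Or.inl ⟨t, ht, q, hq, (toAmb_eq_iff.2 ⟨k, he⟩).symm⟩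
    · exact Or.inr fun t ht => stable_stays hg H h1 h7 hz ht

lemma stableSet_inter_secU : Q.stableSet L ∩
    sectionSet (fun q => toCover L (secU n q)) (secOver n (ballB P.lam)) =
      sectionSet (fun q => toCover L (secU n q)) (secOver n {0}) := by
  have h0 : (0 : ℂ) ∈ ballB P.lam := by
    have := P.R_ge
    show ‖(0 : ℂ)‖ ≤ P.R
    rw [norm_zero]; linarith
  ext y
  constructor
  · rintro ⟨hy, q, hq, rfl⟩
    exact ⟨q, ⟨(mem_stableSet.1 hy).2, hq.2⟩, rfl⟩
  · rintro ⟨q, hq, rfl⟩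
    have hq' : q ∈ secOver n (ballB P.lam) := secOver_mono (singleton_subset_iff.2 h0) hq
    refine ⟨mem_stableSet.2 ⟨⟨by rw [Thp_secU hq']; norm_num, 0, ?_⟩, hq.1⟩, q, hq', rfl⟩
    rw [sh_zero]
    exact ⟨by norm_num [secU], by norm_num [secU]⟩

end Tube
end transport

/-! ### Choice of the parameters -/

/-- The fibre has real dimension 2 + 2 + (n - 5) = n - 1; scaling places the bounded region inside
the solid torus. -/
lemma exists_linearEquiv {n : ℕ} (hn : 5 ≤ n) (B : ℝ) :
    ∃ L : Sec n ≃L[ℝ] EuclideanSpace ℝ (Fin (n - 1)), ∀ q, ‖q‖ ≤ B → ‖L q‖ ≤ 1 := by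
  have hf : Module.finrank ℝ (Sec n) = Module.finrank ℝ (EuclideanSpace ℝ (Fin (n - 1))) := by
    rw [Module.finrank_prod, Module.finrank_prod, Complex.finrank_real_complex,
      finrank_euclideanSpace_fin, finrank_euclideanSpace_fin]
    omega
  let e : Sec n ≃L[ℝ] EuclideanSpace ℝ (Fin (n - 1)) := ContinuousLinearEquiv.ofFinrankEq hf
  set M : ℝ := ‖(e : Sec n →L[ℝ] EuclideanSpace ℝ (Fin (n - 1)))‖ * |B| + 1 with hM
  have hM0 : 0 < M := by positivity
  refine ⟨e.trans (ContinuousLinearEquiv.smulLeft (Units.mk0 M⁻¹ (inv_pos.2 hM0).ne')),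
    fun q hq => ?_⟩
  show ‖M⁻¹ • e q‖ ≤ 1
  have h1 : ‖e q‖ ≤ ‖(e : Sec n →L[ℝ] EuclideanSpace ℝ (Fin (n - 1)))‖ * ‖q‖ :=
    (e : Sec n →L[ℝ] EuclideanSpace ℝ (Fin (n - 1))).le_opNorm q
  have h2 := mul_le_mul_of_nonneg_left (hq.trans (le_abs_self B))
    (norm_nonneg (e : Sec n →L[ℝ] EuclideanSpace ℝ (Fin (n - 1))))
  rw [norm_smul, norm_inv, Real.norm_eq_abs, abs_of_pos hM0, inv_mul_le_iff₀ hM0, mul_one]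
  linarith

/-- The function `gg` is bounded by a constant plus a multiple of log(4/cs), and cs log cs tends to
0. -/
lemma exists_cs {sig a b r : ℝ} (hs : 0 < sig) (ha : 0 < a) (hab : a < b) :
    ∃ cs, 0 < cs ∧ cs * r ≤ 1 / 4 ∧
      ∀ x, sig * gg a b (2 * Real.log (4 / cs)) x * cs ≤ 1 / 2 := by
  have hc : Continuous (deriv (stp a b)) := (contDiff_deriv_stp a b).continuous
  obtain ⟨M1, hM1⟩ := (isCompact_Icc (a := a) (b := b)).exists_bound_of_continuousOn
    (f := fun x => x * deriv (stp a b) x) (continuous_id.mul hc).continuousOn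
  obtain ⟨M2, hM2⟩ := (isCompact_Icc (a := a) (b := b)).exists_bound_of_continuousOn
    (f := fun x => x * deriv (stp a b) x * Real.log x)
    ((continuous_id.mul hc).continuousOn.mul (Real.continuousOn_log.mono fun x hx =>
      (ha.trans_le hx.1).ne'))
  have hM1' : 0 ≤ M1 := (norm_nonneg _).trans (hM1 a ⟨le_rfl, hab.le⟩)
  have hM2' : 0 ≤ M2 := (norm_nonneg _).trans (hM2 a ⟨le_rfl, hab.le⟩)
  have h1 : ∀ᶠ c : ℝ in 𝓝 0, sig * (c * (1 + M2) + 2 * M1 * (c * Real.log 4 - c * Real.log c)) < 1 / 2 := by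
    have hcont : Continuous fun c : ℝ =>
        sig * (c * (1 + M2) + 2 * M1 * (c * Real.log 4 - c * Real.log c)) :=
      continuous_const.mul ((continuous_id.mul continuous_const).add (continuous_const.mul
        ((continuous_id.mul continuous_const).sub Real.continuous_mul_log)))
    exact hcont.continuousAt.eventually_lt_const (by norm_num)
  have h2 : ∀ᶠ c : ℝ in 𝓝 0, c * r < 1 / 4 :=
    (continuous_id.mul continuous_const).continuousAt.eventually_lt_const (by norm_num)
  have h3 : ∀ᶠ c : ℝ in 𝓝 0, c < 1 := gt_mem_nhds one_pos
  obtain ⟨cs, ⟨hcs1, hcs2, hcs3⟩, hcs0⟩ := (((h1.and (h2.and h3)).filter_mono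
    (nhdsWithin_le_nhds (s := Ioi 0))).and self_mem_nhdsWithin).exists
  have hcs0 : 0 < cs := hcs0
  refine ⟨cs, hcs0, hcs2.le, fun x => ?_⟩
  have hlog : Real.log (4 / cs) = Real.log 4 - Real.log cs := Real.log_div (by norm_num) hcs0.ne'
  have hlog0 : 0 ≤ Real.log (4 / cs) := by
    apply Real.log_nonneg
    rw [le_div_iff₀ hcs0]; linarith
  have hgg : gg a b (2 * Real.log (4 / cs)) x ≤ 1 + M2 + 2 * M1 * Real.log (4 / cs) := by
    have hp : 0 ≤ 2 * M1 * Real.log (4 / cs) := by positivity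
    rcases lt_or_ge x a with hx | hx
    · rw [gg_of_le hab hx.le]; linarith
    rcases lt_or_ge b x with hx' | hx'
    · rw [gg_of_ge hab hx'.le]; linarith
    have h4 := (abs_le.1 (hM1 x ⟨hx, hx'⟩)).1
    have h5 := (abs_le.1 (hM2 x ⟨hx, hx'⟩)).2
    have h6 := stp_le_one a b x
    have h7 := mul_le_mul_of_nonneg_right h4 hlog0
    unfold gg
    nlinarith
  have h8 : sig * gg a b (2 * Real.log (4 / cs)) x * cs ≤
      sig * (1 + M2 + 2 * M1 * Real.log (4 / cs)) * cs :=
    mul_le_mul_of_nonneg_right (mul_le_mul_of_nonneg_left hgg hs.le) hcs0.le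
  rw [hlog] at h8
  have e : sig * (1 + M2 + 2 * M1 * (Real.log 4 - Real.log cs)) * cs =
      sig * (cs * (1 + M2) + 2 * M1 * (cs * Real.log 4 - cs * Real.log cs)) := by ring
  rw [hlog]
  linarith

/-- The choice of the parameters of the construction. -/
lemma exists_tube (n : ℕ) {sig eta lam : ℝ} (hs : 0 < sig) (he : 0 < eta) (hl : 1 / 2 < lam)
    (hl1 : lam < 1) : ∃ eps betaBar : ℝ, 0 < eps ∧ eps < 1 / 2 ∧ 0 < betaBar ∧ betaBar ≤ eps ∧
      ∀ beta ∈ Ioo 0 betaBar, ∃ P : Par, P.sig = sig ∧ P.eta = eta ∧ P.lam = lam ∧ P.bet = beta ∧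
        P.eps = eps ∧ Nonempty (Tube n P) := by
  set R : ℝ := 2 * (1 - lam)⁻¹ with hR
  have hR0 : 0 < R := mul_pos two_pos (inv_pos.2 (by linarith))
  obtain ⟨cs, hcs, hcs1, hcs2⟩ := exists_cs (sig := sig) (a := (4 * (R + 1)) ^ 2)
    (b := (8 * (R + 1)) ^ 2) (r := R + 1) hs (by positivity)
    (pow_lt_pow_left₀ (by linarith) (by positivity) (by norm_num))
  obtain ⟨δ, hδ, S, g, hS, hg, hr, hleft⟩ := exists_chart (cs := cs) (lam := lam) (sig := sig) n
    (Real.log (8 * (R + 1) + 1) / sig + 1) hcs (by linarith) hs (r0 := (1 - lam) / 20) R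
    (by linarith)
  have hlog : 0 ≤ eta / sig * Real.log (8 * (R + 1)) :=
    mul_nonneg (div_pos he hs).le (Real.log_nonneg (by linarith))
  -- ε = min(1/6, δ/3): the first entry is below 1/5, the second makes 3ε ≤ δ, the fibre size of the
  -- chart.
  have h0 : 0 < min (1 / 6) (δ / 3) := lt_min (by norm_num) (by linarith)
  have h6 := min_le_left (1 / 6) (δ / 3)
  have h3 := min_le_right (1 / 6) (δ / 3)
  set eps := min (1 / 6) (δ / 3) with heps
  -- The bound for β is ε R2^(-η/σ), the exponential form of `bet_le`.
  refine ⟨eps, Real.exp (Real.log eps - eta / sig * Real.log (8 * (R + 1))), h0, by linarith,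
    Real.exp_pos _, ?_, fun beta hb => ?_⟩
  · calc _ ≤ Real.exp (Real.log eps) := Real.exp_le_exp.2 (by linarith)
      _ = eps := Real.exp_log h0
  · have hbl : Real.log beta ≤ Real.log eps - eta / sig * Real.log (8 * (R + 1)) :=
      ((Real.log_lt_iff_lt_exp hb.1).2 hb.2).le
    let P : Par :=
      { sig := sig, eta := eta, lam := lam, cs := cs, eps := eps, bet := beta
        nu := cs * (1 - lam) / (2 * lam) / 8
        sig_pos := hs, eta_pos := he, half_le_lam := hl.le, lam_lt := hl1, cs_pos := hcs
        cs_le := hcs1, eps_pos := h0, eps_lt := by linarith, bet_pos := hb.1, bet_le := hbl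
        nu_pos := div_pos (div_pos (mul_pos hcs (by linarith)) (by linarith)) (by norm_num)
        nu_le := le_rfl, slow := hcs2 }
    refine ⟨P, rfl, rfl, rfl, rfl, rfl, ⟨⟨S, g, hS, hg, hr, fun f hf q h1 h2 hw hv => ?_⟩⟩⟩
    exact hleft f hf q h1 h2 (hw.trans_le (by show 3 * eps ≤ δ; linarith))
      (hv.trans_le (by show 3 * eps ≤ δ; linarith))

end

end WildLorenz

open WildLorenz
theorem mainTheorem7 (n : ℕ) (hn : 5 ≤ n) (eta sigma : ℝ) (hsigma : 0 < sigma)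
    (heta : sigma < eta) :
    ∃ lam₀ ∈ Ioo (0 : ℝ) 1, ∀ lam ∈ Ioo lam₀ 1, ∃ betaBar : ℝ, 0 < betaBar ∧
    ∀ beta ∈ Ioo (0 : ℝ) betaBar,
    ∃ beta₀ ∈ Ioo (0 : ℝ) 1, ∃ beta₁ ∈ Ioo (0 : ℝ) (1 / 2), beta₀ * beta₁ = beta ∧
    ∃ mu₀ ∈ Ioo (0 : ℝ) sigma,
    ∃ (U V : Set (Ambient n)) (X : ℝ → Ambient n → Cover n),
      -- the smooth family, on an open neighbourhood `V` of the closure of the open set `U`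
      IsOpen U ∧ IsOpen V ∧ closure U ⊆ V ∧ V ⊆ solidTorus n ∧
      closure U ⊆ interior (solidTorus n) ∧ HasSmoothBoundary U ∧
      IsSmoothFamily X (Icc mu₀ sigma) V ∧
      ∀ mu ∈ Icc mu₀ sigma,
        PointsInward (X mu) U ∧
        ∃ o : Cover n, proj o ∈ U ∧
          -- the unique singularity and its eigenvalues with their multiplicities
          (∀ p ∈ V, X mu p = 0 ↔ p = proj o) ∧
          IsHyperbolicSingularity (X mu) o ∧
          (linearPart (X mu) o).charpoly =
            (Polynomial.X - Polynomial.C (-mu)) * (Polynomial.X - Polynomial.C sigma) ^ 2 *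
              (Polynomial.X - Polynomial.C (-eta)) ^ (n - 3) ∧
          -- the cross-sections and the local stable manifold
          ∃ (PhiU PhiS : Sec n → Cover n) (W : Set (Ambient n)),
            IsCrossSection (X mu) U PhiU (secOver n (ballB lam)) ∧
            IsCrossSection (X mu) U PhiS (secOver n (annulusB lam)) ∧
            IsLocalStableManifold (X mu) U (proj o) 2 W ∧
            (∀ p ∈ U, ∃ γ : ℝ → Cover n, IsForwardOrbit (X mu) U γ ∧ proj (γ 0) = p ∧
              ((∃ t : ℝ, 0 ≤ t ∧ proj (γ t) ∈ sectionSet PhiU (secOver n (ballB lam))) ∨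
                ∀ t : ℝ, 0 ≤ t → proj (γ t) ∈ W)) ∧
            W ∩ sectionSet PhiU (secOver n (ballB lam)) = sectionSet PhiU (secOver n {0}) ∧
            -- the Poincaré maps and the first return map
            IsPoincareMap (X mu) U PhiU (secOver n (ballB lam)) PhiS (secOver n (annulusB lam))
              (secOver n (ballB lam \ {0})) (mapThat n eta sigma beta₀ lam mu) ∧
            IsPoincareMap (X mu) U PhiS (secOver n (annulusB lam)) PhiU (secOver n (ballB lam))
              (secOver n (annulusB lam)) (mapGhat n beta₁) ∧
            IsPoincareMap (X mu) U PhiU (secOver n (ballB lam)) PhiU (secOver n (ballB lam))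
              (secOver n (ballB lam \ {0})) (mapFhat n eta sigma beta lam mu) := by
  -- Every λ > 1/2 is close enough to 1.
  refine ⟨1 / 2, ⟨by norm_num, by norm_num⟩, fun lam hlam => ?_⟩
  obtain ⟨eps, betaBar, he0, he2, hb0, hbe, hP⟩ :=
    exists_tube n hsigma (hsigma.trans heta) hlam.1 hlam.2
  refine ⟨betaBar, hb0, fun beta hbeta => ?_⟩
  obtain ⟨P, rfl, rfl, rfl, rfl, rfl, ⟨Q⟩⟩ := hP beta hbeta
  -- β₁ = ε is fixed before β, and β₀ = β/ε lies below 1 because β < betaBar ≤ ε.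
  refine ⟨P.bet / P.eps, ⟨div_pos P.bet_pos he0, (div_lt_one he0).2 (hbeta.2.trans_le hbe)⟩, P.eps,
    ⟨he0, he2⟩, div_mul_cancel₀ _ he0.ne', ?_⟩
  obtain ⟨mu₀, hmu₀, hgood⟩ := P.exists_good
  obtain ⟨B, hB, -⟩ := Tube.Yp_zero_of_norm (Q := Q)
  -- B bounds the fibre of the whole set `Thp` > 0, so V as well as U fits into the solid torus.
  obtain ⟨L, hL⟩ := exists_linearEquiv hn B
  have hV : Q.region L (1 / 4) ⊆ solidTorus n := by
    intro y hy
    have h1 : (1 / 4 : ℝ) < Q.Thp (rep L y) := hy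
    rw [← toAmb_rep (L := L) y]
    exact ⟨mem_univ _, mem_closedBall_zero_iff.2 (hL _ (hB _ (lt_trans (by norm_num) h1)))⟩
  have hU : closure (Q.region L (1 / 2)) ⊆ Q.region L (1 / 4) :=
    Tube.closure_region_subset (by norm_num)
  refine ⟨mu₀, hmu₀, Q.region L (1 / 2), Q.region L (1 / 4), Q.field L, Tube.isOpen_region,
    Tube.isOpen_region, hU, hV, hU.trans (interior_maximal hV Tube.isOpen_region),
    fun x hx => ⟨_, (Tube.boundary (hgood mu₀ ⟨le_rfl, hmu₀.2.le⟩) hx).1⟩,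
    Tube.isSmoothFamily_field _ _, fun mu hmu => ?_⟩
  have hg := hgood mu hmu
  refine ⟨fun x hx => ⟨_, Tube.boundary hg hx⟩, toCover L 0, ?_,
    fun p hp => Tube.field_eq_zero_iff hg hp, Tube.isHyperbolicSingularity hn hg.1.1,
    Tube.charpoly_field hn, _, _, Q.stableSet L, Tube.isCrossSection_secU, Tube.isCrossSection_secS,
    Tube.isLocalStableManifold hg, fun p hp => Tube.orbit_of_region hg hp,
    Tube.stableSet_inter_secU, Tube.poincare_US hg, Tube.poincare_SU hg, Tube.poincare_UU hg⟩
  exact Tube.mem_region.2 (by rw [Tube.Thp_zero]; norm_num)
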